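/- **Setting.** For every security parameter $\lambda$ let $q=q(\lambda)$ be a prime and $n=n(\lambda)$ with $2+4(2^{n}-1)<q$. Let $(\mathsf{Gen},\mathsf{Enc})$ be an additively homomorphic public-key encryption scheme with plaintexts in $\mathbb F_q$: randomness and ciphertexts form $\mathbb F_q$-modules (written additively), $(m,r)\mapsto \mathsf{Enc}_{pk}(m;r)$ is $\mathbb F_q$-linear, and any secret key for $pk$ recognizes exactly the encryptions of $0$ among the ciphertexts $\mathsf{Enc}_{pk}(m;r)$ (for example exponential ElGamal, $\mathsf{Enc}_h(m;r)=(g^r,h^rg^m)$, in a group of prime order $q$). Let $\mathsf{Com}$ be a commitment scheme with messages in $\mathbb F_q$ and parameters from a trusted setup. All algorithms of the two schemes run in non-uniform probabilistic polynomial time. Assume that encryption is semantically secure and that $\mathsf{Com}$ is (computationally) hiding and binding. **Comparison algorithm.** For $a_j,b_j$ ($0\le j<n$) in an $\mathbb F_q$-module with an element $e$ that represents $1$, put $w_j=\sum_{k<j}2^{2+k}(a_k-b_k)$, $c_{0,j}=e+a_j-b_j+w_j$, $c_{1,j}=-e+a_j-b_j+w_j$ for $j<n$, and $c_{0,n}=c_{1,n}=w_n$.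 For a uniform permutation $\pi$ of $\{0,\dots,n\}$ and independent uniform $s_{i,j}\in\mathbb F_q\setminus\{0\}$ output $d_{i,j}=s_{i,j}\,c_{i,\pi(j)}$. **Protocol $\Pi_{\min}^{\sf B2C}$** (in the hybrid model with ideal zero-knowledge functionalities, which receive the witness from $P_0$, check the relation and answer accept or reject to $P_1$). $P_i$ holds $v_i\in\{0,\dots,2^n-1\}$ with big-endian bits $v_{i,j}$. 1. $P_0$ generates keys $(pk,sk)$ and sends $pk$, $V_0=\mathsf{Com}(v_0;r_0)$ and $A_j=\mathsf{Enc}_{pk}(v_{0,j})$ for $0\le j<n$. It proves that $V_0$ and $\sum_j 2^{n-1-j}A_j$ contain the same message, and that every $A_j$ contains a bit; the witnesses are openings of these commitments and ciphertexts. 2. If a proof is rejected, $P_1$ aborts. Otherwise it runs the comparison algorithm on the ciphertexts $A_j$ and on encryptions of its bits $v_{1,j}$ (with an encryption of $1$ as $e$), re-randomizes every resulting ciphertext $D_{i,j}$ by adding a fresh encryption of $0$, and sends $(D_{0,j})_{j=0}^n$, $(D_{1,j})_{j=0}^n$ to $P_0$. 3. $P_0$ lets $b_i$ be true if some $D_{i,j}$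 is an encryption of $0$, puts $u=0$ if $b_0$ is true and $u=1$ otherwise, sends $u$, and proves that one of $D_{u,0},\dots,D_{u,n}$ encrypts $0$ (the witness is an index and a secret key for $pk$). If $u=0$ it also opens $V_0$ by sending $(v_0,r_0)$. 4. If the proof (and for $u=0$ the opening) is accepted, $P_1$ outputs $v_u$, and if $u=1$ it sends $v_1$ to $P_0$; otherwise $P_1$ aborts. $P_0$ outputs $v_u$. **Functionality ${\cal F}_{\min}^{\sf B2C}$.** On inputs $v_0,v_1$ both parties receive $\min\{v_0,v_1\}$; a corrupted party moreover learns whether $v_0=v_1$. If $P_0$ is malicious, it receives its output first and then decides whether $P_1$ receives the minimum or $\bot$. **Theorem.** The protocol $\Pi_{\min}^{\sf B2C}$ securely computes ${\cal F}_{\min}^{\sf B2C}$ in the presence of a malicious $P_0$ or a semi-honest $P_1$. That is: * without corruptions, both parties output $\min\{v_0,v_1\}$; * for every non-uniform probabilistic polynomial-time adversary that controls $P_0$ (and may in particular choose $pk$ arbitrarily) there is a non-uniform probabilistic polynomial-time simulator such that for all inputs $v_0,v_1$ and auxiliary inputs $z$ the joint output of the adversary and of $P_1$ in the protocol is computationally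 indistinguishable from the joint output of the simulator and of $P_1$ in the ideal execution with ${\cal F}_{\min}^{\sf B2C}$; * for every non-uniform probabilistic polynomial-time adversary that sees the view of a $P_1$ which follows the protocol there is such a simulator, which sends $v_1$ to ${\cal F}_{\min}^{\sf B2C}$, such that the joint output of the adversary and of $P_0$ is computationally indistinguishable from the joint output of the simulator and of $P_0$ in the ideal execution. -/

import Mathlib

open scoped BigOperators

noncomputable section

namespace BankToClient

/-! ### Binary encodings -/

/-- A fixed-length binary encoding of a type. -/
class BitCode (α : Type) where
  len : ℕ
  code : α → Fin len → Bool
  inj : Function.Injective code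

/-- The length of the encoding of `α`. -/
abbrev len (α : Type) [BitCode α] : ℕ := BitCode.len α

/-- The encoding of an element. -/
abbrev code {α : Type} [BitCode α] (x : α) : Fin (len α) → Bool := BitCode.code x

/-- Bit strings of length `m`. -/
abbrev Bits (m : ℕ) : Type := Fin m → Bool

instance : BitCode Unit where
  len := 0
  code _ := Fin.elim0
  inj _ _ _ := rfl

instance : BitCode Bool where
  len := 1
  code b _ := b
  inj _ _ h := congrFun h 0

/-- Numbers below `m` in binary. -/
instance (m : ℕ) : BitCode (Fin m) where
  len := Nat.size m
  code x i := x.val.testBit i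
  inj x y h := by
    apply Fin.ext
    apply Nat.eq_of_testBit_eq
    intro i
    by_cases hi : i < Nat.size m
    · exact congrFun h ⟨i, hi⟩
    · have hm : m ≤ 2 ^ i := (Nat.lt_size_self m).le.trans
        (Nat.pow_le_pow_right (by norm_num) (not_lt.1 hi))
      rw [Nat.testBit_lt_two_pow (lt_of_lt_of_le x.2 hm),
        Nat.testBit_lt_two_pow (lt_of_lt_of_le y.2 hm)]

instance {α β : Type} [BitCode α] [BitCode β] : BitCode (α × β) where
  len := len α + len β
  code x := Fin.append (code x.1) (code x.2)
  inj x y h := by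
    refine Prod.ext (BitCode.inj ?_) (BitCode.inj ?_)
    · funext i
      simpa using congrFun h (Fin.castAdd _ i)
    · funext i
      simpa using congrFun h (Fin.natAdd _ i)

instance {α : Type} [BitCode α] : BitCode (Option α) where
  len := len α + 1
  code
    | none => fun _ => false
    | some x => Fin.cons true (code x)
  inj x y h := by
    match x, y with
    | none, none => rfl
    | none, some y => exact absurd (congrFun h 0) (by simp)
    | some x, none => exact absurd (congrFun h 0) (by simp)
    | some x, some y =>
      refine congrArg some (BitCode.inj ?_)
      funext i
      simpa using congrFun h i.succ

/-- Finite sequences, by concatenation. -/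
instance {t : ℕ} {β : Fin t → Type} [∀ i, BitCode (β i)] : BitCode (∀ i, β i) where
  len := ∑ i, len (β i)
  code f j := code (f (finSigmaFinEquiv.symm j).1) (finSigmaFinEquiv.symm j).2
  inj f g h := by
    funext i
    refine BitCode.inj ?_
    funext l
    have key : ∀ p : (i : Fin t) × Fin (len (β i)), code (f p.1) p.2 = code (g p.1) p.2 := by
      intro p
      obtain ⟨j, rfl⟩ := finSigmaFinEquiv.symm.surjective p
      exact congrFun h j
    exact key ⟨i, l⟩

instance {α : Type} [BitCode α] (p : α → Prop) : BitCode {x // p x} where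
  len := len α
  code x := code x.1
  inj _ _ h := Subtype.ext (BitCode.inj h)

instance {G : Type} [BitCode G] : BitCode (Additive G) where
  len := len G
  code x := code x.toMul
  inj _ _ h := Additive.toMul.injective (BitCode.inj (α := G) h)

/-- Permutations, as tables of values. -/
instance (m : ℕ) : BitCode (Equiv.Perm (Fin m)) where
  len := len (Fin m → Fin m)
  code e := code (fun i => e i)
  inj _ _ h := Equiv.ext (congrFun (BitCode.inj h))

/-- Residues modulo `q`, as numbers below `q` in binary. -/
instance (q : ℕ) [NeZero q] : BitCode (ZMod q) where
  len := len (Fin q)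
  code x := code (⟨x.val, x.val_lt⟩ : Fin q)
  inj _ _ h := ZMod.val_injective q (congrArg Fin.val (BitCode.inj h))

/-! ### Boolean circuits and non-uniform polynomial time -/

/-- A Boolean circuit with `a` inputs and `b` outputs: a straight-line program of NAND gates.
Wires `0, …, a - 1` are the inputs, each gate reads two earlier wires and adds one wire, and a wire
that does not exist carries `false`. -/
structure Circuit (a b : ℕ) where
  gates : List (ℕ × ℕ)
  out : Fin b → ℕ

/-- The number of gates, inputs and outputs. -/
def Circuit.size {a b : ℕ} (C : Circuit a b) : ℕ := C.gates.length + a + b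

/-- The values of all wires of `C` on input `x`. -/
def Circuit.wires {a b : ℕ} (C : Circuit a b) (x : Fin a → Bool) : List Bool :=
  C.gates.foldl (fun w g => w ++ [!(w.getD g.1 false && w.getD g.2 false)]) (List.ofFn x)

def Circuit.eval {a b : ℕ} (C : Circuit a b) (x : Fin a → Bool) : Fin b → Bool :=
  fun i => (C.wires x).getD (C.out i) false

/-- A family of functions, indexed by the security parameter `k`, that is computed (on encodings) by
circuits of size polynomial in `k`: non-uniform deterministic polynomial time. -/
def PolySize {α β : ℕ → Type} [∀ k, BitCode (α k)] [∀ k, BitCode (β k)]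
    (f : ∀ k, α k → β k) : Prop :=
  ∃ p : Polynomial ℕ, ∀ k, ∃ C : Circuit (len (α k)) (len (β k)),
    C.size ≤ p.eval k ∧ ∀ x, C.eval (code x) = code (f k x)

/-- A family of randomized functions that is computed by circuits of polynomial size from their
input and from independent uniform draws from sets `{0, …, m}`: non-uniform probabilistic polynomial
time. (Coin flips are the draws with `m = 1`.) -/
def PolySampler {α β : ℕ → Type} [∀ k, BitCode (α k)] [∀ k, BitCode (β k)]
    (f : ∀ k, α k → PMF (β k)) : Prop :=
  ∃ (t : ℕ → ℕ) (m : ∀ k, Fin (t k) → ℕ)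
    (g : ∀ k, α k × (∀ i : Fin (t k), Fin (m k i + 1)) → β k),
    PolySize g ∧
      ∀ k x, (PMF.uniformOfFintype (∀ i : Fin (t k), Fin (m k i + 1))).map
        (fun ω => g k (x, ω)) = f k x

/-- The probability of the event `D` under `p`. -/
def prob {α : Type} (p : PMF α) (D : α → Bool) : ℝ := ((p.map D) true).toReal

/-- A function of the security parameter that decays faster than every inverse polynomial. -/
def Negligible (f : ℕ → ℝ) : Prop :=
  Asymptotics.SuperpolynomialDecay Filter.atTop (fun k : ℕ => (k : ℝ)) f

/-- Computational indistinguishability against non-uniform polynomial-time distinguishers. -/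
def Indist {O : ℕ → Type} [∀ k, BitCode (O k)] (X Y : ∀ k, PMF (O k)) : Prop :=
  ∀ D : ∀ k, O k → Bool, PolySize D →
    Negligible (fun k => |prob (X k) (D k) - prob (Y k) (D k)|)

/-! ### Additively homomorphic encryption -/

/-- A public-key encryption scheme with plaintexts in `𝔽_q` whose randomness and ciphertexts form
`𝔽_q`-modules (written additively) and whose encryption is linear in plaintext and randomness.
Decryption is only used to recognize the encryptions of `0`; `isKey pk sk` says that `sk` is a secret
key for `pk`. -/
structure HomEnc (q : ℕ) where
  PK : Type
  SK : Type
  Rnd : Type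
  CT : Type
  [codePK : BitCode PK]
  [codeSK : BitCode SK]
  [codeRnd : BitCode Rnd]
  [codeCT : BitCode CT]
  [fintypeRnd : Fintype Rnd]
  [groupRnd : AddCommGroup Rnd]
  [moduleRnd : Module (ZMod q) Rnd]
  [groupCT : AddCommGroup CT]
  [moduleCT : Module (ZMod q) CT]
  gen : PMF (PK × SK)
  enc : PK → (ZMod q × Rnd) →ₗ[ZMod q] CT
  isKey : PK → SK → Bool
  isZero : SK → CT → Bool
  isKey_gen : ∀ p ∈ gen.support, isKey p.1 p.2 = true
  isZero_enc : ∀ pk sk, isKey pk sk = true → ∀ m r, isZero sk (enc pk (m, r)) = true ↔ m = 0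

attribute [instance] HomEnc.codePK HomEnc.codeSK HomEnc.codeRnd HomEnc.codeCT HomEnc.fintypeRnd
  HomEnc.groupRnd HomEnc.moduleRnd HomEnc.groupCT HomEnc.moduleCT

/-- The algorithms of the scheme run in (non-uniform) polynomial time. -/
structure HomEnc.Efficient {q : ℕ → ℕ} [∀ k, Fact (q k).Prime] (E : ∀ k, HomEnc (q k)) : Prop where
  gen : PolySampler (α := fun _ => Unit) (β := fun k => (E k).PK × (E k).SK)
    (fun k _ => (E k).gen)
  rnd : PolySampler (α := fun _ => Unit) (β := fun k => (E k).Rnd)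
    (fun k _ => PMF.uniformOfFintype (E k).Rnd)
  enc : PolySize (α := fun k => (E k).PK × (ZMod (q k) × (E k).Rnd)) (β := fun k => (E k).CT)
    (fun k x => (E k).enc x.1 x.2)
  add : PolySize (α := fun k => (E k).CT × (E k).CT) (β := fun k => (E k).CT)
    (fun _ x => x.1 + x.2)
  isKey : PolySize (α := fun k => (E k).PK × (E k).SK) (β := fun _ => Bool)
    (fun k x => (E k).isKey x.1 x.2)
  isZero : PolySize (α := fun k => (E k).SK × (E k).CT) (β := fun _ => Bool)
    (fun k x => (E k).isZero x.1 x.2)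

/-- Public key and encryption of `m`. -/
def HomEnc.sample {q : ℕ} (E : HomEnc q) (m : ZMod q) : PMF (E.PK × E.CT) := do
  let key ← E.gen
  let r ← PMF.uniformOfFintype E.Rnd
  pure (key.1, E.enc key.1 (m, r))

/-- Semantic security: encryptions of any two plaintexts are indistinguishable given the public
key. -/
def HomEnc.Secure {q : ℕ → ℕ} (E : ∀ k, HomEnc (q k)) : Prop :=
  ∀ m₀ m₁ : ∀ k, ZMod (q k), Indist (fun k => (E k).sample (m₀ k)) (fun k => (E k).sample (m₁ k))

/-- Exponential ElGamal encryption, `Enc_h(m; r) = (g ^ r, h ^ r * g ^ m)` with `h = g ^ x`, in a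
group of prime order `q` with generator `g`. A ciphertext `(c₁, c₂)` encrypts `0` if and only if
`c₂ = c₁ ^ x`. -/
def expElGamal (q : ℕ) [Fact q.Prime] (G : Type) [CommGroup G] [BitCode G]
    (hG : Nat.card G = q) (g : G) (hg : g ≠ 1) : HomEnc q :=
  have hpow : ∀ a : G, a ^ q = 1 := fun a => hG ▸ pow_card_eq_one'
  letI : Module (ZMod q) (Additive G) :=
    AddCommGroup.zmodModule (fun a => congrArg Additive.ofMul (hpow a.toMul))
  { PK := G
    SK := ZMod q
    Rnd := ZMod q
    CT := Additive G × Additive G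
    gen := (PMF.uniformOfFintype (ZMod q)).map (fun x => (g ^ x.val, x))
    enc := fun h =>
      LinearMap.prod
        ((LinearMap.toSpanSingleton (ZMod q) (Additive G) (Additive.ofMul g)).comp
          (LinearMap.snd (ZMod q) (ZMod q) (ZMod q)))
        ((LinearMap.toSpanSingleton (ZMod q) (Additive G) (Additive.ofMul h)).comp
            (LinearMap.snd (ZMod q) (ZMod q) (ZMod q)) +
          (LinearMap.toSpanSingleton (ZMod q) (Additive G) (Additive.ofMul g)).comp
            (LinearMap.fst (ZMod q) (ZMod q) (ZMod q)))
    isKey := fun h x => open Classical in decide (h = g ^ x.val)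
    isZero := fun x c => open Classical in decide (c.2 = x • c.1)
    isKey_gen := by
      intro p hp
      simp only [PMF.support_map, Set.mem_image] at hp
      obtain ⟨x, -, rfl⟩ := hp
      simp
    isZero_enc := by
      intro h x hx m r
      have hsmul : ∀ (y : ZMod q) (a : G), y • Additive.ofMul a = Additive.ofMul (a ^ y.val) := by
        intro y a
        conv_lhs => rw [← ZMod.natCast_zmod_val y, Nat.cast_smul_eq_nsmul]
        rfl
      have hx' : h = g ^ x.val := by simpa using hx
      have hh : Additive.ofMul h = x • Additive.ofMul g := by rw [hx', hsmul]
      have hg0 : Additive.ofMul g ≠ 0 := fun e => hg e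
      have hc : r • x • Additive.ofMul g = x • r • Additive.ofMul g := smul_comm r x _
      have hd : (r • Additive.ofMul h + m • Additive.ofMul g = x • r • Additive.ofMul g) ↔ m = 0 := by
        rw [hh, hc, add_eq_left, smul_eq_zero]
        exact or_iff_left hg0
      simpa using hd }

/-! ### Commitments -/

/-- A commitment scheme with messages in `M`. -/
structure ComScheme (M : Type) where
  Par : Type
  Rnd : Type
  Com : Type
  [codePar : BitCode Par]
  [codeRnd : BitCode Rnd]
  [codeCom : BitCode Com]
  [fintypeRnd : Fintype Rnd]
  [nonemptyRnd : Nonempty Rnd]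
  gen : PMF Par
  com : Par → M → Rnd → Com

attribute [instance] ComScheme.codePar ComScheme.codeRnd ComScheme.codeCom ComScheme.fintypeRnd
  ComScheme.nonemptyRnd

/-- The algorithms of the scheme run in (non-uniform) polynomial time. -/
structure ComScheme.Efficient {M : ℕ → Type} [∀ k, BitCode (M k)] (C : ∀ k, ComScheme (M k)) :
    Prop where
  gen : PolySampler (α := fun _ => Unit) (β := fun k => (C k).Par) (fun k _ => (C k).gen)
  rnd : PolySampler (α := fun _ => Unit) (β := fun k => (C k).Rnd)
    (fun k _ => PMF.uniformOfFintype (C k).Rnd)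
  com : PolySize (α := fun k => (C k).Par × (M k × (C k).Rnd)) (β := fun k => (C k).Com)
    (fun k x => (C k).com x.1 x.2.1 x.2.2)

/-- Parameters and commitment to `m`. -/
def ComScheme.sample {M : Type} (C : ComScheme M) (m : M) : PMF (C.Par × C.Com) := do
  let par ← C.gen
  let r ← PMF.uniformOfFintype C.Rnd
  pure (par, C.com par m r)

/-- Commitments to any two messages are indistinguishable given the parameters. -/
def ComScheme.Hiding {M : ℕ → Type} (C : ∀ k, ComScheme (M k)) : Prop :=
  ∀ m₀ m₁ : ∀ k, M k, Indist (fun k => (C k).sample (m₀ k)) (fun k => (C k).sample (m₁ k))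

open Classical in
/-- It is infeasible to open one commitment to two different messages. -/
def ComScheme.Binding {M : ℕ → Type} [∀ k, BitCode (M k)] (C : ∀ k, ComScheme (M k)) : Prop :=
  ∀ B : ∀ k, (C k).Par → (M k × (C k).Rnd) × (M k × (C k).Rnd), PolySize B →
    Negligible (fun k => prob (C k).gen (fun par =>
      decide ((B k par).1.1 ≠ (B k par).2.1 ∧
        (C k).com par (B k par).1.1 (B k par).1.2 = (C k).com par (B k par).2.1 (B k par).2.2)))

/-! ### The affine-linear comparison algorithm -/

section Comparison

variable {q n : ℕ} {M : Type} [AddCommGroup M] [Module (ZMod q) M]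

/-- The `j`-th bit of `v` in big-endian order, `v = ∑ j, 2 ^ (n - 1 - j) * v_j`. -/
def bit (q : ℕ) {n : ℕ} (v : Fin (2 ^ n)) (j : Fin n) : ZMod q :=
  if v.val.testBit (n - 1 - j.val) then 1 else 0

/-- The accumulated value of `w` before round `j`. -/
def wAccum (a b : Fin n → M) (j : ℕ) : M :=
  ∑ k : Fin n with k.val < j, ((2 : ZMod q) ^ (2 + k.val)) • (a k - b k)

/-- The values `c_{i,j}`, where `e` represents the constant `1`. -/
def cVec (q : ℕ) [Module (ZMod q) M] (e : M) (a b : Fin n → M) (i : Fin 2) (j : Fin (n + 1)) : M :=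
  if h : j.val < n then
    (if i = 0 then e else -e) + a ⟨j.val, h⟩ - b ⟨j.val, h⟩ + wAccum (q := q) a b j.val
  else wAccum (q := q) a b n

/-- `ComparisonInitial` with random permutation `π` and random nonzero scalars `s`. -/
def comparisonInitial (e : M) (a b : Fin n → M) (π : Equiv.Perm (Fin (n + 1)))
    (s : Fin 2 → Fin (n + 1) → {x : ZMod q // x ≠ 0}) (i : Fin 2) (j : Fin (n + 1)) : M :=
  (s i j).1 • cVec q e a b i (π j)

/-- `ComparisonFinal`, where `isZero` recognizes (encryptions of) zero. -/
def comparisonFinal {A : Type} (isZero : A → Bool) (d : Fin 2 → Fin (n + 1) → A) (i : Fin 2) :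
    Bool :=
  decide (∃ j, isZero (d i j) = true)

end Comparison

instance (q : ℕ) [Fact q.Prime] : Nonempty {x : ZMod q // x ≠ 0} := ⟨⟨1, one_ne_zero⟩⟩

/-! ### The protocol -/

section Protocol

variable {q : ℕ} [Fact q.Prime] (n : ℕ) (E : HomEnc q) (C : ComScheme (ZMod q))

/-- First message of `P₀`: public key, commitment to its input, encrypted bits. -/
abbrev Msg1 : Type := E.PK × C.Com × (Fin n → E.CT)

/-- Witnesses which `P₀` hands to the zero-knowledge functionalities together with its first message:
openings `(m, r)` and `(m', r')` of the two sides of the equality proof, and an opening of every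
encrypted bit. -/
abbrev Wit1 : Type := ((ZMod q × C.Rnd) × (ZMod q × E.Rnd)) × (Fin n → ZMod q × E.Rnd)

/-- Reply of `P₁`: the encrypted vectors `D₀` and `D₁`. -/
abbrev Msg2 : Type := Fin 2 → Fin (n + 1) → E.CT

/-- Second message of `P₀`: the index `u` and, if `u = 0`, an opening of its commitment. -/
abbrev Msg3 : Type := Fin 2 × Option (Fin (2 ^ n) × C.Rnd)

/-- Witness for the one-out-of-many functionality: a position and a secret key. -/
abbrev Wit3 : Type := Fin (n + 1) × E.SK

/-- Random tape of `P₁`: permutation, scalars, and randomness for re-randomizing its reply. -/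
abbrev Tape1 : Type :=
  Equiv.Perm (Fin (n + 1)) × (Fin 2 → Fin (n + 1) → {x : ZMod q // x ≠ 0}) ×
    (Fin 2 → Fin (n + 1) → E.Rnd)

variable {n E C}

open Classical in
/-- `F_ZK(ComEq)`: the commitment `V` and the ciphertext `A` contain the same message. -/
def zkComEq (par : C.Par) (pk : E.PK) (V : C.Com) (A : E.CT)
    (w : (ZMod q × C.Rnd) × (ZMod q × E.Rnd)) : Bool :=
  decide (V = C.com par w.1.1 w.1.2 ∧ A = E.enc pk w.2 ∧ w.1.1 = w.2.1)

open Classical in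
/-- `F_ZK(BitProof)`: the ciphertext `A` contains a bit. -/
def zkBit (pk : E.PK) (A : E.CT) (w : ZMod q × E.Rnd) : Bool :=
  decide (A = E.enc pk w ∧ (w.1 = 0 ∨ w.1 = 1))

/-- `F_ZK(OneMany)`: one of the given ciphertexts contains `0`. The witness opens that ciphertext by
a secret key for `pk`. -/
def zkOneMany (pk : E.PK) (D : Fin (n + 1) → E.CT) (w : Wit3 n E) : Bool :=
  E.isKey pk w.2 && E.isZero w.2 (D w.1)

/-- The answers of the functionalities `F_ZK(ComEq)` and `F_ZK(BitProof)` to `P₁`. -/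
def zkAnswers (par : C.Par) (m : Msg1 n E C) (w : Wit1 n E C) : Bool × (Fin n → Bool) :=
  (zkComEq par m.1 m.2.1 (∑ j : Fin n, ((2 : ZMod q) ^ (n - 1 - j.val)) • m.2.2 j) w.1,
    fun j => zkBit m.1 (m.2.2 j) (w.2 j))

/-- The vectors which `P₁` computes: `ComparisonInitial` on the ciphertexts `A` and on the bits of
`v₁`, re-randomized by fresh encryptions of `0`. -/
def p1Vectors (v₁ : Fin (2 ^ n)) (tape : Tape1 n E) (m : Msg1 n E C) : Msg2 n E :=
  fun i j =>
    comparisonInitial (E.enc m.1 (1, 0)) m.2.2 (fun l => E.enc m.1 (bit q v₁ l, 0))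
        tape.1 tape.2.1 i j
      + E.enc m.1 (0, tape.2.2 i j)

open Classical in
/-- The reply of `P₁` to the first message; `none` is an abort (also of a malformed message). -/
def p1Reply (par : C.Par) (v₁ : Fin (2 ^ n)) (tape : Tape1 n E)
    (m₁ : Option (Msg1 n E C × Wit1 n E C)) : Option (Msg2 n E) :=
  m₁.bind fun x =>
    if (zkAnswers par x.1 x.2).1 = true ∧ ∀ j, (zkAnswers par x.1 x.2).2 j = true then
      some (p1Vectors v₁ tape x.1)
    else none

open Classical in
/-- The output of `P₁`, where `none` is an abort. If `u = 0` the output is the opened value of the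
commitment of `P₀`, and if `u = 1` it is the input of `P₁`. -/
def p1Output (par : C.Par) (v₁ : Fin (2 ^ n)) (m₁ : Option (Msg1 n E C × Wit1 n E C))
    (D : Option (Msg2 n E)) (m₃ : Option (Msg3 n C × Wit3 n E)) : Option (Fin (2 ^ n)) :=
  m₁.bind fun x => D.bind fun d => m₃.bind fun y =>
    if zkOneMany x.1.1 (d y.1.1) y.2 = true then
      if y.1.1 = 0 then
        y.1.2.bind fun o => if x.1.2.1 = C.com par (o.1.val : ZMod q) o.2 then some o.1 else none
      else some v₁
    else none

/-- The last message: `P₁` sends its output to `P₀` if `u = 1`. -/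
def p1Send (m₃ : Option (Msg3 n C × Wit3 n E)) (y : Option (Fin (2 ^ n))) : Option (Fin (2 ^ n)) :=
  m₃.bind fun x => if x.1.1 = 1 then y else none

variable (n E C)

/-- What `P₁` sees besides parameters and input: its random tape, the first message of `P₀` with the
answers of the zero-knowledge functionalities, and the second message with the answer to it. -/
abbrev View1 : Type :=
  Tape1 n E × Option (Msg1 n E C × (Bool × (Fin n → Bool))) × Option (Msg3 n C × Bool)

/-- A program for `P₀`, honest or not, in the hybrid model with zero-knowledge functionalities. It
acts three times: at the beginning, after the reply of `P₁`, and at the end; `none` stands for a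
missing or malformed message. -/
structure Party0 (S T O : Type) where
  run1 : C.Par → PMF (S × Option (Msg1 n E C × Wit1 n E C))
  run2 : S × Option (Msg2 n E) → PMF (T × Option (Msg3 n C × Wit3 n E))
  run3 : T × Option (Fin (2 ^ n)) → PMF O

variable {n E C}

/-- An execution of a program for `P₀` with the honest `P₁`: the output of `P₀`, the view of `P₁` and
the output of `P₁`. -/
def exec {S T O : Type} (par : C.Par) (P : Party0 n E C S T O) (v₁ : Fin (2 ^ n)) :
    PMF (O × View1 n E C × Option (Fin (2 ^ n))) := do
  let tape ← PMF.uniformOfFintype (Tape1 n E)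
  let (s, m₁) ← P.run1 par
  let D := p1Reply par v₁ tape m₁
  let (t, m₃) ← P.run2 (s, D)
  let y := p1Output par v₁ m₁ D m₃
  let o ← P.run3 (t, p1Send m₃ y)
  pure (o,
    (tape, m₁.map (fun x => (x.1, zkAnswers par x.1 x.2)),
      m₁.bind fun x => D.bind fun d => m₃.map fun w =>
        (w.1, zkOneMany x.1.1 (d w.1.1) w.2)),
    y)

/-- The honest `P₀` with input `v₀`. Its state is first its key pair and the randomness of its
commitment, and then the index `u`, or `none` if `P₁` has aborted. -/
def honest0 (v₀ : Fin (2 ^ n)) :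
    Party0 n E C ((E.PK × E.SK) × C.Rnd) (Option (Fin 2)) (Option (Fin (2 ^ n))) where
  run1 par := do
    let key ← E.gen
    let r ← PMF.uniformOfFintype C.Rnd
    let ρ ← PMF.uniformOfFintype (Fin n → E.Rnd)
    pure ((key, r), some
      ((key.1, C.com par (v₀.val : ZMod q) r, fun j => E.enc key.1 (bit q v₀ j, ρ j)),
        ((((v₀.val : ZMod q), r),
            ((v₀.val : ZMod q), ∑ j : Fin n, ((2 : ZMod q) ^ (n - 1 - j.val)) • ρ j)),
          fun j => (bit q v₀ j, ρ j))))
  run2 x :=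
    match x.2 with
    | none => pure (none, none)
    | some D =>
      let zero : E.CT → Bool := E.isZero x.1.1.2
      let u : Fin 2 := if comparisonFinal zero D 0 = true then 0 else 1
      let l : Fin (n + 1) := ((List.finRange (n + 1)).find? (fun j => zero (D u j))).getD 0
      pure (some u, some ((u, if u = 0 then some (v₀, x.1.2) else none), (l, x.1.1.2)))
  run3 x :=
    match x.1 with
    | none => pure none
    | some u => pure (if u = 0 then some v₀ else x.2)

end Protocol

/-! ### Security -/

/-- What a corrupted party obtains from the two-party minimum functionality: the minimum, and whether
the inputs are equal. An honest party obtains the minimum. -/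
def minLeak {m : ℕ} (v₀ v₁ : Fin m) : Fin m × Bool := (min v₀ v₁, decide (v₀ = v₁))

section Security

variable {q : ℕ → ℕ} [∀ k, Fact (q k).Prime] (n : ℕ → ℕ) (E : ∀ k, HomEnc (q k))
  (C : ∀ k, ComScheme (ZMod (q k)))

/-- A malicious `P₀`: a non-uniform probabilistic polynomial-time program which starts with an
auxiliary input, the input of `P₀` and the commitment parameters. -/
structure Adversary0 (aux out : ℕ → ℕ) where
  st : ℕ → ℕ
  run1 : ∀ k, Bits (aux k) × Fin (2 ^ n k) × (C k).Par →
    PMF (Bits (st k) × Option (Msg1 (n k) (E k) (C k) × Wit1 (n k) (E k) (C k)))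
  run2 : ∀ k, Bits (st k) × Option (Msg2 (n k) (E k)) →
    PMF (Bits (st k) × Option (Msg3 (n k) (C k) × Wit3 (n k) (E k)))
  run3 : ∀ k, Bits (st k) × Option (Fin (2 ^ n k)) → PMF (Bits (out k))
  poly1 : PolySampler run1
  poly2 : PolySampler run2
  poly3 : PolySampler run3

/-- A simulator for a malicious `P₀`: it first chooses an input for the trusted party (`none` is an
abort), then obtains what the functionality gives to a corrupted party, and finally produces an
output and decides whether the trusted party delivers the minimum to `P₁`. -/
structure Simulator0 (aux out : ℕ → ℕ) where
  st : ℕ → ℕ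
  run1 : ∀ k, Bits (aux k) × Fin (2 ^ n k) × (C k).Par → PMF (Bits (st k) × Option (Fin (2 ^ n k)))
  run2 : ∀ k, Bits (st k) × Option (Fin (2 ^ n k) × Bool) → PMF (Bits (out k) × Bool)
  poly1 : PolySampler run1
  poly2 : PolySampler run2

variable {n E C}

/-- Output of the malicious `P₀` and of the honest `P₁` in an execution of the protocol. -/
def real0 {aux out : ℕ → ℕ} (A : Adversary0 n E C aux out) (k : ℕ) (z : Bits (aux k))
    (v₀ v₁ : Fin (2 ^ n k)) : PMF (Bits (out k) × Option (Fin (2 ^ n k))) := do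
  let par ← (C k).gen
  let r ← exec par (⟨fun p => A.run1 k (z, v₀, p), A.run2 k, A.run3 k⟩ :
    Party0 (n k) (E k) (C k) (Bits (A.st k)) (Bits (A.st k)) (Bits (out k))) v₁
  pure (r.1, r.2.2)

/-- Output of the simulator and of the honest `P₁` in the ideal execution. -/
def ideal0 {aux out : ℕ → ℕ} (S : Simulator0 n C aux out) (k : ℕ) (z : Bits (aux k))
    (v₀ v₁ : Fin (2 ^ n k)) : PMF (Bits (out k) × Option (Fin (2 ^ n k))) := do
  let par ← (C k).gen
  let (s, x) ← S.run1 k (z, v₀, par)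
  let (o, ok) ← S.run2 k (s, x.map fun x₀ => minLeak x₀ v₁)
  pure (o, if ok = true then x.map (fun x₀ => min x₀ v₁) else none)

variable (n E C)

/-- Security with abort against a malicious `P₀`. -/
def SecureMalicious0 : Prop :=
  ∀ (aux out : ℕ → ℕ) (A : Adversary0 n E C aux out), ∃ S : Simulator0 n C aux out,
    ∀ (z : ∀ k, Bits (aux k)) (v₀ v₁ : ∀ k, Fin (2 ^ n k)),
      Indist (fun k => real0 A k (z k) (v₀ k) (v₁ k)) (fun k => ideal0 S k (z k) (v₀ k) (v₁ k))

/-- A semi-honest `P₁`: it follows the protocol, and its output is computed in non-uniform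
probabilistic polynomial time from an auxiliary input, the commitment parameters, its input and its
view. -/
structure Adversary1 (aux out : ℕ → ℕ) where
  run : ∀ k, Bits (aux k) × (C k).Par × Fin (2 ^ n k) × View1 (n k) (E k) (C k) → PMF (Bits (out k))
  poly : PolySampler run

/-- A simulator for a semi-honest `P₁`: it sends the input of `P₁` to the trusted party and works with
what the functionality gives to a corrupted party. -/
structure Simulator1 (aux out : ℕ → ℕ) where
  run : ∀ k, Bits (aux k) × (C k).Par × Fin (2 ^ n k) × (Fin (2 ^ n k) × Bool) → PMF (Bits (out k))
  poly : PolySampler run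

variable {n E C}

/-- Output of the semi-honest `P₁` and of the honest `P₀` in an execution of the protocol. -/
def real1 {aux out : ℕ → ℕ} (A : Adversary1 n E C aux out) (k : ℕ) (z : Bits (aux k))
    (v₀ v₁ : Fin (2 ^ n k)) : PMF (Bits (out k) × Option (Fin (2 ^ n k))) := do
  let par ← (C k).gen
  let r ← exec par (honest0 v₀ : Party0 (n k) (E k) (C k) _ _ _) v₁
  let o ← A.run k (z, par, v₁, r.2.1)
  pure (o, r.1)

/-- Output of the simulator and of the honest `P₀` in the ideal execution. -/
def ideal1 {aux out : ℕ → ℕ} (S : Simulator1 n C aux out) (k : ℕ) (z : Bits (aux k))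
    (v₀ v₁ : Fin (2 ^ n k)) : PMF (Bits (out k) × Option (Fin (2 ^ n k))) := do
  let par ← (C k).gen
  let o ← S.run k (z, par, v₁, minLeak v₀ v₁)
  pure (o, some (min v₀ v₁))

variable (n E C)

/-- Security against a semi-honest `P₁`. -/
def SecureSemiHonest1 : Prop :=
  ∀ (aux out : ℕ → ℕ) (A : Adversary1 n E C aux out), ∃ S : Simulator1 n C aux out,
    ∀ (z : ∀ k, Bits (aux k)) (v₀ v₁ : ∀ k, Fin (2 ^ n k)),
      Indist (fun k => real1 A k (z k) (v₀ k) (v₁ k)) (fun k => ideal1 S k (z k) (v₀ k) (v₁ k))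

/-- Without corruptions both parties output the minimum. -/
def Correct : Prop :=
  ∀ (k : ℕ) (v₀ v₁ : Fin (2 ^ n k)), ∀ par ∈ (C k).gen.support,
    (exec par (honest0 v₀ : Party0 (n k) (E k) (C k) _ _ _) v₁).map (fun r => (r.1, r.2.2)) =
      PMF.pure (some (min v₀ v₁), some (min v₀ v₁))

end Security

end BankToClient

end

open scoped BigOperators

noncomputable section

namespace BankToClient

/-! ### Boolean functions built by NAND gates -/

/-! The arithmetic core is that the comparison vectors contain at most one zero each, and that its
presence decides the order. Let `d` be the most significant position where the bits differ. The
accumulated sum `w_j` vanishes for `j ≤ d`, so `c_{i,j}` is `±1` before `d` and `±1 + (a_d - b_d)`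
at `d`, which is zero in the vector with `i = 0` if the first input is smaller and in the other
vector if it is larger. After `d` the first nonzero term has odd coefficient, so `w_j` is a nonzero
multiple of `4`, too large to be cancelled by the remaining part, of absolute value at most `2`. For
equal inputs only the last entry `w_n` vanishes, in both vectors. All integers involved are at most
`2 + 4(2^n - 1) < q` in absolute value, so nothing changes modulo `q` (`exists_intC_eq_zero_iff`,
`exists_cVec_eq_zero_iff`). Correctness follows by following an honest execution (`exec_honest`).

Malicious `P₀`: the witnesses of the bit proofs contain the plaintext bits, from which the simulator
extracts an input. By linearity, the reply of `P₁` encrypts `s_{i,j} c_{i,π(j)}` with freshly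
shifted randomness. A bijective change of the random tape turns this into random nonzero plaintexts,
with a zero in a random place of each vector that has one; which vectors these are can be computed
from the leakage. Hence the reply is simulated perfectly, for every public key
(`exists_p1Reply_eq`). An accepted final proof shows that the vector `u` has a zero, so `u = 1`
forces the minimum to be `v₁`, and `u = 0` forces it to be the extracted input. It also exhibits a
valid secret key, so ciphertexts determine their plaintexts and the equality proof ties the
commitment to the extracted input (`zkOneMany_p1Vectors`). The only failure left is an opening to
another value, which breaks binding (`p1Output_eq_of_simAccept`).

Semi-honest `P₁`: if `v₀ ≤ v₁`, the minimum is `v₀` and the simulator plays the honest `P₀` exactly.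
If `v₁ < v₀`, the commitment is never opened, and the view depends on `v₀` only through one
commitment and `n` ciphertexts. Replacing `v₀` by `0` costs one application of hiding and `n` of
semantic security (`abs_prob_hybrid_com_le`, `abs_prob_hybrid_enc_le`).

Simulators and reductions have to be circuits of polynomial size. `Cost` counts NAND gates and `GP`
bounds them polynomially over an arbitrary index type, so that one polynomial serves all loop
positions and all hardwired values of a reduction. Since adversaries are non-uniform, negligible
advantage for every choice of hardwired values gives one negligible bound for all of them
(`exists_negligible_bound`); after that, averages over fixed randomness are harmless
(`abs_prob_bind_sub_le`). -/

/-- `Built B s S`: starting from the Boolean functions in `B` and the constant `false`, one obtains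
the set `S` by adding `s` NANDs of functions that are already present. -/
inductive Built {X : Type} (B : Set (X → Bool)) : ℕ → Set (X → Bool) → Prop
  | base : Built B 0 (insert (fun _ => false) B)
  | nand {s : ℕ} {S : Set (X → Bool)} {f g : X → Bool} :
      Built B s S → f ∈ S → g ∈ S → Built B (s + 1) (insert (fun x => !(f x && g x)) S)

theorem Built.subset {X : Type} {B : Set (X → Bool)} {s : ℕ} {S : Set (X → Bool)}
    (h : Built B s S) : B ⊆ S := by
  induction h with
  | base => exact Set.subset_insert _ _
  | nand _ _ _ ih => exact ih.trans (Set.subset_insert _ _)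

theorem Built.false_mem {X : Type} {B : Set (X → Bool)} {s : ℕ} {S : Set (X → Bool)}
    (h : Built B s S) : (fun _ => false) ∈ S := by
  induction h with
  | base => exact Set.mem_insert _ _
  | nand _ _ _ ih => exact Set.mem_insert_of_mem _ ih

/-- Composition of straight-line programs along a relation between the inputs. -/
theorem Built.comp {X Y : Type} (R : Y → X → Prop) {B : Set (X → Bool)} {B' : Set (Y → Bool)}
    {s s' : ℕ} {S : Set (X → Bool)} {S' : Set (Y → Bool)} (h : Built B s S) (h' : Built B' s' S')
    (hB : ∀ f ∈ B, ∃ f' ∈ S', ∀ y x, R y x → f' y = f x) :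
    ∃ S'', Built B' (s' + s) S'' ∧ S' ⊆ S'' ∧ ∀ f ∈ S, ∃ f' ∈ S'', ∀ y x, R y x → f' y = f x := by
  induction h with
  | base =>
    refine ⟨S', h', subset_rfl, ?_⟩
    rintro f (rfl | hf)
    · exact ⟨_, h'.false_mem, fun _ _ _ => rfl⟩
    · exact hB f hf
  | @nand s S f g _ hf hg ih =>
    obtain ⟨S'', h1, h2, h3⟩ := ih
    obtain ⟨f', hf', ef⟩ := h3 f hf
    obtain ⟨g', hg', eg⟩ := h3 g hg
    refine ⟨_, h1.nand hf' hg', h2.trans (Set.subset_insert _ _), ?_⟩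
    rintro u (rfl | hu)
    · exact ⟨_, Set.mem_insert _ _, fun y x r => by simp only [ef y x r, eg y x r]⟩
    · obtain ⟨u', hu', eu⟩ := h3 u hu
      exact ⟨u', Set.mem_insert_of_mem _ hu', eu⟩

/-- The functions in `T` are obtained from those in `B` by at most `s` NANDs. -/
def Comp {X : Type} (B : Set (X → Bool)) (s : ℕ) (T : Set (X → Bool)) : Prop :=
  ∃ s' ≤ s, ∃ S, Built B s' S ∧ T ⊆ S

namespace Comp

variable {X : Type} {B T U : Set (X → Bool)} {s t : ℕ}

theorem of_subset (h : T ⊆ insert (fun _ => false) B) : Comp B s T := ⟨0, Nat.zero_le _, _, .base, h⟩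

theorem mono (h : Comp B s T) (hst : s ≤ t) (hU : U ⊆ T) : Comp B t U := by
  obtain ⟨s', h1, S, h2, h3⟩ := h
  exact ⟨s', h1.trans hst, S, h2, hU.trans h3⟩

/-- Intermediate results stay available next to the new ones, so they are paid for once and gate
counts add. -/
theorem trans (h : Comp B s T) (h' : Comp T t U) : Comp B (s + t) (T ∪ U) := by
  obtain ⟨s', h1, S, h2, h3⟩ := h
  obtain ⟨t', k1, S', k2, k3⟩ := h'
  obtain ⟨S'', e1, e2, e3⟩ := k2.comp (fun y x => y = x) h2
    (fun f hf => ⟨f, h3 hf, fun _ _ r => congrArg f r⟩)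
  refine ⟨_, by omega, S'', e1, Set.union_subset (h3.trans e2) ?_⟩
  intro f hf
  obtain ⟨f', hf', e⟩ := e3 f (k3 hf)
  rwa [← show f' = f from funext fun x => e x x rfl]

theorem union (h : Comp B s T) (h' : Comp B t U) : Comp B (s + t) (T ∪ U) := by
  obtain ⟨s', h1, S, h2, h3⟩ := h
  obtain ⟨t', k1, S', k2, k3⟩ := h'
  obtain ⟨S'', e1, e2, e3⟩ := k2.comp (fun y x => y = x) h2
    (fun f hf => ⟨f, h2.subset hf, fun _ _ r => congrArg f r⟩)
  refine ⟨_, by omega, S'', e1, Set.union_subset (h3.trans e2) ?_⟩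
  intro f hf
  obtain ⟨f', hf', e⟩ := e3 f (k3 hf)
  rwa [← show f' = f from funext fun x => e x x rfl]

theorem iUnion {m : ℕ} {T : Fin m → Set (X → Bool)} (h : ∀ i, Comp B s (T i)) :
    Comp B (m * s) (⋃ i, T i) := by
  induction m with
  | zero => exact of_subset (by simp)
  | succ m ih =>
    refine ((ih fun i => h i.castSucc).union (h (Fin.last m))).mono (by rw [Nat.succ_mul]) ?_
    intro f hf
    obtain ⟨i, hi⟩ := Set.mem_iUnion.1 hf
    induction i using Fin.lastCases with
    | last => exact Or.inr hi
    | cast i => exact Or.inl (Set.mem_iUnion.2 ⟨i, hi⟩)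

theorem nand {f g : X → Bool} (hf : f ∈ B) (hg : g ∈ B) :
    Comp B 1 {fun x => !(f x && g x)} :=
  ⟨1, le_rfl, _, Built.base.nand (Set.mem_insert_of_mem _ hf) (Set.mem_insert_of_mem _ hg), by simp⟩

theorem not {f : X → Bool} (hf : f ∈ B) : Comp B 1 {fun x => !f x} := by
  simpa using nand hf hf

theorem true' : Comp B 1 {fun _ => true} :=
  ⟨1, le_rfl, _, Built.base.nand (Set.mem_insert _ _) (Set.mem_insert _ _), by simp⟩

theorem const (b : Bool) : Comp B 1 {fun _ => b} := by
  cases b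
  · exact of_subset (by simp)
  · exact true'

theorem and {f g : X → Bool} (hf : f ∈ B) (hg : g ∈ B) : Comp B 2 {fun x => f x && g x} := by
  refine ((nand hf hg).trans (not rfl)).mono le_rfl ?_
  simp

/-- Four gates: `¬c`, `¬(c ∧ f)`, `¬(¬c ∧ g)`, and the NAND of the last two. -/
theorem ite {c f g : X → Bool} (hc : c ∈ B) (hf : f ∈ B) (hg : g ∈ B) :
    Comp B 4 {fun x => if c x = true then f x else g x} := by
  have h1 : Comp B 2 ({fun x => !(c x && f x)} ∪ ({fun x => !c x} ∪ B)) :=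
    (nand hc hf).union ((not hc).union (of_subset (s := 0) (Set.subset_insert _ _)))
  have h2 := h1.trans (nand (f := fun x => !c x) (g := g) (by simp) (by simp [hg]))
  refine (h2.trans (nand (f := fun x => !(c x && f x)) (g := fun x => !((!c x) && g x))
    (by simp) (by simp))).mono le_rfl ?_
  rintro _ rfl
  right
  funext x
  cases c x <;> simp

theorem all {m : ℕ} {h : Fin m → X → Bool} (hh : ∀ l, h l ∈ B) :
    Comp B (1 + 2 * m) {fun x => decide (∀ l, h l x = true)} := by
  induction m with
  | zero => exact true'.mono (by omega) (by simp)
  | succ m ih =>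
    have h1 := (ih fun i => hh i.castSucc).union (of_subset (s := 0) (T := B) (Set.subset_insert _ _))
    refine (h1.trans (and (f := fun x => decide (∀ l : Fin m, h l.castSucc x = true))
      (g := h (Fin.last m)) (by simp) (by simp [hh]))).mono (by omega) ?_
    rintro _ rfl
    right
    funext x
    rw [Bool.eq_iff_iff]
    simp [Fin.forall_fin_succ']

theorem beq {f g : X → Bool} (hf : f ∈ B) (hg : g ∈ B) : Comp B 5 {fun x => f x == g x} := by
  have h1 := (not hg).union (of_subset (s := 0) (T := B) (Set.subset_insert _ _))
  refine (h1.trans (ite (c := f) (f := g) (g := fun x => !g x) (by simp [hf]) (by simp [hg])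
    (by simp))).mono le_rfl ?_
  rintro _ rfl
  right
  funext x
  cases f x <;> simp

end Comp

/-! ### Cost of functions between encoded types -/

section Cost

variable {α β γ δ : Type} [BitCode α] [BitCode β] [BitCode γ] [BitCode δ]

/-- The bits of a function into an encoded type. -/
def bitsOf {X : Type} (f : X → β) : Set (X → Bool) := Set.range fun l x => code (f x) l

theorem mem_bitsOf {X : Type} (f : X → β) (l : Fin (len β)) : (fun x => code (f x) l) ∈ bitsOf f :=
  ⟨l, rfl⟩

/-- The bits of `f` are obtained from the bits of the argument by at most `s` NANDs. -/
def Cost (s : ℕ) (f : α → β) : Prop := Comp (bitsOf (fun x : α => x)) s (bitsOf f)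

@[simp] theorem code_append_left (x : α × β) (l : Fin (len α)) :
    code x (Fin.castAdd (len β) l) = code x.1 l := Fin.append_left _ _ _

@[simp] theorem code_append_right (x : α × β) (l : Fin (len β)) :
    code x (Fin.natAdd (len α) l) = code x.2 l := Fin.append_right _ _ _

theorem code_pi {t : ℕ} {β : Fin t → Type} [∀ i, BitCode (β i)] (f : ∀ i, β i) (i : Fin t)
    (l : Fin (len (β i))) : code f (finSigmaFinEquiv (n := fun i => len (β i)) ⟨i, l⟩) = code (f i) l := by
  have key : ∀ p : (i : Fin t) × Fin (len (β i)), p = ⟨i, l⟩ → code (f p.1) p.2 = code (f i) l := by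
    rintro p rfl; rfl
  exact key _ (Equiv.symm_apply_apply _ _)

theorem bitsOf_bool {X : Type} (f : X → Bool) : bitsOf f = {f} := by
  ext g
  constructor
  · rintro ⟨l, rfl⟩; rfl
  · rintro rfl; exact ⟨(0 : Fin 1), rfl⟩

theorem bitsOf_prod {X : Type} (f : X → α × β) :
    bitsOf f = bitsOf (fun x => (f x).1) ∪ bitsOf (fun x => (f x).2) := by
  ext g
  constructor
  · rintro ⟨l, rfl⟩
    induction l using Fin.addCases with
    | left l => exact Or.inl ⟨l, by simp⟩
    | right l => exact Or.inr ⟨l, by simp⟩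
  · rintro (⟨l, rfl⟩ | ⟨l, rfl⟩)
    · exact ⟨Fin.castAdd _ l, by simp⟩
    · exact ⟨Fin.natAdd _ l, by simp⟩

theorem bitsOf_pi {X : Type} {t : ℕ} {β : Fin t → Type} [∀ i, BitCode (β i)] (f : X → ∀ i, β i) :
    bitsOf f = ⋃ i, bitsOf (fun x => f x i) := by
  ext g
  constructor
  · rintro ⟨l, rfl⟩
    obtain ⟨⟨i, l⟩, rfl⟩ := finSigmaFinEquiv.surjective l
    exact Set.mem_iUnion.2 ⟨i, l, by simp only [code_pi]⟩
  · intro h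
    obtain ⟨i, l, rfl⟩ := Set.mem_iUnion.1 h
    exact ⟨finSigmaFinEquiv ⟨i, l⟩, by simp only [code_pi]⟩

theorem bitsOf_option {X : Type} (f : X → Option α) :
    bitsOf f = insert (fun x => (f x).isSome)
      (Set.range fun (l : Fin (len α)) x => (f x).elim false fun a => code a l) := by
  have h0 : ∀ o : Option α, code o (0 : Fin (len α + 1)) = o.isSome := by rintro (_ | a) <;> rfl
  have h1 : ∀ (o : Option α) (l : Fin (len α)),
      code o (l.succ : Fin (len α + 1)) = o.elim false fun a => code a l := by
    rintro (_ | a) l <;> rfl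
  ext g
  constructor
  · rintro ⟨l, rfl⟩
    refine Fin.cases (n := len α) (motive := fun l => (fun x => code (f x) l) ∈ insert _ _)
      ?_ (fun l => ?_) l
    · exact Or.inl (funext fun x => h0 _)
    · exact Or.inr ⟨l, funext fun x => (h1 _ _).symm⟩
  · rintro (rfl | ⟨l, rfl⟩)
    · exact ⟨(0 : Fin (len α + 1)), funext fun x => h0 _⟩
    · exact ⟨(l.succ : Fin (len α + 1)), funext fun x => h1 _ _⟩

namespace Cost

variable {s t u : ℕ}

theorem mono {f : α → β} (h : Cost s f) (hst : s ≤ t) : Cost t f := Comp.mono h hst subset_rfl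

/-- Pure rewiring needs no gates, and the constant `false` is available from the start; hence `s` is
arbitrary. -/
theorem of_bits' {f : α → β}
    (h : ∀ l, (∀ x, code (f x) l = false) ∨ ∃ l', ∀ x, code (f x) l = code x l') : Cost s f := by
  refine Comp.of_subset ?_
  rintro _ ⟨l, rfl⟩
  rcases h l with e | ⟨l', e⟩
  · exact Or.inl (funext e)
  · exact Or.inr ⟨l', funext fun x => (e x).symm⟩

theorem of_bits {f : α → β} (h : ∀ l, ∃ l', ∀ x, code (f x) l = code x l') : Cost s f :=
  of_bits' fun l => Or.inr (h l)

theorem id : Cost s (fun x : α => x) := of_bits fun l => ⟨l, fun _ => rfl⟩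

theorem fst : Cost s (fun x : α × β => x.1) := of_bits fun l => ⟨Fin.castAdd _ l, by simp⟩

theorem snd : Cost s (fun x : α × β => x.2) := of_bits fun l => ⟨Fin.natAdd _ l, by simp⟩

/-- The program for `f` can be fed with wires that carry the bits of `g`. The domain `X` needs no
encoding. -/
theorem pull {X : Type} {f : α → β} (hf : Cost s f) (g : X → α) :
    Comp (bitsOf g) s (bitsOf fun x => f (g x)) := by
  obtain ⟨s', h1, S, h2, h3⟩ := hf
  obtain ⟨S'', e1, -, e3⟩ := h2.comp (fun y x => g y = x) (Built.base (B := bitsOf g))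
    (by
      rintro _ ⟨l, rfl⟩
      exact ⟨_, Set.mem_insert_of_mem _ (mem_bitsOf g l), fun y x r => by simp only [r]⟩)
  refine ⟨_, by omega, S'', e1, ?_⟩
  rintro _ ⟨l, rfl⟩
  obtain ⟨f', hf', e⟩ := e3 _ (h3 (mem_bitsOf f l))
  show (fun x => code (f (g x)) l) ∈ S''
  rwa [← show f' = fun x => code (f (g x)) l from funext fun x => e x _ rfl]

theorem comp {f : α → β} {g : β → γ} (hg : Cost t g) (hf : Cost s f) :
    Cost (s + t) (fun x => g (f x)) :=
  (Comp.trans hf (hg.pull f)).mono le_rfl Set.subset_union_right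

theorem prod {f : α → β} {g : α → γ} (hf : Cost s f) (hg : Cost t g) :
    Cost (s + t) (fun x => (f x, g x)) := by
  unfold Cost
  rw [bitsOf_prod]
  exact Comp.union hf hg

theorem pi {m : ℕ} {β : Fin m → Type} [∀ i, BitCode (β i)] {f : α → ∀ i, β i}
    (hf : ∀ i, Cost s (fun x => f x i)) : Cost (m * s) f := by
  unfold Cost
  rw [bitsOf_pi]
  exact Comp.iUnion hf

theorem proj {m : ℕ} {β : Fin m → Type} [∀ i, BitCode (β i)] (i : Fin m) :
    Cost s (fun x : (∀ i, β i) => x i) :=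
  of_bits fun l => ⟨finSigmaFinEquiv ⟨i, l⟩, fun x => (code_pi x i l).symm⟩

/-- An unrolled loop: every step reads the input and the current state, both still on wires, so the
costs of the steps add up. -/
theorem iterate {m : ℕ} {st : ℕ → α → β} {F : ∀ j, j < m → α × β → β} (h0 : Cost s (st 0))
    (hF : ∀ j hj, Cost t (F j hj)) (hst : ∀ j hj x, st (j + 1) x = F j hj (x, st j x)) :
    Cost (s + m * t) (st m) := by
  have key : ∀ j ≤ m, Cost (s + j * t) (st j) := by
    intro j hj
    induction j with
    | zero => simpa using h0
    | succ j ih =>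
      rw [show st (j + 1) = fun x => F j hj (x, st j x) from funext fun x => hst j hj x]
      exact ((hF j hj).comp ((id (s := 0)).prod (ih (by omega)))).mono
        (by rw [Nat.succ_mul]; omega)
  exact key m le_rfl

theorem const (b : β) : Cost (len β) (fun _ : α => b) := by
  have : bitsOf (fun _ : α => b) = ⋃ l : Fin (len β), {fun _ => code b l} := by
    ext g
    simp [bitsOf, eq_comm]
  unfold Cost
  rw [this]
  exact (Comp.iUnion fun l => Comp.const _).mono (Nat.mul_one _).le subset_rfl

theorem ite {c : α → Bool} {f g : α → β} (hc : Cost s c) (hf : Cost t f) (hg : Cost u g) :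
    Cost (s + t + u + len β * 4) (fun x => if c x = true then f x else g x) := by
  have h := (Comp.union hc hf).union hg
  have h' : Comp (bitsOf c ∪ bitsOf f ∪ bitsOf g) (len β * 4)
      (⋃ l : Fin (len β), {fun x => if c x = true then code (f x) l else code (g x) l}) :=
    Comp.iUnion fun l => Comp.ite (c := c) (by simp [bitsOf_bool]) (by simp [mem_bitsOf])
      (by simp [mem_bitsOf])
  refine (h.trans h').mono le_rfl ?_
  rintro _ ⟨l, rfl⟩
  refine Or.inr (Set.mem_iUnion.2 ⟨l, funext fun x => ?_⟩)
  by_cases hx : c x = true <;> simp [hx]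

theorem all {m : ℕ} {f : α → Fin m → Bool} (hf : Cost s f) :
    Cost (s + (1 + 2 * m)) (fun x => decide (∀ j, f x j = true)) := by
  refine (Comp.trans hf (Comp.all (h := fun j x => f x j) fun j => ?_)).mono le_rfl ?_
  · rw [bitsOf_pi]
    exact Set.mem_iUnion.2 ⟨j, by simp [bitsOf_bool]⟩
  · rw [bitsOf_bool]
    exact Set.subset_union_right

theorem decEq {f g : α → β} [DecidableEq β] (hf : Cost s f) (hg : Cost t g) :
    Cost (s + t + (len β * 5 + (1 + 2 * len β))) (fun x => decide (f x = g x)) := by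
  have h' : Comp (bitsOf f ∪ bitsOf g) (len β * 5)
      (⋃ l : Fin (len β), {fun x => code (f x) l == code (g x) l}) :=
    Comp.iUnion fun l => Comp.beq (by simp [mem_bitsOf]) (by simp [mem_bitsOf])
  refine ((Comp.union hf hg).trans (U := {fun x => decide (f x = g x)}) ?_).mono le_rfl ?_
  · refine (h'.trans (Comp.all (h := fun l x => code (f x) l == code (g x) l)
      fun l => Set.mem_iUnion.2 ⟨l, rfl⟩)).mono le_rfl ?_
    rintro _ rfl
    refine Or.inr (funext fun x => ?_)
    rw [Bool.eq_iff_iff]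
    simp only [decide_eq_true_eq, beq_iff_eq]
    exact ⟨fun h l => by rw [h], fun h => BitCode.inj (funext h)⟩
  · rw [bitsOf_bool]
    exact Set.subset_union_right

theorem not {f : α → Bool} (hf : Cost s f) : Cost (s + 1) (fun x => !f x) := by
  refine (Comp.trans hf (Comp.not (by rw [bitsOf_bool]; rfl))).mono le_rfl ?_
  rw [bitsOf_bool]
  exact Set.subset_union_right

theorem and {f g : α → Bool} (hf : Cost s f) (hg : Cost t g) :
    Cost (s + t + 2) (fun x => f x && g x) := by
  refine ((Comp.union hf hg).trans (Comp.and (f := f) (g := g) ?_ ?_)).mono le_rfl ?_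
  · simp [bitsOf_bool]
  · simp [bitsOf_bool]
  · rw [bitsOf_bool (fun x => f x && g x)]
    exact Set.subset_union_right

theorem isSome {f : α → Option β} (hf : Cost s f) : Cost s (fun x => (f x).isSome) := by
  refine Comp.mono hf le_rfl ?_
  rw [bitsOf_bool, bitsOf_option]
  simp

theorem some {f : α → β} (hf : Cost s f) : Cost (s + 1) (fun x => some (f x)) := by
  refine (Comp.union hf (Comp.const true)).mono le_rfl ?_
  rw [bitsOf_option]
  rintro g (rfl | ⟨l, rfl⟩)
  · exact Or.inr rfl
  · exact Or.inl (mem_bitsOf f l)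

theorem none : Cost s (fun _ : α => (none : Option β)) := by
  refine Comp.of_subset ?_
  rw [bitsOf_option]
  rintro g (rfl | ⟨l, rfl⟩) <;> exact Or.inl rfl

/-- A circuit cannot skip a branch, so the program for `g` also runs when `o x` is `none`, on bits
that may encode nothing. `Built.comp` along the relation `o y = some b` controls its wires in the
other case only, and a final selection by `isSome` discards the junk. -/
theorem elim {o : α → Option β} {g : α × β → γ} {c : α → γ} (ho : Cost s o) (hg : Cost t g)
    (hc : Cost u c) :
    Cost (s + u + t + len γ * 4) (fun x => (o x).elim (c x) fun b => g (x, b)) := by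
  obtain ⟨s', hs', S, hS, hTS⟩ := Comp.union ho hc |>.union (id (s := 0) (α := α))
  obtain ⟨t', ht', T, hT, hgT⟩ := hg
  obtain ⟨W, e1, e2, e3⟩ := hT.comp (fun y x => x.1 = y ∧ o y = Option.some x.2) hS (by
    rw [bitsOf_prod]
    rintro _ (⟨l, rfl⟩ | ⟨l, rfl⟩)
    · exact ⟨fun y => code y l, hTS (Or.inr ⟨l, rfl⟩), fun y x r => by simp only [r.1]⟩
    · refine ⟨fun y => (o y).elim false fun a => code a l, hTS (Or.inl (Or.inl ?_)),
        fun y x r => ?_⟩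
      · rw [bitsOf_option]
        exact Or.inr ⟨l, rfl⟩
      · simp only [r.2, Option.elim])
  choose g' hg' eg using fun l => e3 _ (hgT (mem_bitsOf g l))
  have h1 : Comp (bitsOf fun x : α => x) (s + u + t) W := ⟨_, by omega, W, e1, subset_rfl⟩
  have h2 : Comp W (len γ * 4)
      (⋃ l : Fin (len γ), {fun x => if (o x).isSome = true then g' l x else code (c x) l}) :=
    Comp.iUnion fun l => Comp.ite (c := fun x => (o x).isSome)
      (e2 (hTS (Or.inl (Or.inl (by rw [bitsOf_option]; simp))))) (hg' l)
      (e2 (hTS (Or.inl (Or.inr (mem_bitsOf c l)))))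
  refine (h1.trans h2).mono le_rfl ?_
  rintro _ ⟨l, rfl⟩
  refine Or.inr (Set.mem_iUnion.2 ⟨l, funext fun x => ?_⟩)
  rcases hx : o x with _ | b
  · simp [hx]
  · simp [hx, eg l x (x, b) ⟨rfl, hx⟩]

end Cost

end Cost

/-! ### Circuits and straight-line programs -/

section Circuits

variable {α β γ : Type} [BitCode α] [BitCode β] [BitCode γ]

/-- The wires after running a list of gates. -/
def runGates (gs : List (ℕ × ℕ)) (w : List Bool) : List Bool :=
  gs.foldl (fun w g => w ++ [!(w.getD g.1 false && w.getD g.2 false)]) w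

theorem runGates_concat (gs : List (ℕ × ℕ)) (g : ℕ × ℕ) (w : List Bool) :
    runGates (gs ++ [g]) w = runGates gs w ++
      [!((runGates gs w).getD g.1 false && (runGates gs w).getD g.2 false)] := by
  simp [runGates]

theorem length_runGates (gs : List (ℕ × ℕ)) (w : List Bool) :
    (runGates gs w).length = w.length + gs.length := by
  induction gs using List.reverseRecOn with
  | nil => simp [runGates]
  | append_singleton gs g ih => simp [runGates_concat, ih, add_assoc]

theorem Built.exists_gates {s : ℕ} {S : Set (α → Bool)} (h : Built (bitsOf fun x : α => x) s S) :
    ∃ gs : List (ℕ × ℕ), gs.length = s ∧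
      ∀ f ∈ S, ∃ j, ∀ x, (runGates gs (List.ofFn (code x))).getD j false = f x := by
  induction h with
  | base =>
    refine ⟨[], rfl, ?_⟩
    rintro f (rfl | ⟨l, rfl⟩)
    -- Without gates the wire `len α` does not exist, so it reads `false`.
    · exact ⟨len α, fun x => by simp [runGates]⟩
    · exact ⟨l, fun x => by simp [runGates]⟩
  | @nand s S f g _ hf hg ih =>
    obtain ⟨gs, hs, h⟩ := ih
    obtain ⟨i, hi⟩ := h f hf
    obtain ⟨j, hj⟩ := h g hg
    have hl : ∀ x : α, (runGates gs (List.ofFn (code x))).length = len α + s := fun x => by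
      rw [length_runGates, hs, List.length_ofFn]
    refine ⟨gs ++ [(i, j)], by simp [hs], ?_⟩
    rintro u (rfl | hu)
    · refine ⟨len α + s, fun x => ?_⟩
      rw [runGates_concat, List.getD_append_right _ _ _ _ (hl x).le, hl, hi, hj]
      simp
    · obtain ⟨l, hl'⟩ := h u hu
      by_cases hlt : l < len α + s
      · refine ⟨l, fun x => ?_⟩
        rw [runGates_concat, List.getD_append _ _ _ _ (by rw [hl]; exact hlt), hl']
      -- A reference beyond the old wires stands for the default `false`. Index `len α + s` now
      -- belongs to the new gate, so the reference moves past it.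
      · refine ⟨len α + s + 1, fun x => ?_⟩
        rw [← hl' x, List.getD_eq_default _ _ (by rw [length_runGates, List.length_ofFn, List.length_append, List.length_singleton]; omega),
          List.getD_eq_default _ _ (by rw [hl]; omega)]

theorem exists_built (gs : List (ℕ × ℕ)) :
    ∃ S, Built (bitsOf fun x : α => x) gs.length S ∧
      ∀ j, (fun x : α => (runGates gs (List.ofFn (code x))).getD j false) ∈ S := by
  induction gs using List.reverseRecOn with
  | nil =>
    refine ⟨_, .base, fun j => ?_⟩
    by_cases hj : j < len α
    · exact Or.inr ⟨⟨j, hj⟩, funext fun x => by simp [runGates, hj]⟩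
    · refine Or.inl (funext fun x => ?_)
      exact List.getD_eq_default _ _ (by simp [runGates]; omega)
  | append_singleton gs g ih =>
    obtain ⟨S, hS, h⟩ := ih
    have hl : ∀ x : α, (runGates gs (List.ofFn (code x))).length = len α + gs.length := fun x => by
      rw [length_runGates, List.length_ofFn]
    refine ⟨_, by rw [List.length_append]; exact hS.nand (h g.1) (h g.2), fun j => ?_⟩
    rcases lt_trichotomy j (len α + gs.length) with hj | hj | hj
    · refine Or.inr ?_
      convert h j using 2 with x
      rw [runGates_concat, List.getD_append _ _ _ _ (by rw [hl]; exact hj)]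
    · refine Or.inl (funext fun x => ?_)
      rw [runGates_concat, List.getD_append_right _ _ _ _ (by rw [hl]; exact hj.ge), hl, hj]
      simp
    · have hB := (hS.nand (h g.1) (h g.2)).false_mem
      convert hB using 2 with x
      exact List.getD_eq_default _ _ (by rw [length_runGates, List.length_ofFn, List.length_append, List.length_singleton]; omega)

theorem Cost.exists_circuit {s : ℕ} {f : α → β} (h : Cost s f) :
    ∃ C : Circuit (len α) (len β), C.size ≤ s + len α + len β ∧
      ∀ x, C.eval (code x) = code (f x) := by
  obtain ⟨s', hs', S, hS, hT⟩ := h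
  obtain ⟨gs, hg, h⟩ := hS.exists_gates
  choose out hout using fun l => h _ (hT (mem_bitsOf f l))
  exact ⟨⟨gs, out⟩, by simp only [Circuit.size, hg]; omega, fun x => funext fun l => hout l x⟩

theorem Cost.of_circuit {f : α → β} (C : Circuit (len α) (len β))
    (h : ∀ x, C.eval (code x) = code (f x)) : Cost C.gates.length f := by
  obtain ⟨S, hS, hj⟩ := exists_built (α := α) C.gates
  refine ⟨_, le_rfl, S, hS, ?_⟩
  rintro _ ⟨l, rfl⟩
  convert hj (C.out l) using 2 with x
  exact (congrFun (h x) l).symm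

/-- A function of `α × γ` with values in a type in which every bit string is a code extends to all
bit strings in place of elements of `α`. -/
theorem Cost.exists_extension {s : ℕ} {f : α × γ → β} (h : Cost s f)
    (hβ : Function.Surjective (code : β → _)) :
    ∃ f' : Bits (len α) × γ → β, Cost s f' ∧ ∀ a c, f' (code a, c) = f (a, c) := by
  obtain ⟨s', hs', S, hS, hT⟩ := h
  obtain ⟨W, e1, -, e3⟩ := hS.comp (fun (y : Bits (len α) × γ) x => y.1 = code x.1 ∧ y.2 = x.2)
    (Built.base (B := bitsOf fun y : Bits (len α) × γ => y)) (by
      rw [bitsOf_prod]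
      rintro _ (⟨l, rfl⟩ | ⟨l, rfl⟩)
      · refine ⟨fun y => y.1 l, Or.inr ?_, fun y x r => by simp only [r.1]⟩
        rw [bitsOf_prod]
        refine Or.inl ?_
        rw [bitsOf_pi]
        exact Set.mem_iUnion.2 ⟨l, by simp [bitsOf_bool]⟩
      · refine ⟨fun y => code y.2 l, Or.inr ?_, fun y x r => by simp only [r.2]⟩
        rw [bitsOf_prod]
        exact Or.inr ⟨l, rfl⟩)
  choose g hg eg using fun l => e3 _ (hT (mem_bitsOf f l))
  -- On strings that encode no element of `α` the program still produces some output string;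
  -- surjectivity makes it the code of a value.
  choose dec hdec using hβ
  refine ⟨fun y => dec fun l => g l y, ⟨_, by omega, W, e1, ?_⟩, fun a c => ?_⟩
  · rintro _ ⟨l, rfl⟩
    simp only [hdec]
    exact hg l
  · refine BitCode.inj ?_
    show code _ = code _
    rw [hdec]
    exact funext fun l => eg l _ (a, c) ⟨rfl, rfl⟩

theorem code_surjective_bits (m : ℕ) : Function.Surjective (code : Bits m → _) := by
  intro y
  refine ⟨fun l => y (finSigmaFinEquiv (n := fun _ => len Bool) ⟨l, (0 : Fin 1)⟩), funext fun l => ?_⟩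
  obtain ⟨⟨i, l⟩, rfl⟩ := (finSigmaFinEquiv (n := fun _ : Fin m => len Bool)).surjective l
  rw [code_pi]
  have : l = (0 : Fin 1) := Subsingleton.elim (α := Fin 1) _ _
  subst this
  rfl

theorem code_surjective_bool : Function.Surjective (code : Bool → _) := fun y =>
  ⟨y (0 : Fin 1), funext fun l => by rw [Subsingleton.elim (α := Fin 1) l 0]; rfl⟩

theorem code_surjective_prod (hα : Function.Surjective (code : α → _))
    (hβ : Function.Surjective (code : β → _)) : Function.Surjective (code : α × β → _) := by
  intro y
  obtain ⟨a, ha⟩ := hα fun l => y (Fin.castAdd _ l)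
  obtain ⟨b, hb⟩ := hβ fun l => y (Fin.natAdd _ l)
  refine ⟨(a, b), funext fun l => ?_⟩
  induction l using Fin.addCases with
  | left l => rw [code_append_left, ha]
  | right l => rw [code_append_right, hb]

end Circuits

/-! ### Families of polynomial cost -/

/-- `s` is bounded by a polynomial in `sz`. -/
def PolyBdd {I : Type} (sz s : I → ℕ) : Prop := ∃ p : Polynomial ℕ, ∀ i, s i ≤ p.eval (sz i)

namespace PolyBdd

variable {I : Type} {sz s t : I → ℕ}

theorem mono (ht : PolyBdd sz t) (h : ∀ i, s i ≤ t i) : PolyBdd sz s :=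
  let ⟨p, hp⟩ := ht
  ⟨p, fun i => (h i).trans (hp i)⟩

theorem const (c : ℕ) : PolyBdd sz fun _ => c := ⟨.C c, fun i => by simp⟩

theorem add (hs : PolyBdd sz s) (ht : PolyBdd sz t) : PolyBdd sz fun i => s i + t i :=
  let ⟨p, hp⟩ := hs
  let ⟨p', hp'⟩ := ht
  ⟨p + p', fun i => by rw [Polynomial.eval_add]; exact add_le_add (hp i) (hp' i)⟩

theorem mul (hs : PolyBdd sz s) (ht : PolyBdd sz t) : PolyBdd sz fun i => s i * t i :=
  let ⟨p, hp⟩ := hs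
  let ⟨p', hp'⟩ := ht
  ⟨p * p', fun i => by rw [Polynomial.eval_mul]; exact Nat.mul_le_mul (hp i) (hp' i)⟩

theorem pull {J : Type} (h : PolyBdd sz s) (φ : J → I) :
    PolyBdd (fun j => sz (φ j)) fun j => s (φ j) :=
  let ⟨p, hp⟩ := h
  ⟨p, fun j => hp (φ j)⟩

end PolyBdd

/-- The encodings have polynomial length. -/
abbrev PolyLen {I : Type} (sz : I → ℕ) (α : I → Type) [∀ i, BitCode (α i)] : Prop :=
  PolyBdd sz fun i => len (α i)

/-- The functions `f i` need polynomially many gates. -/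
def GP {I : Type} (sz : I → ℕ) {α β : I → Type} [∀ i, BitCode (α i)] [∀ i, BitCode (β i)]
    (f : ∀ i, α i → β i) : Prop :=
  ∃ p : Polynomial ℕ, ∀ i, Cost (p.eval (sz i)) (f i)

namespace PolyLen

variable {I : Type} {sz : I → ℕ} {α β : I → Type} [∀ i, BitCode (α i)] [∀ i, BitCode (β i)]

theorem unit : PolyLen sz fun _ => Unit := PolyBdd.const 0

theorem bool : PolyLen sz fun _ => Bool := PolyBdd.const 1

theorem prod (hα : PolyLen sz α) (hβ : PolyLen sz β) : PolyLen sz fun i => α i × β i :=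
  PolyBdd.add hα hβ

theorem option (hα : PolyLen sz α) : PolyLen sz fun i => Option (α i) :=
  PolyBdd.add hα (PolyBdd.const 1)

theorem pi {m : I → ℕ} (hm : PolyBdd sz m) (hα : PolyLen sz α) :
    PolyLen sz fun i => Fin (m i) → α i :=
  (hm.mul hα).mono fun i => by
    show ∑ _ : Fin (m i), len (α i) ≤ _
    simp

theorem fst (h : PolyLen sz fun i => α i × β i) : PolyLen sz α :=
  PolyBdd.mono h fun _ => Nat.le_add_right _ _

theorem snd (h : PolyLen sz fun i => α i × β i) : PolyLen sz β :=
  PolyBdd.mono h fun _ => Nat.le_add_left _ _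

end PolyLen

namespace GP

variable {I : Type} {sz : I → ℕ} {α β γ : I → Type} [∀ i, BitCode (α i)] [∀ i, BitCode (β i)]
  [∀ i, BitCode (γ i)]

theorem of_bdd {s : I → ℕ} (hs : PolyBdd sz s) {f : ∀ i, α i → β i} (h : ∀ i, Cost (s i) (f i)) :
    GP sz f :=
  let ⟨p, hp⟩ := hs
  ⟨p, fun i => (h i).mono (hp i)⟩

theorem exists_bdd {f : ∀ i, α i → β i} (hf : GP sz f) :
    ∃ s, PolyBdd sz s ∧ ∀ i, Cost (s i) (f i) :=
  let ⟨p, hp⟩ := hf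
  ⟨_, ⟨p, fun _ => le_rfl⟩, hp⟩

theorem pull {J : Type} {f : ∀ i, α i → β i} (hf : GP sz f) (φ : J → I) :
    GP (fun j => sz (φ j)) (fun j => f (φ j)) :=
  let ⟨p, hp⟩ := hf
  ⟨p, fun j => hp (φ j)⟩

theorem of_bits {f : ∀ i, α i → β i} (h : ∀ i l, ∃ l', ∀ x, code (f i x) l = code x l') :
    GP sz f := ⟨0, fun i => Cost.of_bits (h i)⟩

theorem of_bits' {f : ∀ i, α i → β i}
    (h : ∀ i l, (∀ x, code (f i x) l = false) ∨ ∃ l', ∀ x, code (f i x) l = code x l') :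
    GP sz f := ⟨0, fun i => Cost.of_bits' (h i)⟩

theorem id : GP sz (fun i (x : α i) => x) := ⟨0, fun _ => Cost.id⟩

theorem fst : GP sz (fun i (x : α i × β i) => x.1) := ⟨0, fun _ => Cost.fst⟩

theorem snd : GP sz (fun i (x : α i × β i) => x.2) := ⟨0, fun _ => Cost.snd⟩

theorem comp {f : ∀ i, α i → β i} {g : ∀ i, β i → γ i} (hg : GP sz g) (hf : GP sz f) :
    GP sz (fun i x => g i (f i x)) :=
  let ⟨_, hs, hf⟩ := hf.exists_bdd
  let ⟨_, ht, hg⟩ := hg.exists_bdd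
  of_bdd (hs.add ht) fun i => (hg i).comp (hf i)

theorem prod {f : ∀ i, α i → β i} {g : ∀ i, α i → γ i} (hf : GP sz f) (hg : GP sz g) :
    GP sz (fun i x => (f i x, g i x)) :=
  let ⟨_, hs, hf⟩ := hf.exists_bdd
  let ⟨_, ht, hg⟩ := hg.exists_bdd
  of_bdd (hs.add ht) fun i => (hf i).prod (hg i)

theorem fst' {f : ∀ i, α i → β i × γ i} (hf : GP sz f) : GP sz (fun i x => (f i x).1) :=
  fst.comp hf

theorem snd' {f : ∀ i, α i → β i × γ i} (hf : GP sz f) : GP sz (fun i x => (f i x).2) :=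
  snd.comp hf

/-- Indexing by pairs `(i, j)` makes the bound uniform in the component `j`; a separate polynomial
for every component would not bound their sum. -/
theorem pi {m : I → ℕ} (hm : PolyBdd sz m) {f : ∀ i, α i → Fin (m i) → β i}
    (hf : GP (I := Σ i, Fin (m i)) (fun p => sz p.1) (α := fun p => α p.1) (β := fun p => β p.1)
      (fun p x => f p.1 x p.2)) : GP sz f :=
  let ⟨p, hp⟩ := hf
  of_bdd (hm.mul ⟨p, fun _ => le_rfl⟩) fun i => Cost.pi fun j => hp ⟨i, j⟩

theorem proj {m : I → ℕ} {β : ∀ i, Fin (m i) → Type} [∀ i j, BitCode (β i j)] {f : ∀ i, α i → ∀ j, β i j}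
    (hf : GP sz f) (j : ∀ i, Fin (m i)) : GP sz (fun i x => f i x (j i)) :=
  let ⟨p, hp⟩ := hf
  ⟨p, fun i => ((Cost.proj (s := 0) (j i)).comp (hp i)).mono (by simp)⟩

theorem iterate {m : I → ℕ} (hm : PolyBdd sz m) {st : ∀ i, ℕ → α i → β i}
    {F : ∀ i, Fin (m i) → α i × β i → β i} (h0 : GP sz fun i => st i 0)
    (hF : GP (I := Σ i, Fin (m i)) (fun p => sz p.1) (α := fun p => α p.1 × β p.1)
      (β := fun p => β p.1) fun p => F p.1 p.2)
    (hst : ∀ i (j : Fin (m i)) x, st i (j + 1) x = F i j (x, st i j x)) :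
    GP sz fun i => st i (m i) :=
  let ⟨_, hs, h0⟩ := h0.exists_bdd
  let ⟨p, hp⟩ := hF
  of_bdd (hs.add (hm.mul ⟨p, fun _ => le_rfl⟩)) fun i =>
    Cost.iterate (F := fun j hj => F i ⟨j, hj⟩) (h0 i) (fun j hj => hp ⟨i, j, hj⟩)
      fun j hj x => hst i ⟨j, hj⟩ x

theorem const (hβ : PolyLen sz β) (b : ∀ i, β i) : GP sz (fun i (_ : α i) => b i) :=
  of_bdd hβ fun i => Cost.const (b i)

theorem ite {c : ∀ i, α i → Bool} {f g : ∀ i, α i → β i} (hβ : PolyLen sz β)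
    (hc : GP sz (β := fun _ => Bool) c) (hf : GP sz f) (hg : GP sz g) :
    GP sz (fun i x => if c i x = true then f i x else g i x) :=
  let ⟨_, hr, hc⟩ := hc.exists_bdd
  let ⟨_, hs, hf⟩ := hf.exists_bdd
  let ⟨_, ht, hg⟩ := hg.exists_bdd
  of_bdd (((hr.add hs).add ht).add (hβ.mul (.const 4))) fun i => (hc i).ite (hf i) (hg i)

theorem all {m : I → ℕ} (hm : PolyBdd sz m) {f : ∀ i, α i → Fin (m i) → Bool} (hf : GP sz f) :
    GP sz (β := fun _ => Bool) (fun i x => decide (∀ j, f i x j = true)) :=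
  let ⟨_, hs, hf⟩ := hf.exists_bdd
  of_bdd (hs.add ((PolyBdd.const 1).add ((PolyBdd.const 2).mul hm))) fun i => (hf i).all

theorem decEq [∀ i, DecidableEq (β i)] {f g : ∀ i, α i → β i} (hβ : PolyLen sz β) (hf : GP sz f)
    (hg : GP sz g) : GP sz (β := fun _ => Bool) (fun i x => decide (f i x = g i x)) :=
  let ⟨_, hs, hf⟩ := hf.exists_bdd
  let ⟨_, ht, hg⟩ := hg.exists_bdd
  of_bdd ((hs.add ht).add ((hβ.mul (.const 5)).add ((PolyBdd.const 1).add
    ((PolyBdd.const 2).mul hβ)))) fun i => (hf i).decEq (hg i)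

theorem not {f : ∀ i, α i → Bool} (hf : GP sz (β := fun _ => Bool) f) :
    GP sz (β := fun _ => Bool) (fun i x => !f i x) :=
  let ⟨_, hs, hf⟩ := hf.exists_bdd
  of_bdd (hs.add (.const 1)) fun i => (hf i).not

theorem and {f g : ∀ i, α i → Bool} (hf : GP sz (β := fun _ => Bool) f)
    (hg : GP sz (β := fun _ => Bool) g) :
    GP sz (β := fun _ => Bool) (fun i x => f i x && g i x) :=
  let ⟨_, hs, hf⟩ := hf.exists_bdd
  let ⟨_, ht, hg⟩ := hg.exists_bdd
  of_bdd ((hs.add ht).add (.const 2)) fun i => (hf i).and (hg i)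

theorem or {f g : ∀ i, α i → Bool} (hf : GP sz (β := fun _ => Bool) f)
    (hg : GP sz (β := fun _ => Bool) g) :
    GP sz (β := fun _ => Bool) (fun i x => f i x || g i x) := by
  simpa using (hf.not.and hg.not).not

theorem isSome {f : ∀ i, α i → Option (β i)} (hf : GP sz f) :
    GP sz (β := fun _ => Bool) (fun i x => (f i x).isSome) :=
  let ⟨_, hs, hf⟩ := hf.exists_bdd
  of_bdd hs fun i => (hf i).isSome

theorem some {f : ∀ i, α i → β i} (hf : GP sz f) :
    GP sz (β := fun i => Option (β i)) (fun i x => Option.some (f i x)) :=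
  let ⟨_, hs, hf⟩ := hf.exists_bdd
  of_bdd (hs.add (.const 1)) fun i => (hf i).some

theorem none : GP sz (β := fun i => Option (β i)) (fun i (_ : α i) => Option.none) :=
  ⟨0, fun _ => Cost.none⟩

theorem elim {o : ∀ i, α i → Option (β i)} {g : ∀ i, α i × β i → γ i} {c : ∀ i, α i → γ i}
    (hγ : PolyLen sz γ) (ho : GP sz o) (hc : GP sz c) (hg : GP sz (α := fun i => α i × β i) g) :
    GP sz (fun i x => (o i x).elim (c i x) fun b => g i (x, b)) :=
  let ⟨_, hr, ho⟩ := ho.exists_bdd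
  let ⟨_, hs, hc⟩ := hc.exists_bdd
  let ⟨_, ht, hg⟩ := hg.exists_bdd
  of_bdd (((hr.add hs).add ht).add (hγ.mul (.const 4))) fun i => (ho i).elim (hg i) (hc i)

theorem bind {o : ∀ i, α i → Option (β i)} {g : ∀ i, α i × β i → Option (γ i)}
    (hγ : PolyLen sz γ) (ho : GP sz o) (hg : GP sz (α := fun i => α i × β i) g) :
    GP sz (β := fun i => Option (γ i)) (fun i x => (o i x).bind fun b => g i (x, b)) := by
  convert ho.elim (γ := fun i => Option (γ i)) hγ.option none hg using 3 with i x
  cases o i x <;> rfl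

theorem exists_extension {f : ∀ i, α i × γ i → β i} (hf : GP sz f)
    (hβ : ∀ i, Function.Surjective (code : β i → _)) :
    ∃ f' : ∀ i, Bits (len (α i)) × γ i → β i, GP sz f' ∧ ∀ i a c, f' i (code a, c) = f i (a, c) := by
  obtain ⟨p, hp⟩ := hf
  choose f' h1 h2 using fun i => (hp i).exists_extension (hβ i)
  exact ⟨f', ⟨p, h1⟩, h2⟩

end GP

theorem PolySize.gp {α β : ℕ → Type} [∀ k, BitCode (α k)] [∀ k, BitCode (β k)]
    {f : ∀ k, α k → β k} (h : PolySize f) : GP (fun k => k) f := by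
  obtain ⟨p, hp⟩ := h
  refine ⟨p, fun k => ?_⟩
  obtain ⟨C, hC, e⟩ := hp k
  exact (Cost.of_circuit C e).mono (by unfold Circuit.size at hC; show _ ≤ p.eval k; omega)

theorem PolySize.polyLen_left {α β : ℕ → Type} [∀ k, BitCode (α k)] [∀ k, BitCode (β k)]
    {f : ∀ k, α k → β k} (h : PolySize f) : PolyLen (fun k => k) α := by
  obtain ⟨p, hp⟩ := h
  refine ⟨p, fun k => ?_⟩
  obtain ⟨C, hC, e⟩ := hp k
  unfold Circuit.size at hC
  show _ ≤ p.eval k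
  dsimp only
  omega

theorem PolySize.polyLen_right {α β : ℕ → Type} [∀ k, BitCode (α k)] [∀ k, BitCode (β k)]
    {f : ∀ k, α k → β k} (h : PolySize f) : PolyLen (fun k => k) β := by
  obtain ⟨p, hp⟩ := h
  refine ⟨p, fun k => ?_⟩
  obtain ⟨C, hC, e⟩ := hp k
  unfold Circuit.size at hC
  show _ ≤ p.eval k
  dsimp only
  omega

theorem GP.polySize {α β : ℕ → Type} [∀ k, BitCode (α k)] [∀ k, BitCode (β k)]
    {f : ∀ k, α k → β k} (h : GP (fun k => k) f) (hα : PolyLen (fun k => k) α)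
    (hβ : PolyLen (fun k => k) β) : PolySize f := by
  obtain ⟨s, hs, h⟩ := h.exists_bdd
  obtain ⟨p, hp⟩ := (hs.add hα).add hβ
  refine ⟨p, fun k => ?_⟩
  obtain ⟨C, hC, e⟩ := (h k).exists_circuit
  exact ⟨C, hC.trans (hp k), e⟩

/-! ### Uniform distributions -/

section Uniform

variable {α β γ : Type}

theorem uniform_map_of_bijective [Fintype α] [Nonempty α] [Fintype β] [Nonempty β] {f : α → β}
    (hf : Function.Bijective f) :
    (PMF.uniformOfFintype α).map f = PMF.uniformOfFintype β := by
  ext b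
  obtain ⟨a, rfl⟩ := hf.2 b
  rw [PMF.map_apply, tsum_eq_single a]
  · simp [Fintype.card_of_bijective hf]
  · intro a' h
    rw [if_neg]
    exact fun e => h (hf.1 e).symm

theorem uniform_map_equiv [Fintype α] [Nonempty α] [Fintype β] [Nonempty β] (e : α ≃ β) :
    (PMF.uniformOfFintype α).map e = PMF.uniformOfFintype β :=
  uniform_map_of_bijective e.bijective

theorem uniform_prod [Fintype α] [Nonempty α] [Fintype β] [Nonempty β] :
    PMF.uniformOfFintype (α × β) =
      (PMF.uniformOfFintype α).bind fun a => (PMF.uniformOfFintype β).map fun b => (a, b) := by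
  classical
  ext ⟨a, b⟩
  rw [PMF.bind_apply, tsum_eq_single a]
  · rw [PMF.map_apply, tsum_eq_single b]
    · simp only [PMF.uniformOfFintype_apply, Fintype.card_prod, Nat.cast_mul, if_true]
      rw [ENNReal.mul_inv]
      · exact Or.inr (ENNReal.natCast_ne_top _)
      · exact Or.inl (ENNReal.natCast_ne_top _)
    · intro b' h
      rw [if_neg]
      simpa using h.symm
  · intro a' h
    rw [PMF.map_apply, ENNReal.tsum_eq_zero.2, mul_zero]
    intro b'
    rw [if_neg]
    intro e
    exact h (congrArg Prod.fst e).symm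

theorem uniform_map_prod {α' β' : Type} [Fintype α] [Nonempty α] [Fintype β] [Nonempty β]
    [Fintype α'] [Nonempty α'] [Fintype β'] [Nonempty β'] {f : α → α'} {g : β → β'}
    (hf : (PMF.uniformOfFintype α).map f = PMF.uniformOfFintype α')
    (hg : (PMF.uniformOfFintype β).map g = PMF.uniformOfFintype β') :
    (PMF.uniformOfFintype (α × β)).map (fun x => (f x.1, g x.2)) =
      PMF.uniformOfFintype (α' × β') := by
  rw [uniform_prod, uniform_prod, ← hf, ← hg, PMF.map_bind, PMF.bind_map]
  congr 1
  funext a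
  simp only [PMF.map_comp, Function.comp_def]

theorem uniform_map_pi {t : ℕ} [Fintype α] [Nonempty α] [Fintype β] [Nonempty β] {f : α → β}
    (hf : (PMF.uniformOfFintype α).map f = PMF.uniformOfFintype β) :
    (PMF.uniformOfFintype (Fin t → α)).map (fun x i => f (x i)) =
      PMF.uniformOfFintype (Fin t → β) := by
  induction t with
  | zero => exact uniform_map_of_bijective ⟨fun _ _ _ => Subsingleton.elim _ _, fun y => ⟨Fin.elim0, Subsingleton.elim _ _⟩⟩
  | succ t ih =>
    rw [← uniform_map_equiv (Fin.consEquiv fun _ : Fin (t + 1) => α),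
      ← uniform_map_equiv (Fin.consEquiv fun _ : Fin (t + 1) => β), ← uniform_map_prod hf ih,
      PMF.map_comp, PMF.map_comp]
    congr 1
    funext x i
    induction i using Fin.cases <;> rfl

end Uniform

/-! ### Probabilities and advantages -/

section Prob

variable {α β : Type}

theorem prob_nonneg (p : PMF α) (D : α → Bool) : 0 ≤ prob p D := ENNReal.toReal_nonneg

theorem prob_le_one (p : PMF α) (D : α → Bool) : prob p D ≤ 1 :=
  ENNReal.toReal_mono ENNReal.one_ne_top (PMF.coe_le_one _ _)

theorem prob_map (p : PMF α) (f : α → β) (D : β → Bool) :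
    prob (p.map f) D = prob p fun x => D (f x) := by
  unfold prob
  rw [PMF.map_comp]
  rfl

theorem prob_bind (p : PMF α) (f : α → PMF β) (D : β → Bool) :
    prob (p.bind f) D = ∑' a, (p a).toReal * prob (f a) D := by
  unfold prob
  rw [PMF.map_bind, PMF.bind_apply, ENNReal.tsum_toReal_eq]
  · simp [ENNReal.toReal_mul]
  · exact fun a => ENNReal.mul_ne_top (PMF.apply_ne_top _ _) (PMF.apply_ne_top _ _)

theorem summable_toReal (p : PMF α) : Summable fun a => (p a).toReal :=
  ENNReal.summable_toReal p.tsum_coe_ne_top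

theorem tsum_toReal (p : PMF α) : ∑' a, (p a).toReal = 1 := by
  rw [← ENNReal.tsum_toReal_eq (fun a => PMF.apply_ne_top _ _), p.tsum_coe, ENNReal.toReal_one]

theorem summable_toReal_mul (p : PMF α) {x : α → ℝ} (hx : ∀ a, |x a| ≤ 1) :
    Summable fun a => (p a).toReal * x a := by
  refine Summable.of_norm_bounded (summable_toReal p) fun a => ?_
  rw [norm_mul, Real.norm_of_nonneg ENNReal.toReal_nonneg, Real.norm_eq_abs]
  exact mul_le_of_le_one_right ENNReal.toReal_nonneg (hx a)

theorem abs_prob_le (p : PMF α) (D : α → Bool) : |prob p D| ≤ 1 := by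
  rw [abs_of_nonneg (prob_nonneg _ _)]
  exact prob_le_one _ _

theorem abs_prob_sub_le_one (p q : PMF α) (D : α → Bool) : |prob p D - prob q D| ≤ 1 := by
  rw [abs_le]
  constructor <;> linarith [prob_nonneg p D, prob_nonneg q D, prob_le_one p D, prob_le_one q D]

/-- The advantage is an average over the common randomness `p`, so that randomness may be fixed in
the worst way and hardwired. -/
theorem abs_prob_bind_sub_le (p : PMF α) (f g : α → PMF β) (D : β → Bool) {ε : ℝ}
    (h : ∀ a, |prob (f a) D - prob (g a) D| ≤ ε) :
    |prob (p.bind f) D - prob (p.bind g) D| ≤ ε := by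
  have hs : Summable fun a => (p a).toReal * (prob (f a) D - prob (g a) D) :=
    summable_toReal_mul p fun a => abs_prob_sub_le_one _ _ _
  rw [prob_bind, prob_bind, ← (summable_toReal_mul p fun a => abs_prob_le _ _).tsum_sub
    (summable_toReal_mul p fun a => abs_prob_le _ _)]
  simp only [← mul_sub]
  rw [← Real.norm_eq_abs]
  refine (norm_tsum_le_tsum_norm hs.norm).trans ?_
  calc ∑' a, ‖(p a).toReal * (prob (f a) D - prob (g a) D)‖ ≤ ∑' a, (p a).toReal * ε := by
        refine hs.norm.tsum_le_tsum (fun a => ?_) ((summable_toReal p).mul_right ε)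
        rw [norm_mul, Real.norm_of_nonneg ENNReal.toReal_nonneg]
        exact mul_le_mul_of_nonneg_left (h a) ENNReal.toReal_nonneg
    _ = ε := by rw [tsum_mul_right, tsum_toReal, one_mul]

theorem prob_eq_tsum (p : PMF α) (D : α → Bool) :
    prob p D = ∑' a, (p a).toReal * if D a = true then 1 else 0 := by
  have h := prob_bind p PMF.pure D
  rw [PMF.bind_pure] at h
  rw [h]
  congr 1
  funext a
  congr 1
  unfold prob
  rw [PMF.pure_map, PMF.pure_apply]
  by_cases ha : D a = true <;> simp [ha]

/-- Two events that agree outside a bad event `B` differ in probability by at most that of `B`. -/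
theorem abs_prob_sub_le_prob (p : PMF α) {D D' B : α → Bool}
    (h : ∀ a, B a = false → D a = D' a) : |prob p D - prob p D'| ≤ prob p B := by
  have hi : ∀ (D : α → Bool) a, |if D a = true then (1 : ℝ) else 0| ≤ 1 := fun D a => by
    split_ifs <;> simp
  have hs : Summable fun a =>
      (p a).toReal * ((if D a = true then (1 : ℝ) else 0) - if D' a = true then 1 else 0) := by
    simp only [mul_sub]
    exact (summable_toReal_mul p (hi D)).sub (summable_toReal_mul p (hi D'))
  simp only [prob_eq_tsum p]
  rw [← (summable_toReal_mul p (hi D)).tsum_sub (summable_toReal_mul p (hi D'))]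
  simp only [← mul_sub]
  rw [← Real.norm_eq_abs]
  refine (norm_tsum_le_tsum_norm hs.norm).trans
    (hs.norm.tsum_le_tsum (fun a => ?_) (summable_toReal_mul p (hi B)))
  rw [norm_mul, Real.norm_of_nonneg ENNReal.toReal_nonneg]
  refine mul_le_mul_of_nonneg_left ?_ ENNReal.toReal_nonneg
  rcases hB : B a with _ | _
  · simp [h a hB]
  · rw [if_pos (show true = true from rfl)]
    split_ifs <;> simp

end Prob

/-! ### Negligible functions and uniform advantages -/

section Negligible

theorem Negligible.of_abs_le {f g : ℕ → ℝ} (hg : Negligible g) (h : ∀ k, |f k| ≤ g k) :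
    Negligible f :=
  Asymptotics.SuperpolynomialDecay.trans_abs_le hg fun k => (h k).trans (le_abs_self _)

theorem Negligible.add {f g : ℕ → ℝ} (hf : Negligible f) (hg : Negligible g) :
    Negligible fun k => f k + g k := Asymptotics.SuperpolynomialDecay.add hf hg

theorem Negligible.polyBdd_mul {f : ℕ → ℝ} (hf : Negligible f) {s : ℕ → ℕ}
    (hs : PolyBdd (fun k => k) s) (h0 : ∀ k, 0 ≤ f k) : Negligible fun k => s k * f k := by
  obtain ⟨p, hp⟩ := hs
  have h := Asymptotics.SuperpolynomialDecay.polynomial_mul hf (p.map (Nat.castRingHom ℝ))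
  refine Negligible.of_abs_le h fun k => ?_
  rw [abs_of_nonneg (mul_nonneg (Nat.cast_nonneg _) (h0 k))]
  refine mul_le_mul_of_nonneg_right ?_ (h0 k)
  rw [Polynomial.eval_natCast_map]
  exact Nat.cast_le.2 (hp k)

/-- If every choice of parameters has negligible advantage, then so has the worst choice. -/
theorem exists_negligible_bound {P : ℕ → Type} [∀ k, Nonempty (P k)] (adv : ∀ k, P k → ℝ)
    (h0 : ∀ k c, 0 ≤ adv k c) (h1 : ∀ k c, adv k c ≤ 1)
    (h : ∀ c : ∀ k, P k, Negligible fun k => adv k (c k)) :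
    ∃ ε : ℕ → ℝ, Negligible ε ∧ (∀ k, 0 ≤ ε k) ∧ ∀ k c, adv k c ≤ ε k := by
  -- The supremum need not be attained, but some choice reaches half of it; if it is not positive,
  -- all advantages vanish and any choice works.
  have key : ∀ k, ∃ c, ∀ c', adv k c' ≤ 2 * adv k c := by
    intro k
    have hb : BddAbove (Set.range (adv k)) := ⟨1, by rintro _ ⟨c, rfl⟩; exact h1 k c⟩
    by_cases hs : sSup (Set.range (adv k)) ≤ 0
    · obtain ⟨c⟩ := ‹∀ k, Nonempty (P k)› k
      refine ⟨c, fun c' => ?_⟩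
      linarith [le_csSup hb ⟨c', rfl⟩, h0 k c]
    · obtain ⟨_, ⟨c, rfl⟩, hc⟩ := exists_lt_of_lt_csSup (Set.range_nonempty (adv k))
        (show sSup (Set.range (adv k)) / 2 < sSup (Set.range (adv k)) by linarith)
      exact ⟨c, fun c' => by linarith [le_csSup hb ⟨c', rfl⟩]⟩
  choose c hc using key
  refine ⟨fun k => 2 * adv k (c k), ?_, fun k => by linarith [h0 k (c k)], hc⟩
  convert (h c).add (h c) using 2
  ring

theorem Cost.const_false {α : Type} [BitCode α] {s : ℕ} : Cost s (fun _ : α => false) := by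
  refine Comp.of_subset ?_
  rw [bitsOf_bool]
  simp

theorem PolySize.of_cost {α β : ℕ → Type} [∀ k, BitCode (α k)] [∀ k, BitCode (β k)]
    {f : ∀ k, α k → β k} (p : Polynomial ℕ) (h : ∀ k, Cost (p.eval k) (f k))
    (hα : PolyLen (fun k => k) α) (hβ : PolyLen (fun k => k) β) : PolySize f :=
  GP.polySize ⟨p, h⟩ hα hβ

/-- Indistinguishability for all choices of messages is uniform in the messages and in the
distinguishing circuits. -/
theorem Indist.exists_bound {M O : ℕ → Type} [∀ k, BitCode (O k)] [∀ k, Nonempty (M k)]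
    (hO : PolyLen (fun k => k) O) {X : ∀ k, M k → PMF (O k)}
    (h : ∀ m₀ m₁ : ∀ k, M k, Indist (fun k => X k (m₀ k)) (fun k => X k (m₁ k)))
    (p : Polynomial ℕ) :
    ∃ ε : ℕ → ℝ, Negligible ε ∧ (∀ k, 0 ≤ ε k) ∧ ∀ k (m₀ m₁ : M k) (D : O k → Bool),
      Cost (p.eval k) D → |prob (X k m₀) D - prob (X k m₁) D| ≤ ε k := by
  have hne : ∀ k, Nonempty (M k × M k × {D : O k → Bool // Cost (p.eval k) D}) := fun k =>
    ⟨(Classical.arbitrary _, Classical.arbitrary _, ⟨_, Cost.const_false⟩)⟩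
  obtain ⟨ε, h1, h2, h3⟩ := exists_negligible_bound
    (P := fun k => M k × M k × {D : O k → Bool // Cost (p.eval k) D})
    (fun k c => |prob (X k c.1) c.2.2.1 - prob (X k c.2.1) c.2.2.1|) (fun _ _ => abs_nonneg _)
    (fun _ _ => abs_prob_sub_le_one _ _ _)
    (fun c => h _ _ _ (PolySize.of_cost p (fun k => (c k).2.2.2) hO PolyLen.bool))
  exact ⟨ε, h1, h2, fun k m₀ m₁ D hD => h3 k (m₀, m₁, ⟨D, hD⟩)⟩

open Classical in
/-- Binding is uniform in the circuits that try to open a commitment in two ways. -/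
theorem ComScheme.Binding.exists_bound {M : ℕ → Type} [∀ k, BitCode (M k)] [∀ k, Nonempty (M k)]
    {C : ∀ k, ComScheme (M k)} (h : ComScheme.Binding C)
    (hP : PolyLen (fun k => k) fun k => (C k).Par)
    (hO : PolyLen (fun k => k) fun k => (M k × (C k).Rnd) × (M k × (C k).Rnd)) (p : Polynomial ℕ) :
    ∃ ε : ℕ → ℝ, Negligible ε ∧ (∀ k, 0 ≤ ε k) ∧
      ∀ k (B : (C k).Par → (M k × (C k).Rnd) × (M k × (C k).Rnd)), Cost (p.eval k) B →
        prob (C k).gen (fun par =>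
          decide ((B par).1.1 ≠ (B par).2.1 ∧
            (C k).com par (B par).1.1 (B par).1.2 = (C k).com par (B par).2.1 (B par).2.2)) ≤
          ε k := by
  -- A constant output costs at most `p'` gates. Enlarging the budget by `p'` makes the set of
  -- admissible `B` nonempty, as `exists_negligible_bound` requires.
  obtain ⟨p', hp'⟩ := hO
  have hne : ∀ k, Nonempty {B : (C k).Par → (M k × (C k).Rnd) × (M k × (C k).Rnd) //
      Cost ((p + p').eval k) B} := fun k =>
    ⟨⟨_, (Cost.const (Classical.arbitrary _)).mono
      ((hp' k).trans (by rw [Polynomial.eval_add]; exact Nat.le_add_left _ _))⟩⟩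
  obtain ⟨ε, h1, h2, h3⟩ := exists_negligible_bound
    (P := fun k => {B : (C k).Par → (M k × (C k).Rnd) × (M k × (C k).Rnd) //
      Cost ((p + p').eval k) B})
    (fun k c => prob (C k).gen (fun par =>
          decide ((c.1 par).1.1 ≠ (c.1 par).2.1 ∧
            (C k).com par (c.1 par).1.1 (c.1 par).1.2 =
              (C k).com par (c.1 par).2.1 (c.1 par).2.2)))
    (fun _ _ => prob_nonneg _ _) (fun _ _ => prob_le_one _ _)
    (fun c => h _ (PolySize.of_cost _ (fun k => (c k).2) hP ⟨p', hp'⟩))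
  exact ⟨ε, h1, h2, fun k B hB => h3 k ⟨B, hB.mono (by
    rw [Polynomial.eval_add]; exact Nat.le_add_right _ _)⟩⟩

end Negligible

/-! ### Spaces with an efficiently sampled uniform distribution -/

/-- The uniform distribution on `Ω k` can be sampled. -/
def Drawable (Ω : ℕ → Type) [∀ k, BitCode (Ω k)] [∀ k, Fintype (Ω k)] [∀ k, Nonempty (Ω k)] : Prop :=
  PolySampler (α := fun _ => Unit) (β := Ω) fun k _ => PMF.uniformOfFintype (Ω k)

namespace Drawable

variable {Ω Ω' α β : ℕ → Type} [∀ k, BitCode (Ω k)] [∀ k, Fintype (Ω k)] [∀ k, Nonempty (Ω k)]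
  [∀ k, BitCode (Ω' k)] [∀ k, Fintype (Ω' k)] [∀ k, Nonempty (Ω' k)]
  [∀ k, BitCode (α k)] [∀ k, BitCode (β k)]

theorem polyLen (h : Drawable Ω) : PolyLen (fun k => k) Ω := by
  obtain ⟨t, m, g, hg, -⟩ := h
  exact hg.polyLen_right

theorem polySampler (h : Drawable Ω) {g : ∀ k, α k × Ω k → β k} (hg : PolySize g) :
    PolySampler fun k (x : α k) => (PMF.uniformOfFintype (Ω k)).map fun ω => g k (x, ω) := by
  obtain ⟨t, m, f, hf, e⟩ := h
  refine ⟨t, m, fun k x => g k (x.1, f k ((), x.2)), ?_, fun k x => ?_⟩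
  · exact (hg.gp.comp (GP.fst.prod (hf.gp.comp ((GP.const PolyLen.unit fun _ => ()).prod
      GP.snd)))).polySize (hg.polyLen_left.fst.prod hf.polyLen_left.snd) hg.polyLen_right
  · have e' : (PMF.uniformOfFintype _).map (fun ω => f k ((), ω)) = PMF.uniformOfFintype (Ω k) :=
      e k ()
    dsimp only
    rw [← e', PMF.map_comp]
    rfl

theorem draws {t : ℕ → ℕ} {m : ∀ k, Fin (t k) → ℕ}
    (h : PolyLen (fun k => k) fun k => ∀ i : Fin (t k), Fin (m k i + 1)) :
    Drawable fun k => ∀ i : Fin (t k), Fin (m k i + 1) :=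
  ⟨t, m, fun _ x => x.2, GP.snd.polySize (PolyLen.unit.prod h) h, fun _ _ => PMF.map_id _⟩

theorem of_map (h : Drawable Ω) {g : ∀ k, Ω k → Ω' k} (hg : GP (fun k => k) g)
    (hl : PolyLen (fun k => k) Ω')
    (e : ∀ k, (PMF.uniformOfFintype (Ω k)).map (g k) = PMF.uniformOfFintype (Ω' k)) :
    Drawable Ω' := by
  have := h.polySampler (α := fun _ => Unit) (g := fun k x => g k x.2)
    ((hg.comp GP.snd).polySize (PolyLen.unit.prod h.polyLen) hl)
  simp only [e] at this
  exact this

/-- Both sequences of draws are concatenated. Cutting the result back into two is a bijection that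
only moves bits, so it preserves uniformity and needs no gates. -/
theorem prod (h : Drawable Ω) (h' : Drawable Ω') : Drawable fun k => Ω k × Ω' k := by
  have hl := h.polyLen
  have hl' := h'.polyLen
  obtain ⟨t, m, f, hf, e⟩ := h
  obtain ⟨t', m', f', hf', e'⟩ := h'
  let σ : ∀ k, Fin (t k) ⊕ Fin (t' k) → ℕ := fun k => Sum.elim (m k) (m' k)
  let ψ : ∀ k, (∀ i : Fin (t k + t' k), Fin (σ k (finSumFinEquiv.symm i) + 1)) ≃
      (∀ i : Fin (t k), Fin (m k i + 1)) × (∀ i : Fin (t' k), Fin (m' k i + 1)) := fun k =>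
    (Equiv.piCongrLeft (fun s => Fin (σ k s + 1)) finSumFinEquiv.symm).trans
      (Equiv.sumPiEquivProdPi _)
  have hb : ∀ k (s : Fin (t k) ⊕ Fin (t' k)) l, ∃ i l', ∀ ω : ∀ i : Fin (t k + t' k),
      Fin (σ k (finSumFinEquiv.symm i) + 1),
      code (Equiv.piCongrLeft (fun s => Fin (σ k s + 1)) finSumFinEquiv.symm ω s) l =
        code (ω i) l' := by
    intro k s l
    obtain ⟨i, rfl⟩ := finSumFinEquiv.symm.surjective s
    exact ⟨i, l, fun ω => by rw [Equiv.piCongrLeft_apply_apply]⟩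
  have hψ1 : GP (fun k => k) fun k ω => (ψ k ω).1 := by
    refine GP.of_bits fun k l => ?_
    obtain ⟨⟨i, l⟩, rfl⟩ := (finSigmaFinEquiv (n := fun i => len (Fin (m k i + 1)))).surjective l
    obtain ⟨i', l', h⟩ := hb k (Sum.inl i) l
    exact ⟨finSigmaFinEquiv ⟨i', l'⟩, fun ω => by rw [code_pi, code_pi]; exact h ω⟩
  have hψ2 : GP (fun k => k) fun k ω => (ψ k ω).2 := by
    refine GP.of_bits fun k l => ?_
    obtain ⟨⟨i, l⟩, rfl⟩ := (finSigmaFinEquiv (n := fun i => len (Fin (m' k i + 1)))).surjective l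
    obtain ⟨i', l', h⟩ := hb k (Sum.inr i) l
    exact ⟨finSigmaFinEquiv ⟨i', l'⟩, fun ω => by rw [code_pi, code_pi]; exact h ω⟩
  have hlen : PolyLen (fun k => k)
      fun k => ∀ i : Fin (t k + t' k), Fin (σ k (finSumFinEquiv.symm i) + 1) := by
    refine (PolyBdd.add hf.polyLen_left.snd hf'.polyLen_left.snd).mono fun k => ?_
    show ∑ i, Nat.size _ ≤ ∑ i, Nat.size _ + ∑ i, Nat.size _
    rw [Fin.sum_univ_add]
    simp [σ]
  have hu := GP.const (sz := fun k => k)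
    (α := fun k => ∀ i : Fin (t k + t' k), Fin (σ k (finSumFinEquiv.symm i) + 1))
    PolyLen.unit fun _ => ()
  refine (draws hlen).of_map (g := fun k ω => (f k ((), (ψ k ω).1), f' k ((), (ψ k ω).2)))
    ((hf.gp.comp (hu.prod hψ1)).prod (hf'.gp.comp (hu.prod hψ2))) (hl.prod hl') fun k => ?_
  rw [← uniform_map_prod (e k ()) (e' k ()), ← uniform_map_equiv (ψ k), PMF.map_comp]
  rfl

/-- One sequence of `s * t` draws is regrouped into `s` blocks of length `t`, again by mere
rewiring. -/
theorem pi (h : Drawable Ω) {s : ℕ → ℕ} (hs : PolyBdd (fun k => k) s) :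
    Drawable fun k => Fin (s k) → Ω k := by
  have hl := h.polyLen
  obtain ⟨t, m, f, hf, e⟩ := h
  let ψ : ∀ k, (∀ i : Fin (s k * t k), Fin (m k (finProdFinEquiv.symm i).2 + 1)) ≃
      (Fin (s k) → ∀ i : Fin (t k), Fin (m k i + 1)) := fun k =>
    (Equiv.piCongrLeft (fun x : Fin (s k) × Fin (t k) => Fin (m k x.2 + 1))
      finProdFinEquiv.symm).trans
      { toFun := fun F i j => F (i, j)
        invFun := fun G x => G x.1 x.2
        left_inv := fun _ => rfl
        right_inv := fun _ => rfl }
  have hb : ∀ k (x : Fin (s k) × Fin (t k)) l, ∃ i l', ∀ ω : ∀ i : Fin (s k * t k),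
      Fin (m k (finProdFinEquiv.symm i).2 + 1),
      code (Equiv.piCongrLeft (fun x : Fin (s k) × Fin (t k) => Fin (m k x.2 + 1))
        finProdFinEquiv.symm ω x) l = code (ω i) l' := by
    intro k x l
    obtain ⟨i, rfl⟩ := finProdFinEquiv.symm.surjective x
    exact ⟨i, l, fun ω => by rw [Equiv.piCongrLeft_apply_apply]⟩
  have hψ : GP (I := Σ k, Fin (s k)) (fun x => x.1)
      (α := fun x => ∀ i : Fin (s x.1 * t x.1), Fin (m x.1 (finProdFinEquiv.symm i).2 + 1))
      (β := fun x => ∀ i : Fin (t x.1), Fin (m x.1 i + 1)) fun x ω => ψ x.1 ω x.2 := by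
    refine GP.of_bits fun x l => ?_
    obtain ⟨⟨i, l⟩, rfl⟩ := (finSigmaFinEquiv (n := fun i => len (Fin (m x.1 i + 1)))).surjective l
    obtain ⟨i', l', h⟩ := hb x.1 (x.2, i) l
    exact ⟨finSigmaFinEquiv ⟨i', l'⟩, fun ω => by rw [code_pi, code_pi]; exact h ω⟩
  have hlen : PolyLen (fun k => k)
      fun k => ∀ i : Fin (s k * t k), Fin (m k (finProdFinEquiv.symm i).2 + 1) := by
    refine (hs.mul hf.polyLen_left.snd).mono fun k => ?_
    show ∑ i, Nat.size _ ≤ s k * ∑ i, Nat.size _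
    rw [← finProdFinEquiv.sum_comp]
    simp [Fintype.sum_prod_type]
  refine (draws hlen).of_map (g := fun k ω i => f k ((), ψ k ω i))
    (GP.pi hs ((hf.gp.pull Sigma.fst).comp ((GP.const PolyLen.unit fun _ => ()).prod hψ)))
    (PolyLen.pi hs hl) fun k => ?_
  rw [← uniform_map_pi (e k ()), ← uniform_map_equiv (ψ k), PMF.map_comp]
  rfl

end Drawable

/-! ### Random permutations and nonzero residues -/

theorem testBit_eq_false_of_size_le {m x l : ℕ} (hx : x < m) (hl : m.size ≤ l) :
    x.testBit l = false :=
  Nat.testBit_lt_two_pow (hx.trans_le ((Nat.lt_size_self m).le.trans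
    (Nat.pow_le_pow_right (by norm_num) hl)))

/-- Encodings of the same number below different bounds differ only in leading zeros. -/
theorem GP.of_val_eq {I : Type} {sz : I → ℕ} {a b : I → ℕ} {f : ∀ i, Fin (a i) → Fin (b i)}
    (h : ∀ i x, (f i x).val = x.val) : GP sz f := by
  refine GP.of_bits' fun i l => ?_
  by_cases hl : l.val < Nat.size (a i)
  · refine Or.inr ⟨⟨l, hl⟩, fun x => ?_⟩
    show (f i x).val.testBit l = x.val.testBit l
    rw [h]
  · refine Or.inl fun x => ?_
    show (f i x).val.testBit l = false
    rw [h]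
    exact testBit_eq_false_of_size_le x.2 (not_lt.1 hl)

theorem GP.zmod_of_val_eq {I : Type} {sz : I → ℕ} {a b : I → ℕ} [∀ i, NeZero (b i)]
    {f : ∀ i, Fin (a i) → ZMod (b i)} (h : ∀ i x, (f i x).val = x.val) : GP sz f := by
  refine GP.of_bits' fun i l => ?_
  by_cases hl : l.val < Nat.size (a i)
  · refine Or.inr ⟨⟨l, hl⟩, fun x => ?_⟩
    show (f i x).val.testBit l = x.val.testBit l
    rw [h]
  · refine Or.inl fun x => ?_
    show (f i x).val.testBit l = false
    rw [h]
    exact testBit_eq_false_of_size_le x.2 (not_lt.1 hl)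

/-- A permutation is given by the table of its values. -/
theorem GP.perm {I : Type} {sz : I → ℕ} {α : I → Type} [∀ i, BitCode (α i)] {m : I → ℕ}
    {f : ∀ i, α i → Equiv.Perm (Fin (m i))}
    (h : GP sz (β := fun i => Fin (m i) → Fin (m i)) fun i x j => f i x j) : GP sz f := h

theorem GP.permTable {I : Type} {sz : I → ℕ} {m : I → ℕ} :
    GP sz (α := fun i => Equiv.Perm (Fin (m i))) (β := fun i => Fin (m i) → Fin (m i))
      fun _ x j => x j :=
  GP.of_bits fun _ l => ⟨l, fun _ => rfl⟩

theorem GP.permApply {I : Type} {sz : I → ℕ} {α : I → Type} [∀ i, BitCode (α i)] {m : I → ℕ}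
    {f : ∀ i, α i → Equiv.Perm (Fin (m i))} (h : GP sz f) (j : ∀ i, Fin (m i)) :
    GP sz (β := fun i => Fin (m i)) fun i x => f i x (j i) :=
  GP.proj (m := m) (β := fun i _ => Fin (m i)) (f := fun i x l => f i x l)
    (GP.comp (β := fun i => Equiv.Perm (Fin (m i))) GP.permTable h) j

theorem GP.subtypeMk {I : Type} {sz : I → ℕ} {α β : I → Type} [∀ i, BitCode (α i)]
    [∀ i, BitCode (β i)] {p : ∀ i, β i → Prop} {f : ∀ i, α i → {x // p i x}}
    (h : GP sz fun i x => (f i x).1) : GP sz f := h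

theorem GP.subtypeVal {I : Type} {sz : I → ℕ} {β : I → Type}
    [∀ i, BitCode (β i)] {p : ∀ i, β i → Prop} :
    GP sz (α := fun i => {x // p i x}) fun _ x => x.1 :=
  GP.of_bits fun _ l => ⟨l, fun _ => rfl⟩

/-- The permutation of `{0, …, N - 1}` after `j` steps of a random shuffle with draws `d`. -/
def shuffle {N : ℕ} (d : ∀ i : Fin N, Fin (i.val + 1)) : ℕ → Equiv.Perm (Fin N)
  | 0 => 1
  | j + 1 => if h : j < N then
      Equiv.swap ⟨j, h⟩ (Fin.castLE h (d ⟨j, h⟩)) * shuffle d j else shuffle d j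

theorem shuffle_succ {N : ℕ} (d : ∀ i : Fin N, Fin (i.val + 1)) (j : Fin N) :
    shuffle d (j + 1) = Equiv.swap j (Fin.castLE j.2 (d j)) * shuffle d j := by
  rw [shuffle, dif_pos j.2]

/-- Step `j` exchanges `j` with a value at most `j`, so the steps before `j` leave everything from
`j` on in place. -/
theorem shuffle_apply_of_le {N : ℕ} (d : ∀ i : Fin N, Fin (i.val + 1)) (j : ℕ) (i : Fin N)
    (h : j ≤ i) : shuffle d j i = i := by
  induction j with
  | zero => rfl
  | succ j ih =>
    have hj : j < N := by omega
    rw [shuffle, dif_pos hj, Equiv.Perm.mul_apply, ih (by omega), Equiv.swap_apply_of_ne_of_ne]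
    · exact fun e => by rw [Fin.ext_iff] at e; simp only at e; omega
    · intro e
      have := (d ⟨j, hj⟩).2
      rw [Fin.ext_iff] at e
      simp only [Fin.val_castLE] at e this
      omega

/-- The last draw can be read off: earlier steps fix `j`, so after step `j` the image of `j` is the
draw `d j`. Cancelling that transposition reduces to one step less. -/
theorem shuffle_injective_aux {N : ℕ} (d d' : ∀ i : Fin N, Fin (i.val + 1)) (j : ℕ) (hj : j ≤ N)
    (h : shuffle d j = shuffle d' j) : ∀ i : Fin N, i.val < j → d i = d' i := by
  induction j with
  | zero => intro i hi; omega
  | succ j ih =>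
    have e1 := shuffle_succ d ⟨j, hj⟩
    have e2 := shuffle_succ d' ⟨j, hj⟩
    dsimp only at e1 e2
    have hd : d ⟨j, hj⟩ = d' ⟨j, hj⟩ := by
      have e := congrArg (fun π : Equiv.Perm (Fin N) => π ⟨j, hj⟩) h
      rw [e1, e2, Equiv.Perm.mul_apply, Equiv.Perm.mul_apply,
        shuffle_apply_of_le d j ⟨j, hj⟩ le_rfl, shuffle_apply_of_le d' j ⟨j, hj⟩ le_rfl, Equiv.swap_apply_left, Equiv.swap_apply_left] at e
      exact Fin.castLE_injective _ e
    rw [e1, e2, hd] at h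
    have h' := mul_left_cancel h
    intro i hi
    rcases Nat.lt_succ_iff_lt_or_eq.1 hi with hi | hi
    · exact ih (by omega) h' i hi
    · obtain rfl : i = ⟨j, hj⟩ := Fin.ext hi
      exact hd

/-- There are `1 * 2 * ⋯ * N = N!` sequences of draws, as many as permutations, so injectivity
suffices. -/
theorem shuffle_bijective (N : ℕ) :
    Function.Bijective fun d : (∀ i : Fin N, Fin (i.val + 1)) => shuffle d N := by
  rw [Fintype.bijective_iff_injective_and_card]
  constructor
  · intro d d' h
    exact funext fun i => shuffle_injective_aux d d' N le_rfl h i i.2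
  · rw [Fintype.card_perm, Fintype.card_pi, Fintype.card_fin]
    simp only [Fintype.card_fin]
    rw [Fin.prod_univ_eq_prod_range (fun i => i + 1) N, Finset.prod_range_add_one_eq_factorial]

theorem size_le_self (m : ℕ) : Nat.size m ≤ m :=
  Nat.size_le.2 Nat.lt_two_pow_self

theorem PolyLen.fin {I : Type} {sz : I → ℕ} {m : I → ℕ} (h : PolyBdd sz m) :
    PolyLen sz fun i => Fin (m i) :=
  PolyBdd.mono h fun _ => size_le_self _

theorem PolyLen.perm {I : Type} {sz : I → ℕ} {m : I → ℕ} (h : PolyBdd sz m) :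
    PolyLen sz fun i => Equiv.Perm (Fin (m i)) :=
  PolyBdd.mono (PolyLen.pi h (PolyLen.fin h)) fun _ => le_rfl

theorem drawable_perm {N : ℕ → ℕ} (hN : PolyBdd (fun k => k) N) :
    Drawable fun k => Equiv.Perm (Fin (N k)) := by
  have hl : PolyLen (fun k => k) fun k => ∀ i : Fin (N k), Fin (i.val + 1) := by
    refine (hN.mul hN).mono fun k => ?_
    show ∑ i : Fin (N k), Nat.size (i.val + 1) ≤ _
    refine (Finset.sum_le_card_nsmul _ _ (N k) fun i _ => ?_).trans (by simp)
    exact (size_le_self _).trans i.2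
  refine (Drawable.draws (m := fun k (i : Fin (N k)) => i.val) hl).of_map
    (g := fun k d => shuffle d (N k)) ?_ (PolyLen.perm hN)
    fun k => uniform_map_of_bijective (shuffle_bijective _)
  refine GP.iterate hN (st := fun k j d => shuffle d j)
    (F := fun k j x => Equiv.swap j (Fin.castLE j.2 (x.1 j)) * x.2) ?_ ?_
    (fun k j d => shuffle_succ d j)
  · exact GP.const (PolyLen.perm hN) fun _ => 1
  -- Multiplying by a transposition on the left acts on values, so each table entry is compared with
  -- the two exchanged values.
  · refine GP.perm (GP.pi (hN.pull _) ?_)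
    have hN' := hN.pull (fun p : (Σ p : (Σ k, Fin (N k)), Fin (N p.1)) => p.1.1)
    have hl' := PolyLen.fin hN'
    have h1 : GP (I := Σ p : (Σ k, Fin (N k)), Fin (N p.1)) (fun p => p.1.1)
        (α := fun p => (∀ i : Fin (N p.1.1), Fin (i.val + 1)) × Equiv.Perm (Fin (N p.1.1)))
        (β := fun p => Fin (N p.1.1)) fun p x => x.2 p.2 :=
      GP.permApply (I := Σ p : (Σ k, Fin (N k)), Fin (N p.1)) (sz := fun p => p.1.1)
        (α := fun p => (∀ i : Fin (N p.1.1), Fin (i.val + 1)) × Equiv.Perm (Fin (N p.1.1)))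
        (m := fun p => N p.1.1) (f := fun _ x => x.2) GP.snd fun p => p.2
    have h20 : GP (I := Σ p : (Σ k, Fin (N k)), Fin (N p.1)) (fun p => p.1.1)
        (α := fun p => (∀ i : Fin (N p.1.1), Fin (i.val + 1)) × Equiv.Perm (Fin (N p.1.1)))
        (β := fun p => ∀ i : Fin (N p.1.1), Fin (i.val + 1)) fun _ x => x.1 := GP.fst
    have h21 : GP (I := Σ p : (Σ k, Fin (N k)), Fin (N p.1)) (fun p => p.1.1)
        (α := fun p => (∀ i : Fin (N p.1.1), Fin (i.val + 1)) × Equiv.Perm (Fin (N p.1.1)))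
        (β := fun p => Fin (p.1.2.val + 1)) fun p x => x.1 p.1.2 := h20.proj fun p => p.1.2
    have h22 : GP (I := Σ p : (Σ k, Fin (N k)), Fin (N p.1)) (fun p => p.1.1)
        (α := fun p => Fin (p.1.2.val + 1)) (β := fun p => Fin (N p.1.1))
        fun p x => Fin.castLE p.1.2.2 x := GP.of_val_eq fun _ _ => rfl
    have h2 := h22.comp h21
    have h3 := GP.const (sz := fun p : (Σ p : (Σ k, Fin (N k)), Fin (N p.1)) => p.1.1)
      (α := fun p => (∀ i : Fin (N p.1.1), Fin (i.val + 1)) × Equiv.Perm (Fin (N p.1.1)))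
      hl' fun p => p.1.2
    have h := GP.ite hl' (GP.decEq hl' h1 h3) h2 (GP.ite hl' (GP.decEq hl' h1 h2) h3 h1)
    simpa only [decide_eq_true_eq, Equiv.Perm.mul_apply, Equiv.swap_apply_def] using h

theorem card_nonzero (q : ℕ) [Fact q.Prime] : Fintype.card {x : ZMod q // x ≠ 0} = q - 1 := by
  rw [← ZMod.card_units q]
  exact Fintype.card_congr unitsEquivNeZero.symm

/-- A bijection between `{0, …, q - 2}` and the nonzero residues. -/
def nonzeroOfFin (q : ℕ) [Fact q.Prime] (x : Fin (q - 2 + 1)) : {x : ZMod q // x ≠ 0} :=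
  -- The casts of `1, …, q - 2` miss just one nonzero residue, `q - 1 = -1`, which becomes the image
  -- of `0`. The bound is written `q - 2 + 1` to fit the form of a draw.
  ⟨if decide (x = 0) = true then -1 else (x.val : ZMod q), by
    have hq := (Fact.out : q.Prime).two_le
    split_ifs with h
    · exact neg_ne_zero.2 one_ne_zero
    · intro e
      rw [ZMod.natCast_eq_zero_iff] at e
      have := Nat.eq_zero_of_dvd_of_lt e (by have := x.2; omega)
      exact h (decide_eq_true (Fin.ext this))⟩

theorem nonzeroOfFin_bijective (q : ℕ) [Fact q.Prime] : Function.Bijective (nonzeroOfFin q) := by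
  have hq := (Fact.out : q.Prime).two_le
  have hval : ∀ x : Fin (q - 2 + 1), ((x.val : ℕ) : ZMod q).val = x.val := fun x =>
    ZMod.val_natCast_of_lt (by have := x.2; omega)
  have hneg : (-1 : ZMod q).val = q - 1 := by
    obtain ⟨m, rfl⟩ : ∃ m, q = m + 1 := ⟨q - 1, by omega⟩
    exact ZMod.val_neg_one m
  rw [Fintype.bijective_iff_injective_and_card]
  constructor
  · intro x y h
    have h' := congrArg (fun z => z.1.val) h
    simp only [nonzeroOfFin, decide_eq_true_eq] at h'
    have hx := x.2
    have hy := y.2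
    split_ifs at h' with h1 h2 h2
    · rw [h1, h2]
    · rw [hneg, hval] at h'; omega
    · rw [hneg, hval] at h'; omega
    · rw [hval, hval] at h'; exact Fin.ext h'
  · rw [Fintype.card_fin, card_nonzero]
    omega

theorem drawable_nonzero {q : ℕ → ℕ} [∀ k, Fact (q k).Prime]
    (hq : PolyLen (fun k => k) fun k => ZMod (q k)) :
    Drawable fun k => {x : ZMod (q k) // x ≠ 0} := by
  have hl1 : PolyLen (fun k => k) fun k => Fin (q k - 2 + 1) := hq.mono fun k =>
    Nat.size_le_size (by have := (Fact.out : (q k).Prime).two_le; omega)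
  have hl : PolyLen (fun k => k) fun k => ∀ _ : Fin 1, Fin (q k - 2 + 1) :=
    PolyLen.pi (PolyBdd.const 1) hl1
  refine (Drawable.draws (t := fun _ => 1) (m := fun k _ => q k - 2) hl).of_map
    (g := fun k d => nonzeroOfFin (q k) (d 0)) ?_ hq fun k => ?_
  · refine GP.subtypeMk ?_
    have h0 : GP (fun k => k) (α := fun k => ∀ _ : Fin 1, Fin (q k - 2 + 1)) fun k d => d 0 :=
      GP.id.proj fun _ => 0
    refine GP.ite hq (GP.decEq hl1 h0 (GP.const hl1 fun _ => 0)) (GP.const hq fun _ => -1)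
      ((GP.zmod_of_val_eq (f := fun k x => (x.val : ZMod (q k))) fun k x => ?_).comp h0)
    have := (Fact.out : (q k).Prime).two_le
    exact ZMod.val_natCast_of_lt (by have := x.2; omega)
  · exact uniform_map_of_bijective ((nonzeroOfFin_bijective (q k)).comp
      (Equiv.funUnique (Fin 1) (Fin (q k - 2 + 1))).bijective)

/-! ### Binary expansions -/

theorem sum_testBit (n v : ℕ) (hv : v < 2 ^ n) :
    ∑ i : Fin n, (if v.testBit i.val then 2 ^ i.val else 0) = v := by
  induction n generalizing v with
  | zero =>
    have : v = 0 := by simpa using hv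
    simp [this]
  | succ n ih =>
    have h2 : v / 2 < 2 ^ n := by rw [pow_succ] at hv; omega
    rw [Fin.sum_univ_succ]
    have e : ∀ i : Fin n, (if v.testBit (i.succ : Fin (n + 1)).val then 2 ^ (i.succ : Fin (n + 1)).val
        else 0) = 2 * (if (v / 2).testBit i.val then 2 ^ i.val else 0) := by
      intro i
      rw [Fin.val_succ, Nat.testBit_succ, pow_succ]
      split_ifs <;> ring
    rw [Finset.sum_congr rfl fun i _ => e i, ← Finset.mul_sum, ih _ h2]
    simp only [Fin.val_zero, Nat.testBit_zero, pow_zero, decide_eq_true_eq]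
    split_ifs <;> omega

theorem sum_bit (q : ℕ) {n : ℕ} (v : Fin (2 ^ n)) :
    ∑ j : Fin n, ((2 : ZMod q) ^ (n - 1 - j.val)) * bit q v j = (v.val : ZMod q) := by
  conv_rhs => rw [← sum_testBit n v.val v.2]
  -- Reversing the index passes from the big-endian order of `bit` to the order of `testBit`.
  rw [Nat.cast_sum, ← Equiv.sum_comp Fin.revPerm]
  refine Finset.sum_congr rfl fun j _ => ?_
  have hj : n - (j.val + 1) = n - 1 - j.val := by omega
  simp only [Fin.revPerm_apply, Fin.val_rev, hj, bit]
  have hj' : n - 1 - (n - 1 - j.val) = j.val := by omega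
  simp [hj', apply_ite Nat.cast]

/-- The number with given bits in big-endian order. -/
def ofBitsBE {n : ℕ} (b : Fin n → Bool) : Fin (2 ^ n) :=
  ⟨Nat.ofBits fun i => b i.rev, Nat.ofBits_lt_two_pow _⟩

theorem testBit_ofBitsBE {n : ℕ} (b : Fin n → Bool) (j : Fin n) :
    (ofBitsBE b).val.testBit (n - 1 - j.val) = b j := by
  have hj : n - 1 - j.val < n := by omega
  rw [ofBitsBE, Nat.testBit_ofBits_lt _ _ hj]
  congr 1
  ext
  simp only [Fin.val_rev]
  omega

theorem bit_ofBitsBE (q : ℕ) {n : ℕ} (b : Fin n → Bool) (j : Fin n) :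
    bit q (ofBitsBE b) j = if b j then 1 else 0 := by
  rw [bit, testBit_ofBitsBE]

/-! ### Correctness of the comparison -/

section Accum

variable {q n : ℕ} {M N : Type} [AddCommGroup M] [Module (ZMod q) M] [AddCommGroup N]
  [Module (ZMod q) N]

theorem wAccum_zero (a b : Fin n → M) : wAccum (q := q) a b 0 = 0 := by
  simp [wAccum]

theorem wAccum_succ (a b : Fin n → M) (j : Fin n) :
    wAccum (q := q) a b (j + 1) =
      wAccum (q := q) a b j + ((2 : ZMod q) ^ (2 + j.val)) • (a j - b j) := by
  unfold wAccum
  have h : (Finset.univ.filter fun k : Fin n => k.val < j.val + 1) =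
      insert j (Finset.univ.filter fun k : Fin n => k.val < j.val) := by
    ext k
    simp only [Finset.mem_filter, Finset.mem_univ, true_and, Finset.mem_insert, Fin.ext_iff]
    omega
  rw [h, Finset.sum_insert (by simp), add_comm]

theorem map_wAccum (f : M →ₗ[ZMod q] N) (a b : Fin n → M) (j : ℕ) :
    f (wAccum (q := q) a b j) = wAccum (q := q) (fun k => f (a k)) (fun k => f (b k)) j := by
  simp [wAccum, map_sum]

/-- Encryption is linear in the pair of plaintext and randomness, so the comparison on ciphertexts
is the encryption of the comparison on such pairs; the projection to the plaintext is linear as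
well. -/
theorem map_cVec (f : M →ₗ[ZMod q] N) (e : M) (a b : Fin n → M) (i : Fin 2) (j : Fin (n + 1)) :
    f (cVec q e a b i j) = cVec q (f e) (fun k => f (a k)) (fun k => f (b k)) i j := by
  unfold cVec
  split_ifs <;> simp [map_wAccum]

end Accum

/-- The integer that `wAccum` represents, for differences `δ`. -/
def intAccum (δ : ℕ → ℤ) (j : ℕ) : ℤ := ∑ k ∈ Finset.range j, 2 ^ (2 + k) * δ k

theorem intAccum_eq_zero {δ : ℕ → ℤ} {j : ℕ} (h : ∀ k < j, δ k = 0) : intAccum δ j = 0 :=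
  Finset.sum_eq_zero fun k hk => by rw [h k (Finset.mem_range.1 hk), mul_zero]

/-- The first nonzero term is an odd multiple of `2 ^ (2 + d)`, and all later terms are divisible by
`2 ^ (3 + d)`. -/
theorem intAccum_eq_of_lt {δ : ℕ → ℤ} {d j : ℕ} (h : ∀ k < d, δ k = 0) (hd : Odd (δ d))
    (hj : d < j) : ∃ m : ℤ, intAccum δ j = 2 ^ (2 + d) * (2 * m + 1) := by
  induction j, hj using Nat.le_induction with
  | base =>
    obtain ⟨m, hm⟩ := hd
    exact ⟨m, by rw [intAccum, Finset.sum_range_succ, ← intAccum, intAccum_eq_zero h, hm, zero_add]⟩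
  | succ j hj ih =>
    obtain ⟨m, hm⟩ := ih
    obtain ⟨c, rfl⟩ := Nat.exists_eq_add_of_le hj
    refine ⟨m + 2 ^ c * δ (d.succ + c), ?_⟩
    rw [intAccum, Finset.sum_range_succ, ← intAccum, hm]
    rw [show 2 + (d.succ + c) = (2 + d) + 1 + c by omega, pow_add, pow_add]
    ring

theorem four_dvd_intAccum (δ : ℕ → ℤ) (j : ℕ) : (4 : ℤ) ∣ intAccum δ j :=
  Finset.dvd_sum fun k _ => by
    rw [pow_add]
    exact Dvd.intro (2 ^ k * δ k) (by ring)

theorem abs_intAccum_le {δ : ℕ → ℤ} (h : ∀ k, |δ k| ≤ 1) (j : ℕ) :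
    |intAccum δ j| ≤ 4 * (2 ^ j - 1) := by
  induction j with
  | zero => simp [intAccum]
  | succ j ih =>
    rw [intAccum, Finset.sum_range_succ, ← intAccum]
    refine (abs_add_le _ _).trans ?_
    have : |(2 : ℤ) ^ (2 + j) * δ j| ≤ 4 * 2 ^ j := by
      rw [abs_mul, abs_of_nonneg (by positivity), pow_add]
      nlinarith [h j, pow_pos (show (0 : ℤ) < 2 by norm_num) j]
    rw [pow_succ]
    linarith

theorem intAccum_ne_zero_of_lt {δ : ℕ → ℤ} {d j : ℕ} (h : ∀ k < d, δ k = 0) (hd : Odd (δ d))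
    (hj : d < j) : intAccum δ j ≠ 0 := by
  obtain ⟨m, hm⟩ := intAccum_eq_of_lt h hd hj
  rw [hm]
  exact mul_ne_zero (by positivity) (by omega)

/-- The difference of the bits of `x` and `y` at position `k`. -/
def bitDiff (n x y k : ℕ) : ℤ :=
  (if x.testBit (n - 1 - k) then 1 else 0) - if y.testBit (n - 1 - k) then 1 else 0

theorem abs_bitDiff_le (n x y k : ℕ) : |bitDiff n x y k| ≤ 1 := by
  unfold bitDiff
  split_ifs <;> simp

theorem wAccum_bit {q n : ℕ} (x y : Fin (2 ^ n)) (j : ℕ) (hj : j ≤ n) :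
    wAccum (q := q) (bit q x) (bit q y) j = ((intAccum (bitDiff n x y) j : ℤ) : ZMod q) := by
  induction j with
  | zero => simp [wAccum_zero, intAccum]
  | succ j ih =>
    have := wAccum_succ (q := q) (bit q x) (bit q y) ⟨j, hj⟩
    dsimp only at this
    rw [this, ih (by omega), intAccum, intAccum, Finset.sum_range_succ]
    push_cast
    congr 2
    simp [bit, bitDiff, apply_ite (Int.cast : ℤ → ZMod q)]

/-- The integer that `cVec` represents. -/
def intC (n x y : ℕ) (i : Fin 2) (j : ℕ) : ℤ :=
  if j < n then (if i = 0 then 1 else -1) + bitDiff n x y j + intAccum (bitDiff n x y) j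
  else intAccum (bitDiff n x y) n

theorem cVec_bit {q n : ℕ} (x y : Fin (2 ^ n)) (i : Fin 2) (j : Fin (n + 1)) :
    cVec q (1 : ZMod q) (bit q x) (bit q y) i j = ((intC n x y i j : ℤ) : ZMod q) := by
  unfold cVec intC
  by_cases hj : j.val < n
  · rw [dif_pos hj, if_pos hj, wAccum_bit _ _ _ hj.le]
    push_cast
    have : ((bitDiff n x y j : ℤ) : ZMod q) = bit q x ⟨j, hj⟩ - bit q y ⟨j, hj⟩ := by
      simp [bit, bitDiff, apply_ite (Int.cast : ℤ → ZMod q)]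
    rw [this]
    split_ifs <;> ring
  · rw [dif_neg hj, if_neg hj, wAccum_bit _ _ _ le_rfl]

/-- The constant and the bit difference contribute at most `2`, the weighted sum at most `4 + 8 + ⋯
+ 2 ^ (n + 1)`. This is the quantity that has to stay below `q`. -/
theorem abs_intC_le (n x y : ℕ) (i : Fin 2) (j : ℕ) :
    |intC n x y i j| ≤ 2 + 4 * (2 ^ n - 1) := by
  have hw := fun j => abs_intAccum_le (abs_bitDiff_le n x y) j
  unfold intC
  split_ifs with hj hi
  all_goals
    have h1 := abs_bitDiff_le n x y j
    have h2 := hw j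
    have h3 := hw n
    rw [abs_le] at *
  · have : (2 : ℤ) ^ j ≤ 2 ^ n := pow_le_pow_right₀ (by norm_num) hj.le
    constructor <;> linarith
  · have : (2 : ℤ) ^ j ≤ 2 ^ n := pow_le_pow_right₀ (by norm_num) hj.le
    constructor <;> linarith
  · constructor <;> linarith

theorem intCast_eq_zero_iff_of_abs_lt {q : ℕ} {z : ℤ} (h : |z| < q) : ((z : ℤ) : ZMod q) = 0 ↔ z = 0 := by
  rw [ZMod.intCast_zmod_eq_zero_iff_dvd]
  exact ⟨fun hd => Int.eq_zero_of_abs_lt_dvd hd h, fun e => e ▸ dvd_zero _⟩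

/-- Whether the vector with index `i` contains a zero when comparing `x` and `y`. -/
def cmpFlag {m : ℕ} (x y : Fin m) (i : Fin 2) : Prop := if i = 0 then x ≤ y else y ≤ x

/-- The witness `d` is the first position with different bits, or `n` for equal inputs. It does not
depend on `i`: both vectors have their only possible zero in the same place, which allows one
permutation to hide both. -/
theorem exists_intC_eq_zero_iff {n : ℕ} (x y : Fin (2 ^ n)) :
    ∃ d : Fin (n + 1), ∀ i (j : Fin (n + 1)), intC n x y i j = 0 ↔ j = d ∧ cmpFlag x y i := by
  classical
  have hdvd := four_dvd_intAccum (bitDiff n x y)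
  by_cases h : ∃ k, k < n ∧ bitDiff n x y k ≠ 0
  · obtain ⟨hd, hne⟩ := Nat.find_spec h
    have hmin : ∀ k < Nat.find h, bitDiff n x y k = 0 := fun k hk => by
      by_contra hk'
      exact Nat.find_min h hk ⟨hk.trans hd, hk'⟩
    set d := Nat.find h
    -- All more significant bits agree, so the sign of the difference at `d` decides the order.
    have hcases : (bitDiff n x y d = 1 ∧ y < x) ∨ (bitDiff n x y d = -1 ∧ x < y) := by
      have heq : ∀ l, n - 1 - d < l → x.val.testBit l = y.val.testBit l := by
        intro l hl
        by_cases hln : l < n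
        · have h0 := hmin (n - 1 - l) (by omega)
          unfold bitDiff at h0
          rw [show n - 1 - (n - 1 - l) = l by omega] at h0
          revert h0
          rcases x.val.testBit l <;> rcases y.val.testBit l <;> simp
        · have hp : 2 ^ n ≤ 2 ^ l := Nat.pow_le_pow_right (by norm_num) (by omega)
          rw [Nat.testBit_lt_two_pow (x.2.trans_le hp), Nat.testBit_lt_two_pow (y.2.trans_le hp)]
      unfold bitDiff at hne ⊢
      rcases hx : x.val.testBit (n - 1 - d) <;> rcases hy : y.val.testBit (n - 1 - d)
      · simp [hx, hy] at hne
      · exact Or.inr ⟨by simp, Fin.lt_def.2 (Nat.lt_of_testBit _ hx hy heq)⟩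
      · exact Or.inl ⟨by simp, Fin.lt_def.2 (Nat.lt_of_testBit _ hy hx fun l hl => (heq l hl).symm)⟩
      · simp [hx, hy] at hne
    have hodd : Odd (bitDiff n x y d) := by
      rcases hcases with ⟨e, -⟩ | ⟨e, -⟩ <;> rw [e] <;> decide
    refine ⟨⟨d, by omega⟩, fun i j => ?_⟩
    rw [Fin.ext_iff]
    dsimp only
    rcases lt_trichotomy j.val d with hj | hj | hj
    · rw [intC, if_pos (hj.trans hd), hmin _ hj, intAccum_eq_zero fun k hk => hmin k (hk.trans hj)]
      constructor
      · split_ifs <;> simp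
      · rintro ⟨e, -⟩; omega
    · rw [intC, if_pos (hj ▸ hd), hj, intAccum_eq_zero hmin, cmpFlag]
      rcases hcases with ⟨e, hlt⟩ | ⟨e, hlt⟩ <;> rw [e] <;> split_ifs <;>
        simp [hlt.le, hlt.not_ge]
    -- After `d` the sum is a nonzero multiple of `4`, and what is added to it lies between `-2` and
    -- `2`.
    · have hne := intAccum_ne_zero_of_lt hmin hodd hj
      have hnen := intAccum_ne_zero_of_lt hmin hodd hd
      have h1 := abs_bitDiff_le n x y j
      have h2 := hdvd j
      rw [abs_le] at h1
      constructor
      · intro e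
        exfalso
        unfold intC at e
        split_ifs at e <;> omega
      · rintro ⟨e, -⟩; omega
  · push Not at h
    have hxy : x = y := by
      apply Fin.ext
      apply Nat.eq_of_testBit_eq
      intro l
      by_cases hln : l < n
      · have h0 := h (n - 1 - l) (by omega)
        unfold bitDiff at h0
        rw [show n - 1 - (n - 1 - l) = l by omega] at h0
        revert h0
        rcases x.val.testBit l <;> rcases y.val.testBit l <;> simp
      · have hp : 2 ^ n ≤ 2 ^ l := Nat.pow_le_pow_right (by norm_num) (by omega)
        rw [Nat.testBit_lt_two_pow (x.2.trans_le hp), Nat.testBit_lt_two_pow (y.2.trans_le hp)]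
    have hflag : ∀ i, cmpFlag x y i := fun i => by
      rw [hxy, cmpFlag]
      split_ifs <;> exact le_rfl
    refine ⟨Fin.last n, fun i j => ?_⟩
    rw [Fin.ext_iff, Fin.val_last]
    by_cases hj : j.val < n
    · rw [intC, if_pos hj, h _ hj, intAccum_eq_zero fun k hk => h k (hk.trans hj)]
      constructor
      · split_ifs <;> simp
      · rintro ⟨e, -⟩; omega
    · rw [intC, if_neg hj, intAccum_eq_zero h]
      simp only [hflag, and_true, true_iff]
      omega

/-- The plaintexts of the comparison algorithm vanish in exactly one place, depending on the order
of the inputs. -/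
theorem exists_cVec_eq_zero_iff {q n : ℕ} (hn : 2 + 4 * (2 ^ n - 1) < q) (x y : Fin (2 ^ n)) :
    ∃ d : Fin (n + 1), ∀ i j,
      cVec q (1 : ZMod q) (bit q x) (bit q y) i j = 0 ↔ j = d ∧ cmpFlag x y i := by
  obtain ⟨d, hd⟩ := exists_intC_eq_zero_iff x y
  refine ⟨d, fun i j => ?_⟩
  rw [cVec_bit, intCast_eq_zero_iff_of_abs_lt, hd]
  refine (abs_intC_le n x y i j).trans_lt ?_
  have h1 : 1 ≤ 2 ^ n := Nat.one_le_two_pow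
  zify [h1] at hn
  exact hn

/-! ### Executions -/

theorem bind_congr_of_support {α β : Type} {p : PMF α} {f g : α → PMF β}
    (h : ∀ a ∈ p.support, f a = g a) : p.bind f = p.bind g := by
  ext b
  rw [PMF.bind_apply, PMF.bind_apply]
  refine tsum_congr fun a => ?_
  by_cases ha : p a = 0
  · rw [ha, zero_mul, zero_mul]
  · rw [h a ((PMF.mem_support_iff _ _).2 ha)]

section Exec

variable {q : ℕ} [Fact q.Prime] {n : ℕ} {E : HomEnc q} {C : ComScheme (ZMod q)}

theorem exec_eq {S T O : Type} (par : C.Par) (P : Party0 n E C S T O) (v₁ : Fin (2 ^ n)) :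
    exec par P v₁ = (PMF.uniformOfFintype (Tape1 n E)).bind fun tape =>
      (P.run1 par).bind fun s => (P.run2 (s.1, p1Reply par v₁ tape s.2)).bind fun t =>
        (P.run3 (t.1, p1Send t.2 (p1Output par v₁ s.2 (p1Reply par v₁ tape s.2) t.2))).bind
          fun o => PMF.pure (o,
            (tape, s.2.map (fun x => (x.1, zkAnswers par x.1 x.2)),
              s.2.bind fun x => (p1Reply par v₁ tape s.2).bind fun d => t.2.map fun w =>
                (w.1, zkOneMany x.1.1 (d w.1.1) w.2)),
            p1Output par v₁ s.2 (p1Reply par v₁ tape s.2) t.2) := rfl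

/-- The part of the randomness of the reply that stems from the randomness of the encrypted bits. -/
def rndShift (x y : Fin (2 ^ n)) (r : Fin n → E.Rnd) (i : Fin 2) (l : Fin (n + 1)) : E.Rnd :=
  (cVec q ((1, 0) : ZMod q × E.Rnd) (fun k => (bit q x k, r k)) (fun k => (bit q y k, 0)) i l).2

/-- By linearity everything that the reply inherits from the randomness of the ciphertexts of `P₀`
is an additive shift of the fresh uniform randomness. No validity of the public key enters. -/
theorem p1Vectors_eq_enc (v₁ : Fin (2 ^ n)) (tape : Tape1 n E) (m : Msg1 n E C) (x : Fin (2 ^ n))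
    (r : Fin n → E.Rnd) (hA : ∀ j, m.2.2 j = E.enc m.1 (bit q x j, r j)) (i : Fin 2)
    (j : Fin (n + 1)) :
    p1Vectors v₁ tape m i j = E.enc m.1
      ((tape.2.1 i j).1 * cVec q (1 : ZMod q) (bit q x) (bit q v₁) i (tape.1 j),
        tape.2.2 i j + (tape.2.1 i j).1 • rndShift x v₁ r i (tape.1 j)) := by
  have hA' : m.2.2 = fun j => E.enc m.1 (bit q x j, r j) := funext hA
  have h1 := map_cVec (E.enc m.1) ((1, 0) : ZMod q × E.Rnd) (fun k => (bit q x k, r k))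
    (fun k => (bit q v₁ k, 0)) i (tape.1 j)
  have h2 := map_cVec (LinearMap.fst (ZMod q) (ZMod q) E.Rnd) ((1, 0) : ZMod q × E.Rnd)
    (fun k => (bit q x k, r k)) (fun k => (bit q v₁ k, 0)) i (tape.1 j)
  simp only [LinearMap.fst_apply] at h2
  rw [p1Vectors, comparisonInitial, hA', ← h1, ← map_smul, ← map_add]
  congr 1
  refine Prod.ext ?_ ?_
  · simp only [Prod.fst_add, Prod.smul_fst, smul_eq_mul, h2, add_zero]
  · simp only [Prod.snd_add, Prod.smul_snd, rndShift, add_comm]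

theorem bit_eq_zero_or_one (q : ℕ) {n : ℕ} (v : Fin (2 ^ n)) (j : Fin n) :
    bit q v j = 0 ∨ bit q v j = 1 := by
  unfold bit
  split_ifs <;> simp

theorem sum_smul_enc (pk : E.PK) (x : Fin (2 ^ n)) (r : Fin n → E.Rnd) :
    ∑ j : Fin n, ((2 : ZMod q) ^ (n - 1 - j.val)) • E.enc pk (bit q x j, r j) =
      E.enc pk ((x.val : ZMod q), ∑ j : Fin n, ((2 : ZMod q) ^ (n - 1 - j.val)) • r j) := by
  simp only [← map_smul, ← map_sum]
  congr 1
  refine Prod.ext ?_ ?_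
  · simp [Prod.fst_sum, sum_bit]
  · simp [Prod.snd_sum]

/-- The first message of an honest `P₀`. -/
def honestMsg (par : C.Par) (v₀ : Fin (2 ^ n)) (pk : E.PK) (r : C.Rnd) (ρ : Fin n → E.Rnd) :
    Msg1 n E C :=
  (pk, C.com par (v₀.val : ZMod q) r, fun j => E.enc pk (bit q v₀ j, ρ j))

/-- The witnesses of an honest `P₀` for its first message. -/
def honestWit (v₀ : Fin (2 ^ n)) (r : C.Rnd) (ρ : Fin n → E.Rnd) : Wit1 n E C :=
  ((((v₀.val : ZMod q), r),
    ((v₀.val : ZMod q), ∑ j : Fin n, ((2 : ZMod q) ^ (n - 1 - j.val)) • ρ j)),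
    fun j => (bit q v₀ j, ρ j))

theorem zkAnswers_honest (par : C.Par) (v₀ : Fin (2 ^ n)) (pk : E.PK) (r : C.Rnd)
    (ρ : Fin n → E.Rnd) :
    zkAnswers par (honestMsg par v₀ pk r ρ) (honestWit v₀ r ρ) = (true, fun _ => true) := by
  refine Prod.ext ?_ (funext fun j => ?_)
  · simp [zkAnswers, zkComEq, honestMsg, honestWit, sum_smul_enc]
  · simp [zkAnswers, zkBit, honestMsg, honestWit, bit_eq_zero_or_one]

/-- The view of `P₁` in an execution with an honest `P₀`, where `o` is the opening sent by `P₀`. -/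
def honestView (tape : Tape1 n E) (m : Msg1 n E C) (o : Option (Fin (2 ^ n) × C.Rnd)) :
    View1 n E C :=
  (tape, some (m, (true, fun _ => true)), some ((if o.isSome = true then 0 else 1, o), true))

theorem val_cast_of_lt {m q : ℕ} [NeZero q] (h : m ≤ q) (x : Fin m) : ((x.val : ℕ) : ZMod q).val = x.val :=
  ZMod.val_natCast_of_lt (x.2.trans_le h)

/-- The proofs are accepted and the zeros of the reply reveal exactly the order of the inputs, so
outputs and final messages are functions of the inputs and of the randomness of the commitment. The
secret key does not occur in the resulting view. -/
theorem exec_honest (hn : 2 + 4 * (2 ^ n - 1) < q) (par : C.Par) (v₀ v₁ : Fin (2 ^ n)) :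
    exec par (honest0 v₀ : Party0 n E C _ _ _) v₁ =
      (PMF.uniformOfFintype (Tape1 n E)).bind fun tape => E.gen.bind fun key =>
        (PMF.uniformOfFintype C.Rnd).bind fun r =>
          (PMF.uniformOfFintype (Fin n → E.Rnd)).bind fun ρ =>
            PMF.pure (some (min v₀ v₁), honestView tape (honestMsg par v₀ key.1 r ρ)
              (if v₀ ≤ v₁ then some (v₀, r) else none), some (min v₀ v₁)) := by
  rw [exec_eq]
  congr 1
  funext tape
  have hrun : (honest0 v₀ : Party0 n E C _ _ _).run1 par =
      E.gen.bind fun key => (PMF.uniformOfFintype C.Rnd).bind fun r =>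
        (PMF.uniformOfFintype (Fin n → E.Rnd)).bind fun ρ =>
          PMF.pure ((key, r), some (honestMsg par v₀ key.1 r ρ, honestWit v₀ r ρ)) := rfl
  rw [hrun, PMF.bind_bind]
  -- A generated key pair is valid only on the support of `gen`.
  refine bind_congr_of_support fun key hkey => ?_
  have hk := E.isKey_gen key hkey
  rw [PMF.bind_bind]
  congr 1
  funext r
  rw [PMF.bind_bind]
  congr 1
  funext ρ
  rw [PMF.pure_bind]
  have hz := zkAnswers_honest par v₀ key.1 r ρ
  have hreply : p1Reply par v₁ tape (some (honestMsg par v₀ key.1 r ρ, honestWit v₀ r ρ)) =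
      some (p1Vectors v₁ tape (honestMsg par v₀ key.1 r ρ)) := by
    simp [p1Reply, hz]
  dsimp only
  rw [hreply]
  set D := p1Vectors v₁ tape (honestMsg par v₀ key.1 r ρ) with hD
  obtain ⟨d, hd⟩ := exists_cVec_eq_zero_iff (q := q) hn v₀ v₁
  have hzero : ∀ i j, E.isZero key.2 (D i j) = true ↔ tape.1 j = d ∧ cmpFlag v₀ v₁ i := by
    intro i j
    rw [hD, p1Vectors_eq_enc v₁ tape _ v₀ ρ fun _ => rfl]
    refine (E.isZero_enc key.1 key.2 hk _ _).trans ?_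
    rw [mul_eq_zero, or_iff_right (tape.2.1 i j).2, hd]
  have hex : ∀ i, (∃ j, E.isZero key.2 (D i j) = true) ↔ cmpFlag v₀ v₁ i := by
    intro i
    constructor
    · rintro ⟨j, hj⟩
      exact ((hzero i j).1 hj).2
    · intro h
      exact ⟨tape.1.symm d, (hzero _ _).2 ⟨Equiv.apply_symm_apply _ _, h⟩⟩
  let u : Fin 2 := if comparisonFinal (E.isZero key.2) D 0 = true then 0 else 1
  let l : Fin (n + 1) := ((List.finRange (n + 1)).find? (fun j => E.isZero key.2 (D u j))).getD 0
  have hrun2 : (honest0 v₀ : Party0 n E C _ _ _).run2 ((key, r), some D) =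
      PMF.pure (some u, some ((u, if u = 0 then some (v₀, r) else none), (l, key.2))) := rfl
  have hu : u = if v₀ ≤ v₁ then 0 else 1 := by
    have : comparisonFinal (E.isZero key.2) D 0 = true ↔ v₀ ≤ v₁ := by
      rw [comparisonFinal, decide_eq_true_eq, hex, cmpFlag, if_pos rfl]
    simp only [u, this]
  have hflag : cmpFlag v₀ v₁ u := by
    rw [hu]
    by_cases h : v₀ ≤ v₁
    · simp [cmpFlag, h]
    · simpa [cmpFlag, h] using (not_le.1 h).le
  -- The vector chosen by `u` does contain a zero, so the search succeeds and the default `0` in `l`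
  -- is never used.
  have hl : E.isZero key.2 (D u l) = true := by
    obtain ⟨j, hj⟩ := (hex u).2 hflag
    have hs : ((List.finRange (n + 1)).find? (fun j => E.isZero key.2 (D u j))).isSome = true := by
      rw [List.find?_isSome]
      exact ⟨j, List.mem_finRange j, hj⟩
    obtain ⟨j', hj'⟩ := Option.isSome_iff_exists.1 hs
    have : l = j' := by simp only [l, hj', Option.getD_some]
    rw [this]
    exact List.find?_some (p := fun j => E.isZero key.2 (D u j)) hj'
  have hmany : zkOneMany (n := n) key.1 (D u) (l, key.2) = true := by
    simp [zkOneMany, hk, hl]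
  rw [hrun2, PMF.pure_bind]
  dsimp only
  clear_value u l D
  subst hu
  by_cases h : v₀ ≤ v₁
  · have hmin : min v₀ v₁ = v₀ := min_eq_left h
    simp only [h, if_true] at hmany ⊢
    have hout : p1Output par v₁ (some (honestMsg par v₀ key.1 r ρ, honestWit v₀ r ρ)) (some D)
        (some ((0, some (v₀, r)), l, key.2)) = some v₀ := by
      simp [p1Output, honestMsg, hmany]
    rw [hout, hmin]
    have hm : zkOneMany (honestMsg (C := C) par v₀ key.1 r ρ).1 (D 0) (l, key.2) = true := hmany
    exact (PMF.pure_bind _ _).trans (by simp [hz, honestView, hm])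
  · have hmin : min v₀ v₁ = v₁ := min_eq_right (not_le.1 h).le
    simp only [h, if_false] at hmany ⊢
    have hout : p1Output par v₁ (some (honestMsg par v₀ key.1 r ρ, honestWit v₀ r ρ)) (some D)
        (some ((1, none), l, key.2)) = some v₁ := by
      simp [p1Output, honestMsg, hmany]
    simp only [one_ne_zero, if_false]
    rw [hout, hmin]
    have hm : zkOneMany (honestMsg (C := C) par v₀ key.1 r ρ).1 (D 1) (l, key.2) = true := hmany
    exact (PMF.pure_bind _ _).trans (by simp [hz, honestView, hm, p1Send])

end Exec

theorem correct {q n : ℕ → ℕ} [∀ k, Fact (q k).Prime] (hn : ∀ k, 2 + 4 * (2 ^ n k - 1) < q k)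
    (E : ∀ k, HomEnc (q k)) (C : ∀ k, ComScheme (ZMod (q k))) : Correct n E C := by
  intro k v₀ v₁ par _
  rw [exec_honest (hn k)]
  simp only [PMF.map_bind, PMF.pure_map, PMF.bind_const]

/-! ### Costs of the building blocks of the protocol -/

section Blocks

variable {q n : ℕ → ℕ} [∀ k, Fact (q k).Prime] {E : ∀ k, HomEnc (q k)}
  {C : ∀ k, ComScheme (ZMod (q k))}

variable (n E C) in
/-- Polynomial bounds for the lengths of all encodings in the protocol. -/
structure LenBounds : Prop where
  zmod : PolyLen (fun k => k) fun k => ZMod (q k)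
  pk : PolyLen (fun k => k) fun k => (E k).PK
  rnd : PolyLen (fun k => k) fun k => (E k).Rnd
  ct : PolyLen (fun k => k) fun k => (E k).CT
  par : PolyLen (fun k => k) fun k => (C k).Par
  crnd : PolyLen (fun k => k) fun k => (C k).Rnd
  com : PolyLen (fun k => k) fun k => (C k).Com
  fin : PolyLen (fun k => k) fun k => Fin (2 ^ n k)
  bdd : PolyBdd (fun k => k) n
  lt : ∀ k, 2 ^ n k < q k

/-- A circuit has one input wire per bit, so the efficiency of encryption bounds the length of `q`.
As `2 ^ n < q`, it bounds `n` as well. -/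
theorem lenBounds (hn : ∀ k, 2 + 4 * (2 ^ n k - 1) < q k) (hE : HomEnc.Efficient E)
    (hC : ComScheme.Efficient C) : LenBounds n E C := by
  have hlt : ∀ k, 2 ^ n k < q k := fun k => by
    have := hn k
    have := Nat.one_le_two_pow (n := n k)
    omega
  have hfin : PolyLen (fun k => k) fun k => Fin (2 ^ n k) :=
    hE.enc.polyLen_left.snd.fst.mono fun k => Nat.size_le_size (hlt k).le
  exact
    { zmod := hE.enc.polyLen_left.snd.fst
      pk := hE.enc.polyLen_left.fst
      rnd := hE.enc.polyLen_left.snd.snd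
      ct := hE.enc.polyLen_right
      par := hC.com.polyLen_left.fst
      crnd := hC.com.polyLen_left.snd.snd
      com := hC.com.polyLen_right
      fin := hfin
      bdd := hfin.mono fun k => by
        show n k ≤ Nat.size (2 ^ n k)
        rw [Nat.size_pow]
        exact Nat.le_succ _
      lt := hlt }

variable {I : Type} {sz : I → ℕ} {α β γ : I → Type} [∀ i, BitCode (α i)] [∀ i, BitCode (β i)]
  [∀ i, BitCode (γ i)]

theorem GP.unpi {m : I → ℕ} {f : ∀ i, α i → Fin (m i) → β i} (hf : GP sz f) :
    GP (I := Σ i, Fin (m i)) (fun p => sz p.1) (α := fun p => α p.1) (β := fun p => β p.1)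
      fun p x => f p.1 x p.2 :=
  GP.proj (I := Σ i, Fin (m i)) (sz := fun p => sz p.1) (m := fun p => m p.1)
    (β := fun p _ => β p.1) (f := fun p => f p.1) (hf.pull Sigma.fst) fun p => p.2

/-- The condition concerns the index and not the input, so it is settled when the circuit is built
and costs no selection gates. -/
theorem GP.choose {f g : ∀ i, α i → β i} (P : I → Prop) [DecidablePred P] (hf : GP sz f)
    (hg : GP sz g) : GP sz fun i x => if P i then f i x else g i x :=
  let ⟨_, hs, hf⟩ := hf.exists_bdd
  let ⟨_, ht, hg⟩ := hg.exists_bdd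
  GP.of_bdd (hs.add ht) fun i => by
    by_cases h : P i
    · simpa only [h, if_true] using (hf i).mono (Nat.le_add_right _ _)
    · simpa only [h, if_false] using (hg i).mono (Nat.le_add_left _ _)

theorem gp_enc (hE : HomEnc.Efficient E) {pk : ∀ i, α i → (E (sz i)).PK}
    {m : ∀ i, α i → ZMod (q (sz i))} {r : ∀ i, α i → (E (sz i)).Rnd} (hpk : GP sz pk)
    (hm : GP sz m) (hr : GP sz r) :
    GP sz (β := fun i => (E (sz i)).CT) fun i x => (E (sz i)).enc (pk i x) (m i x, r i x) :=
  (hE.enc.gp.pull sz).comp (hpk.prod (hm.prod hr))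

theorem gp_com (hC : ComScheme.Efficient C) {par : ∀ i, α i → (C (sz i)).Par}
    {m : ∀ i, α i → ZMod (q (sz i))} {r : ∀ i, α i → (C (sz i)).Rnd} (hpar : GP sz par)
    (hm : GP sz m) (hr : GP sz r) :
    GP sz (β := fun i => (C (sz i)).Com) fun i x => (C (sz i)).com (par i x) (m i x) (r i x) :=
  (hC.com.gp.pull sz).comp (hpar.prod (hm.prod hr))

theorem gp_cast (hb : LenBounds n E C) {v : ∀ i, α i → Fin (2 ^ n (sz i))} (hv : GP sz v) :
    GP sz (β := fun i => ZMod (q (sz i))) fun i x => ((v i x).val : ZMod (q (sz i))) :=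
  (GP.zmod_of_val_eq (f := fun i (x : Fin (2 ^ n (sz i))) => (x.val : ZMod (q (sz i))))
    fun i x => val_cast_of_lt (hb.lt (sz i)).le x).comp hv

theorem gp_testBit {v : ∀ i, α i → Fin (2 ^ n (sz i))} (hv : GP sz v)
    (j : ∀ i, Fin (n (sz i))) :
    GP sz (β := fun _ => Bool) fun i x => (v i x).val.testBit (n (sz i) - 1 - (j i).val) := by
  have h : GP sz (α := fun i => Fin (2 ^ n (sz i))) (β := fun _ => Bool)
      fun i x => x.val.testBit (n (sz i) - 1 - (j i).val) :=
    GP.of_bits fun i l => ⟨⟨n (sz i) - 1 - (j i).val, by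
      show _ < Nat.size _
      rw [Nat.size_pow]
      omega⟩, fun x => rfl⟩
  exact h.comp hv

theorem gp_bit (hb : LenBounds n E C) {v : ∀ i, α i → Fin (2 ^ n (sz i))} (hv : GP sz v)
    (j : ∀ i, Fin (n (sz i))) :
    GP sz (β := fun i => ZMod (q (sz i))) fun i x => bit (q (sz i)) (v i x) (j i) :=
  GP.ite (hb.zmod.pull sz) (gp_testBit hv j) (GP.const (hb.zmod.pull sz) fun _ => 1)
    (GP.const (hb.zmod.pull sz) fun _ => 0)

theorem gp_honestMsg (hb : LenBounds n E C) (hE : HomEnc.Efficient E) (hC : ComScheme.Efficient C)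
    {par : ∀ i, α i → (C (sz i)).Par} {v : ∀ i, α i → Fin (2 ^ n (sz i))}
    {pk : ∀ i, α i → (E (sz i)).PK} {r : ∀ i, α i → (C (sz i)).Rnd}
    {ρ : ∀ i, α i → Fin (n (sz i)) → (E (sz i)).Rnd} (hpar : GP sz par) (hv : GP sz v)
    (hpk : GP sz pk) (hr : GP sz r) (hρ : GP sz ρ) :
    GP sz (β := fun i => Msg1 (n (sz i)) (E (sz i)) (C (sz i)))
      fun i x => honestMsg (par i x) (v i x) (pk i x) (r i x) (ρ i x) := by
  have hA : GP (I := Σ i, Fin (n (sz i))) (fun p => sz p.1) (α := fun p => α p.1)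
      (β := fun p => (E (sz p.1)).CT)
      fun p x => (E (sz p.1)).enc (pk p.1 x) (bit (q (sz p.1)) (v p.1 x) p.2, ρ p.1 x p.2) :=
    gp_enc (I := Σ i, Fin (n (sz i))) (sz := fun p => sz p.1) hE (hpk.pull Sigma.fst)
      (gp_bit (I := Σ i, Fin (n (sz i))) (sz := fun p => sz p.1) hb (hv.pull Sigma.fst) fun p => p.2)
      hρ.unpi
  exact hpk.prod ((gp_com hC hpar (gp_cast hb hv) hr).prod (GP.pi (hb.bdd.pull sz) hA))

theorem LenBounds.tape (hb : LenBounds n E C) :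
    PolyLen (fun k => k) fun k => Tape1 (n k) (E k) := by
  have h := hb.bdd.add (PolyBdd.const 1)
  exact (PolyLen.perm h).prod ((PolyLen.pi (PolyBdd.const 2) (PolyLen.pi h hb.zmod)).prod
    (PolyLen.pi (PolyBdd.const 2) (PolyLen.pi h hb.rnd)))

theorem gp_honestView (hb : LenBounds n E C) {tape : ∀ i, α i → Tape1 (n (sz i)) (E (sz i))}
    {m : ∀ i, α i → Msg1 (n (sz i)) (E (sz i)) (C (sz i))}
    {o : ∀ i, α i → Option (Fin (2 ^ n (sz i)) × (C (sz i)).Rnd)}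
    (ht : GP sz tape) (hm : GP sz m) (ho : GP sz o) :
    GP sz (β := fun i => View1 (n (sz i)) (E (sz i)) (C (sz i)))
      fun i x => honestView (tape i x) (m i x) (o i x) := by
  have h2 : PolyLen sz fun _ => Fin 2 := PolyLen.fin (PolyBdd.const 2)
  have hu := GP.ite h2 ho.isSome (GP.const h2 fun _ => 0) (GP.const h2 fun _ => 1)
  have ht' : GP sz (α := α) (β := fun _ => Bool) fun _ _ => true := GP.const PolyLen.bool _
  have hts : GP sz (α := α) (β := fun i => Fin (n (sz i)) → Bool) fun _ _ _ => true :=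
    GP.const (PolyLen.pi (hb.bdd.pull sz) PolyLen.bool) fun _ _ => true
  exact ht.prod ((hm.prod (ht'.prod hts)).some.prod ((hu.prod ho).prod ht').some)

theorem drawable_tape (hb : LenBounds n E C) (hE : HomEnc.Efficient E) :
    Drawable fun k => Tape1 (n k) (E k) := by
  have h := hb.bdd.add (PolyBdd.const 1)
  have hr : Drawable fun k => (E k).Rnd := hE.rnd
  exact (drawable_perm h).prod ((((drawable_nonzero hb.zmod).pi h).pi (PolyBdd.const 2)).prod
    ((hr.pi h).pi (PolyBdd.const 2)))

end Blocks

/-! ### Hybrid argument for commitments and vectors of ciphertexts -/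

theorem bind_congr' {α β : Type} (p : PMF α) {f g : α → PMF β} (h : ∀ a, f a = g a) :
    p.bind f = p.bind g := congrArg _ (funext h)

theorem map_uniform_prod {α β γ : Type} [Fintype α] [Nonempty α] [Fintype β] [Nonempty β]
    (f : α × β → γ) :
    (PMF.uniformOfFintype (α × β)).map f =
      (PMF.uniformOfFintype α).bind fun a => (PMF.uniformOfFintype β).map fun b => f (a, b) := by
  rw [uniform_prod, PMF.map_bind]
  exact bind_congr' _ fun a => PMF.map_comp _ _ _

theorem bind_uniform_prod {α β γ : Type} [Fintype α] [Nonempty α] [Fintype β] [Nonempty β]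
    (f : α × β → PMF γ) :
    (PMF.uniformOfFintype (α × β)).bind f =
      (PMF.uniformOfFintype α).bind fun a => (PMF.uniformOfFintype β).bind fun b => f (a, b) := by
  rw [uniform_prod, PMF.bind_bind]
  exact bind_congr' _ fun a => PMF.bind_map _ _ _

theorem map_eq_bind {α β : Type} (p : PMF α) (f : α → β) : p.map f = p.bind fun a => PMF.pure (f a) :=
  rfl

section Hybrid

variable {q n : ℕ} {E : HomEnc q} {C : ComScheme (ZMod q)} {W O : Type}

/-- A function of commitment parameters, public key, a commitment to `m` and encryptions of the
entries of `β`. -/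
def hybrid (ν : PMF W) (F : W → C.Par → E.PK → C.Com → (Fin n → E.CT) → O) (m : ZMod q)
    (β : Fin n → ZMod q) : PMF O :=
  ν.bind fun w => C.gen.bind fun par => E.gen.bind fun key =>
    (PMF.uniformOfFintype C.Rnd).bind fun r => (PMF.uniformOfFintype (Fin n → E.Rnd)).bind fun ρ =>
      PMF.pure (F w par key.1 (C.com par m r) fun j => E.enc key.1 (β j, ρ j))

/-- The draws are independent and can be reordered: parameters and commitment come last, with all
else fixed, which is the form that hiding speaks about. -/
theorem hybrid_eq_com (ν : PMF W) (F : W → C.Par → E.PK → C.Com → (Fin n → E.CT) → O) (m : ZMod q)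
    (β : Fin n → ZMod q) :
    hybrid ν F m β = ν.bind fun w => E.gen.bind fun key =>
      (PMF.uniformOfFintype (Fin n → E.Rnd)).bind fun ρ =>
        (C.sample m).map fun x => F w x.1 key.1 x.2 fun j => E.enc key.1 (β j, ρ j) := by
  have hs : ∀ f : C.Par × C.Com → O, (C.sample m).map f = C.gen.bind fun par =>
      (PMF.uniformOfFintype C.Rnd).bind fun r => PMF.pure (f (par, C.com par m r)) := by
    intro f
    show (C.gen.bind fun par => (PMF.uniformOfFintype C.Rnd).bind fun r =>
      PMF.pure (par, C.com par m r)).map f = _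
    simp only [PMF.map_bind, PMF.pure_map]
  simp only [hs]
  refine bind_congr' _ fun w => ?_
  rw [PMF.bind_comm]
  refine bind_congr' _ fun key => ?_
  rw [PMF.bind_comm (PMF.uniformOfFintype (Fin n → E.Rnd))]
  refine bind_congr' _ fun par => ?_
  rw [PMF.bind_comm]

theorem uniform_funSplitAt {α : Type} [Fintype α] [Nonempty α] (j : Fin n) :
    PMF.uniformOfFintype (Fin n → α) =
      (PMF.uniformOfFintype ({l : Fin n // l ≠ j} → α)).bind fun o =>
        (PMF.uniformOfFintype α).map fun a l => if h : l = j then a else o ⟨l, h⟩ := by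
  rw [← uniform_map_equiv (Equiv.funSplitAt j α).symm, map_uniform_prod]
  simp only [map_eq_bind]
  rw [PMF.bind_comm]
  refine bind_congr' _ fun o => bind_congr' _ fun a => congrArg _ (funext fun l => ?_)
  rw [Equiv.funSplitAt_symm_apply]

/-- Now key and randomness of the ciphertext `j` are drawn last. The other ciphertexts use the same
key, so they are recomputed from the public key and fixed randomness. -/
theorem hybrid_eq_enc (ν : PMF W) (F : W → C.Par → E.PK → C.Com → (Fin n → E.CT) → O) (m : ZMod q)
    (β : Fin n → ZMod q) (j : Fin n) :
    hybrid ν F m β = ν.bind fun w => C.gen.bind fun par =>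
      (PMF.uniformOfFintype C.Rnd).bind fun r =>
        (PMF.uniformOfFintype ({l : Fin n // l ≠ j} → E.Rnd)).bind fun o =>
          (E.sample (β j)).map fun x => F w par x.1 (C.com par m r)
            fun l => if h : l = j then x.2 else E.enc x.1 (β l, o ⟨l, h⟩) := by
  have hs : ∀ f : E.PK × E.CT → O, (E.sample (β j)).map f = E.gen.bind fun key =>
      (PMF.uniformOfFintype E.Rnd).bind fun r => PMF.pure (f (key.1, E.enc key.1 (β j, r))) := by
    intro f
    show (E.gen.bind fun key => (PMF.uniformOfFintype E.Rnd).bind fun r =>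
      PMF.pure (key.1, E.enc key.1 (β j, r))).map f = _
    simp only [PMF.map_bind, PMF.pure_map]
  simp only [hs]
  refine bind_congr' _ fun w => bind_congr' _ fun par => ?_
  rw [PMF.bind_comm]
  refine bind_congr' _ fun r => ?_
  rw [PMF.bind_comm (PMF.uniformOfFintype ({l : Fin n // l ≠ j} → E.Rnd))]
  refine bind_congr' _ fun key => ?_
  rw [uniform_funSplitAt j, PMF.bind_bind]
  refine bind_congr' _ fun o => ?_
  rw [PMF.bind_map]
  refine bind_congr' _ fun a => congrArg PMF.pure (congrArg _ (funext fun l => ?_))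
  by_cases h : l = j
  · subst h; simp
  · simp [h]

theorem abs_prob_hybrid_com_le (ν : PMF W) (F : W → C.Par → E.PK → C.Com → (Fin n → E.CT) → O)
    (m m' : ZMod q) (β : Fin n → ZMod q) (D : O → Bool) {ε : ℝ}
    (h : ∀ w pk A, |prob (C.sample m) (fun x => D (F w x.1 pk x.2 A)) -
      prob (C.sample m') (fun x => D (F w x.1 pk x.2 A))| ≤ ε) :
    |prob (hybrid ν F m β) D - prob (hybrid ν F m' β) D| ≤ ε := by
  rw [hybrid_eq_com, hybrid_eq_com]
  refine abs_prob_bind_sub_le _ _ _ _ fun w => abs_prob_bind_sub_le _ _ _ _ fun key =>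
    abs_prob_bind_sub_le _ _ _ _ fun ρ => ?_
  rw [prob_map, prob_map]
  exact h _ _ _

/-- One ciphertext is exchanged at a time, each exchange being an instance of semantic security with
everything else hardwired. -/
theorem abs_prob_hybrid_enc_le (ν : PMF W) (F : W → C.Par → E.PK → C.Com → (Fin n → E.CT) → O)
    (m : ZMod q) (β β' : Fin n → ZMod q) (D : O → Bool) {ε : ℝ}
    (h : ∀ w par V (γ : Fin n → ZMod q) (o : Fin n → E.Rnd) (j : Fin n) (m₀ m₁ : ZMod q),
      |prob (E.sample m₀) (fun x => D (F w par x.1 V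
          fun l => if l = j then x.2 else E.enc x.1 (γ l, o l))) -
        prob (E.sample m₁) (fun x => D (F w par x.1 V
          fun l => if l = j then x.2 else E.enc x.1 (γ l, o l)))| ≤ ε) :
    |prob (hybrid ν F m β) D - prob (hybrid ν F m β') D| ≤ n * ε := by
  have step : ∀ (j : Fin n) (β β' : Fin n → ZMod q), (∀ l, l ≠ j → β l = β' l) →
      |prob (hybrid ν F m β) D - prob (hybrid ν F m β') D| ≤ ε := by
    intro j β β' hβ
    rw [hybrid_eq_enc ν F m β j, hybrid_eq_enc ν F m β' j]
    refine abs_prob_bind_sub_le _ _ _ _ fun w => abs_prob_bind_sub_le _ _ _ _ fun par =>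
      abs_prob_bind_sub_le _ _ _ _ fun r => abs_prob_bind_sub_le _ _ _ _ fun o => ?_
    rw [prob_map, prob_map]
    -- The challenge occupies position `j`, so plaintext and randomness stored there are irrelevant;
    -- they are filled in with `β j` and `0` to put both sides in the same form.
    have e : ∀ γ : Fin n → ZMod q, (∀ l, l ≠ j → β l = γ l) → ∀ x : E.PK × E.CT,
        (fun l => if h : l = j then x.2 else E.enc x.1 (γ l, o ⟨l, h⟩)) =
          fun l => if l = j then x.2 else E.enc x.1 (β l, if h : l = j then 0 else o ⟨l, h⟩) := by
      intro γ hγ x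
      funext l
      by_cases hl : l = j
      · simp [hl]
      · simp [hl, hγ l hl]
    simp only [e β fun _ _ => rfl, e β' hβ]
    exact h _ _ _ _ _ _ _ _
  -- The interpolating hybrids: the first `j` plaintexts are already the new ones.
  let γ : ℕ → Fin n → ZMod q := fun j l => if l.val < j then β' l else β l
  have key : ∀ j ≤ n, |prob (hybrid ν F m β) D - prob (hybrid ν F m (γ j)) D| ≤ j * ε := by
    intro j hj
    induction j with
    | zero =>
      have : γ 0 = β := funext fun l => by simp [γ]
      simp [this]
    | succ j ih =>
      have h1 := ih (by omega)
      have h2 := step ⟨j, hj⟩ (γ j) (γ (j + 1)) fun l hl => by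
        have : l.val ≠ j := fun e => hl (Fin.ext e)
        have : l.val < j ↔ l.val < j + 1 := by omega
        simp only [γ, this]
      push_cast
      refine (abs_sub_le _ (prob (hybrid ν F m (γ j)) D) _).trans ?_
      linarith
  have hn : γ n = β' := funext fun l => by simp [γ]
  rw [← hn]
  exact key n le_rfl

end Hybrid

/-! ### Security against a semi-honest `P₁` -/

section SemiHonest

variable {q n : ℕ → ℕ} [∀ k, Fact (q k).Prime] {E : ∀ k, HomEnc (q k)}
  {C : ∀ k, ComScheme (ZMod (q k))}

/-- The input which the simulator for `P₁` uses for `P₀`. -/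
def simInput {m : ℕ} (v₁ : Fin (2 ^ m)) (x : Fin (2 ^ m) × Bool) : Fin (2 ^ m) :=
  if (decide (x.1 = v₁) && !x.2) = true then 0 else x.1

/-- The tested condition, that the minimum is `v₁` and the inputs differ, means `v₁ < v₀`. The
leaked equality is indispensable: for `v₀ = v₁` the honest `P₀` opens its commitment, for `v₁ < v₀`
it does not, although the minimum is the same. -/
theorem simInput_minLeak_of_le {m : ℕ} {v₀ v₁ : Fin (2 ^ m)} (h : v₀ ≤ v₁) :
    (decide ((minLeak v₀ v₁).1 = v₁) && !(minLeak v₀ v₁).2) = false := by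
  simp [minLeak, h]

theorem simInput_minLeak_of_lt {m : ℕ} {v₀ v₁ : Fin (2 ^ m)} (h : v₁ < v₀) :
    (decide ((minLeak v₀ v₁).1 = v₁) && !(minLeak v₀ v₁).2) = true := by
  simp [minLeak, h.le, h.ne']

/-- The view which the simulator for `P₁` produces. -/
def simView {q m : ℕ} [Fact q.Prime] {E : HomEnc q} {C : ComScheme (ZMod q)} (par : C.Par)
    (v₁ : Fin (2 ^ m)) (x : Fin (2 ^ m) × Bool) (tape : Tape1 m E) (pk : E.PK) (r : C.Rnd)
    (ρ : Fin m → E.Rnd) : View1 m E C :=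
  honestView tape (honestMsg par (simInput v₁ x) pk r ρ)
    (if (decide (x.1 = v₁) && !x.2) = true then none else some (simInput v₁ x, r))

/-- The simulator generates a key pair, plays an honest `P₀` with input `v₀` if it knows it and with
`0` otherwise, and runs the adversary on the resulting view. -/
theorem secureSemiHonest1 (hn : ∀ k, 2 + 4 * (2 ^ n k - 1) < q k) (hE : HomEnc.Efficient E)
    (hC : ComScheme.Efficient C) (hEnc : HomEnc.Secure E) (hHiding : ComScheme.Hiding C) :
    SecureSemiHonest1 n E C := by
  have hb := lenBounds hn hE hC
  intro aux out A
  obtain ⟨t, s, g, hg, eg⟩ := A.poly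
  obtain ⟨t', s', key, hkey, ekey⟩ := hE.gen
  let Ω : ℕ → Type := fun k => ∀ i : Fin (t k), Fin (s k i + 1)
  let Γ : ℕ → Type := fun k => ∀ i : Fin (t' k), Fin (s' k i + 1)
  let X : ℕ → Type := fun k =>
    Bits (aux k) × (C k).Par × Fin (2 ^ n k) × (Fin (2 ^ n k) × Bool)
  let R : ℕ → Type := fun k =>
    Tape1 (n k) (E k) × (Γ k × ((C k).Rnd × ((Fin (n k) → (E k).Rnd) × Ω k)))
  have hΩ : Drawable Ω := Drawable.draws hg.polyLen_left.snd
  have hΓ : Drawable Γ := Drawable.draws hkey.polyLen_left.snd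
  have hrnd : Drawable fun k => (E k).Rnd := hE.rnd
  have hcrnd : Drawable fun k => (C k).Rnd := hC.rnd
  have hR : Drawable R :=
    (drawable_tape hb hE).prod (hΓ.prod (hcrnd.prod ((hrnd.pi hb.bdd).prod hΩ)))
  let G : ∀ k, X k × R k → Bits (out k) := fun k x =>
    g k ((x.1.1, x.1.2.1, x.1.2.2.1, simView x.1.2.1 x.1.2.2.1 x.1.2.2.2 x.2.1
      (key k ((), x.2.2.1)).1 x.2.2.2.1 x.2.2.2.2.1), x.2.2.2.2.2)
  have hXlen : PolyLen (fun k => k) X :=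
    hg.polyLen_left.fst.fst.prod (hb.par.prod (hb.fin.prod (hb.fin.prod PolyLen.bool)))
  have hG : PolySize G := by
    refine GP.polySize ?_ (hXlen.prod hR.polyLen) hg.polyLen_right
    have x : GP (fun k => k) (fun k (x : X k × R k) => x) := GP.id
    have x1 := x.fst'
    have z := x1.fst'
    have par := x1.snd'.fst'
    have v₁ := x1.snd'.snd'.fst'
    have lk := x1.snd'.snd'.snd'
    have x2 := x.snd'
    have tape := x2.fst'
    have ωk := x2.snd'.fst'
    have r := x2.snd'.snd'.fst'
    have ρ := x2.snd'.snd'.snd'.fst'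
    have ω := x2.snd'.snd'.snd'.snd'
    have pk := (hkey.gp.comp ((GP.const PolyLen.unit fun _ => ()).prod ωk)).fst'
    have c := (GP.decEq hb.fin lk.fst' v₁).and lk.snd'.not
    have v := GP.ite hb.fin c (GP.const hb.fin fun _ => 0) lk.fst'
    have op := GP.ite (hb.fin.prod hb.crnd).option c GP.none (v.prod r).some
    have view := gp_honestView hb tape (gp_honestMsg hb hE hC par v pk r ρ) op
    exact hg.gp.comp ((z.prod (par.prod (v₁.prod view))).prod ω)
  refine ⟨⟨fun k x => (PMF.uniformOfFintype (R k)).map fun ω => G k (x, ω), hR.polySampler hG⟩, ?_⟩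
  intro z v₀ v₁ D hD
  have hS : ∀ k (x : X k), (PMF.uniformOfFintype (R k)).map (fun ω => G k (x, ω)) =
      (PMF.uniformOfFintype (Tape1 (n k) (E k))).bind fun tape => (E k).gen.bind fun key =>
        (PMF.uniformOfFintype (C k).Rnd).bind fun r =>
          (PMF.uniformOfFintype (Fin (n k) → (E k).Rnd)).bind fun ρ =>
            A.run k (x.1, x.2.1, x.2.2.1, simView x.2.1 x.2.2.1 x.2.2.2 tape key.1 r ρ) := by
    intro k x
    rw [map_uniform_prod]
    refine bind_congr' _ fun tape => ?_
    have ek : (PMF.uniformOfFintype (Γ k)).map (fun ω => key k ((), ω)) = (E k).gen := ekey k ()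
    rw [map_uniform_prod, ← ek, PMF.bind_map]
    refine bind_congr' _ fun ωk => ?_
    rw [map_uniform_prod]
    refine bind_congr' _ fun r => ?_
    rw [map_uniform_prod]
    exact bind_congr' _ fun ρ => eg k (x.1, x.2.1, x.2.2.1,
      simView x.2.1 x.2.2.1 x.2.2.2 tape (key k ((), ωk)).1 r ρ)
  let W : ℕ → Type := fun k => Tape1 (n k) (E k) × Ω k
  let F : ∀ k, W k → (C k).Par → (E k).PK → (C k).Com → (Fin (n k) → (E k).CT) →
      Bits (out k) × Option (Fin (2 ^ n k)) := fun k w par pk V cs =>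
    (g k ((z k, par, v₁ k, honestView w.1 (pk, V, cs) none), w.2), some (min (v₀ k) (v₁ k)))
  let ν : ∀ k, PMF (W k) := fun k => PMF.uniformOfFintype (W k)
  -- Without an opening the experiment is a hybrid in the input `v`; the real execution takes `v =
  -- v₀` and the simulation `v = 0`.
  have hideal : ∀ k, v₁ k < v₀ k → ∀ v : Fin (2 ^ n k),
      ((C k).gen.bind fun par => (PMF.uniformOfFintype (Tape1 (n k) (E k))).bind fun tape =>
        (E k).gen.bind fun key => (PMF.uniformOfFintype (C k).Rnd).bind fun r =>
          (PMF.uniformOfFintype (Fin (n k) → (E k).Rnd)).bind fun ρ =>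
            (A.run k (z k, par, v₁ k, honestView tape (honestMsg par v key.1 r ρ) none)).bind
              fun o => PMF.pure (o, some (min (v₀ k) (v₁ k)))) =
        hybrid (ν k) (F k) (v.val : ZMod (q k)) (bit (q k) v) := by
    intro k _ v
    simp only [← eg, PMF.bind_map]
    rw [PMF.bind_comm]
    refine Eq.trans ?_ (bind_uniform_prod (α := Tape1 (n k) (E k)) (β := Ω k) _).symm
    refine bind_congr' _ fun tape => ?_
    rw [PMF.bind_comm (PMF.uniformOfFintype (Ω k))]
    refine bind_congr' _ fun par => ?_
    rw [PMF.bind_comm (PMF.uniformOfFintype (Ω k))]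
    refine bind_congr' _ fun key => ?_
    rw [PMF.bind_comm (PMF.uniformOfFintype (Ω k))]
    refine bind_congr' _ fun r => ?_
    rw [PMF.bind_comm (PMF.uniformOfFintype (Ω k))]
    rfl
  have hreal : ∀ k, real1 A k (z k) (v₀ k) (v₁ k) = (C k).gen.bind fun par =>
      (PMF.uniformOfFintype (Tape1 (n k) (E k))).bind fun tape =>
        (E k).gen.bind fun key => (PMF.uniformOfFintype (C k).Rnd).bind fun r =>
          (PMF.uniformOfFintype (Fin (n k) → (E k).Rnd)).bind fun ρ =>
            (A.run k (z k, par, v₁ k, honestView tape (honestMsg par (v₀ k) key.1 r ρ)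
              (if v₀ k ≤ v₁ k then some (v₀ k, r) else none))).bind
              fun o => PMF.pure (o, some (min (v₀ k) (v₁ k))) := by
    intro k
    show ((C k).gen.bind fun par => (exec par (honest0 (v₀ k) : Party0 (n k) (E k) (C k) _ _ _)
      (v₁ k)).bind fun r => (A.run k (z k, par, v₁ k, r.2.1)).bind fun o => PMF.pure (o, r.1)) = _
    simp only [exec_honest (hn k), PMF.bind_bind, PMF.pure_bind]
  have hsim : ∀ k, ideal1 (⟨fun k x => (PMF.uniformOfFintype (R k)).map fun ω => G k (x, ω),
      hR.polySampler hG⟩ : Simulator1 n C aux out) k (z k) (v₀ k) (v₁ k) =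
      (C k).gen.bind fun par => (PMF.uniformOfFintype (Tape1 (n k) (E k))).bind fun tape =>
        (E k).gen.bind fun key => (PMF.uniformOfFintype (C k).Rnd).bind fun r =>
          (PMF.uniformOfFintype (Fin (n k) → (E k).Rnd)).bind fun ρ =>
            (A.run k (z k, par, v₁ k, simView par (v₁ k) (minLeak (v₀ k) (v₁ k)) tape key.1 r ρ)).bind
              fun o => PMF.pure (o, some (min (v₀ k) (v₁ k))) := by
    intro k
    show ((C k).gen.bind fun par => ((PMF.uniformOfFintype (R k)).map fun ω =>
      G k ((z k, par, v₁ k, minLeak (v₀ k) (v₁ k)), ω)).bind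
        fun o => PMF.pure (o, some (min (v₀ k) (v₁ k)))) = _
    simp only [hS, PMF.bind_bind]
  have hDg := hD.gp
  have hres := hb.fin.option
  -- The reduction to hiding: tape and draws of the adversary, key and ciphertexts belong to the
  -- index, so `pc` bounds the circuits for all their values at once.
  obtain ⟨pc, hpc⟩ : GP (I := Σ k, W k × (E k).PK × (Fin (n k) → (E k).CT)) (fun i => i.1)
      (α := fun i => (C i.1).Par × (C i.1).Com) (β := fun _ => Bool)
      fun i x => D i.1 (F i.1 i.2.1 x.1 i.2.2.1 x.2 i.2.2.2) := by
    let sz : (Σ k, W k × (E k).PK × (Fin (n k) → (E k).CT)) → ℕ := fun i => i.1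
    have x : GP sz (fun i (x : (C i.1).Par × (C i.1).Com) => x) := GP.id
    have m := GP.prod (GP.const (hb.pk.pull sz) fun i => i.2.2.1)
      (x.snd'.prod (GP.const ((PolyLen.pi hb.bdd hb.ct).pull sz) fun i => i.2.2.2))
    have view := gp_honestView (sz := sz) hb (GP.const (hb.tape.pull sz) fun i => i.2.1.1) m GP.none
    have o := (hg.gp.pull sz).comp (((GP.const (hg.polyLen_left.fst.fst.pull sz) fun i => z i.1).prod
      (x.fst'.prod ((GP.const (hb.fin.pull sz) fun i => v₁ i.1).prod view))).prod
        (GP.const (hΩ.polyLen.pull sz) fun i => i.2.1.2))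
    exact (hDg.pull sz).comp (o.prod (GP.const (hres.pull sz) fun i => some (min (v₀ i.1) (v₁ i.1))))
  -- The reduction to semantic security. The index also contains the challenge position; the other
  -- ciphertexts are computed from the public key of the challenge.
  obtain ⟨pe, hpe⟩ : GP (I := Σ k, W k × (C k).Par × (C k).Com × (Fin (n k) → ZMod (q k)) ×
      (Fin (n k) → (E k).Rnd) × Fin (n k)) (fun i => i.1)
      (α := fun i => (E i.1).PK × (E i.1).CT) (β := fun _ => Bool)
      fun i x => D i.1 (F i.1 i.2.1 i.2.2.1 x.1 i.2.2.2.1 fun l => if l = i.2.2.2.2.2.2 then x.2 else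
        (E i.1).enc x.1 (i.2.2.2.2.1 l, i.2.2.2.2.2.1 l)) := by
    let sz : (Σ k, W k × (C k).Par × (C k).Com × (Fin (n k) → ZMod (q k)) ×
      (Fin (n k) → (E k).Rnd) × Fin (n k)) → ℕ := fun i => i.1
    let sz' : (Σ i : (Σ k, W k × (C k).Par × (C k).Com × (Fin (n k) → ZMod (q k)) ×
      (Fin (n k) → (E k).Rnd) × Fin (n k)), Fin (n (sz i))) → ℕ := fun p => sz p.1
    have x : GP sz (fun i (x : (E i.1).PK × (E i.1).CT) => x) := GP.id
    have x' : GP sz' (fun p (x : (E p.1.1).PK × (E p.1.1).CT) => x) := GP.id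
    have cs := GP.pi (hb.bdd.pull sz) (f := fun i (x : (E i.1).PK × (E i.1).CT) l =>
      if l = i.2.2.2.2.2.2 then x.2 else (E i.1).enc x.1 (i.2.2.2.2.1 l, i.2.2.2.2.2.1 l))
      (GP.choose (fun p => p.2 = p.1.2.2.2.2.2.2) x'.snd' (gp_enc (sz := sz') hE x'.fst'
        (GP.const (hb.zmod.pull sz') fun p => p.1.2.2.2.2.1 p.2)
        (GP.const (hb.rnd.pull sz') fun p => p.1.2.2.2.2.2.1 p.2)))
    have m := x.fst'.prod ((GP.const (hb.com.pull sz) fun i => i.2.2.2.1).prod cs)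
    have view := gp_honestView (sz := sz) hb (GP.const (hb.tape.pull sz) fun i => i.2.1.1) m GP.none
    have o := (hg.gp.pull sz).comp (((GP.const (hg.polyLen_left.fst.fst.pull sz) fun i => z i.1).prod
      ((GP.const (hb.par.pull sz) fun i => i.2.2.1).prod
        ((GP.const (hb.fin.pull sz) fun i => v₁ i.1).prod view))).prod
        (GP.const (hΩ.polyLen.pull sz) fun i => i.2.1.2))
    exact (hDg.pull sz).comp (o.prod (GP.const (hres.pull sz) fun i => some (min (v₀ i.1) (v₁ i.1))))
  obtain ⟨εc, hc1, hc2, hc3⟩ := Indist.exists_bound (hb.par.prod hb.com)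
    (X := fun k m => (C k).sample m) hHiding pc
  obtain ⟨εe, he1, he2, he3⟩ := Indist.exists_bound (hb.pk.prod hb.ct)
    (X := fun k m => (E k).sample m) hEnc pe
  refine (hc1.add (he1.polyBdd_mul hb.bdd he2)).of_abs_le fun k => ?_
  rw [abs_abs]
  dsimp only
  rcases le_or_gt (v₀ k) (v₁ k) with h | h
  -- Here the simulator knows `v₀` and can also open the commitment, so both distributions coincide.
  · have e : real1 A k (z k) (v₀ k) (v₁ k) = ideal1 (⟨fun k x => (PMF.uniformOfFintype (R k)).map
        fun ω => G k (x, ω), hR.polySampler hG⟩ : Simulator1 n C aux out) k (z k) (v₀ k) (v₁ k) := by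
      rw [hreal, hsim]
      simp only [simView, simInput, simInput_minLeak_of_le h, h, if_true, Bool.false_eq_true, if_false]
      simp only [minLeak, min_eq_left h]
    rw [e, sub_self, abs_zero]
    exact add_nonneg (hc2 k) (mul_nonneg (Nat.cast_nonneg _) (he2 k))
  · have e1 := hreal k
    have e2 := hsim k
    simp only [simView, simInput, simInput_minLeak_of_lt h, if_true] at e2
    simp only [not_le.2 h, if_false] at e1
    rw [hideal k h] at e1 e2
    rw [e1, e2]
    -- The intermediate experiment commits to `0` but still encrypts the bits of `v₀`.
    refine (abs_sub_le _ (prob (hybrid (ν k) (F k) (((0 : Fin (2 ^ n k)).val : ℕ) : ZMod (q k))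
      (bit (q k) (v₀ k))) (D k)) _).trans (add_le_add ?_ ?_)
    · exact abs_prob_hybrid_com_le _ _ _ _ _ _ fun w pk cs => hc3 k _ _ _ (hpc ⟨k, w, pk, cs⟩)
    · exact abs_prob_hybrid_enc_le _ _ _ _ _ _ fun w par V γ o j m₀ m₁ =>
        he3 k _ _ _ (hpe ⟨k, w, par, V, γ, o, j⟩)

end SemiHonest

/-! ### The simulator for a malicious `P₀` -/

section SimDefs

variable {q n : ℕ} [Fact q.Prime] {E : HomEnc q} {C : ComScheme (ZMod q)}

/-- Whether all proofs for the first message are accepted. -/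
def accepts1 (par : C.Par) (x : Msg1 n E C × Wit1 n E C) : Bool :=
  (zkAnswers par x.1 x.2).1 && decide (∀ j, (zkAnswers par x.1 x.2).2 j = true)

/-- The number whose bits are contained in the openings of the ciphertexts. -/
def extract (w : Wit1 n E C) : Fin (2 ^ n) := ofBitsBE fun j => decide ((w.2 j).1 = 1)

/-- What the simulator keeps of an accepted first message: public key, commitment and extracted
input. -/
abbrev Claim (n : ℕ) (E : HomEnc q) (C : ComScheme (ZMod q)) : Type := (E.PK × C.Com) × Fin (2 ^ n)

/-- The value `none` records an abort of `P₁` at the first message; the simulator then gives no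
input to the functionality. -/
def simClaim (par : C.Par) (m₁ : Option (Msg1 n E C × Wit1 n E C)) : Option (Claim n E C) :=
  m₁.bind fun x => if accepts1 par x = true then some ((x.1.1, x.1.2.1), extract x.2) else none

/-- Whether the vector with index `i` contains an encryption of `0`, computed from the input of `P₀`
and the output of the functionality. -/
def simFlag {m : ℕ} (x : Fin m) (l : Fin m × Bool) (i : Fin 2) : Bool :=
  if decide (i = 0) = true then l.2 || decide (l.1 = x) else l.2 || !decide (l.1 = x)

/-- Encryptions of random nonzero plaintexts, and of `0` in a random position of the vectors that are
flagged. -/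
def simVectors (pk : E.PK) (f : Fin 2 → Bool) (tape : Tape1 n E) : Msg2 n E := fun i j =>
  E.enc pk (if (decide (tape.1 j = Fin.last n) && f i) = true then 0 else (tape.2.1 i j).1,
    tape.2.2 i j)

def simReply (c : Option (Claim n E C)) (l : Option (Fin (2 ^ n) × Bool)) (tape : Tape1 n E) :
    Option (Msg2 n E) :=
  c.bind fun c => l.bind fun l => some (simVectors c.1.1 (simFlag c.2 l) tape)

/-- Whether `P₁` accepts the second message. -/
def simAccept (par : C.Par) (c : Option (Claim n E C)) (D : Option (Msg2 n E))
    (m₃ : Option (Msg3 n C × Wit3 n E)) : Bool :=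
  open Classical in
  c.elim false fun c => D.elim false fun d => m₃.elim false fun y =>
    zkOneMany c.1.1 (d y.1.1) y.2 && if decide (y.1.1 = 0) = true then
      y.1.2.elim false fun o => decide (c.1.2 = C.com par (o.1.val : ZMod q) o.2) else true

/-- The message from `P₁` to `P₀` at the end. -/
def simSend (l : Option (Fin (2 ^ n) × Bool)) (m₃ : Option (Msg3 n C × Wit3 n E)) (acc : Bool) :
    Option (Fin (2 ^ n)) :=
  m₃.bind fun y => if (decide (y.1.1 = 1) && acc) = true then l.bind fun l => some l.1 else none

/-- Two openings of the commitment of `P₀`: the one used in the proofs and the one sent to `P₁`. -/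
def twoOpenings (m₁ : Option (Msg1 n E C × Wit1 n E C)) (m₃ : Option (Msg3 n C × Wit3 n E)) :
    (ZMod q × C.Rnd) × (ZMod q × C.Rnd) :=
  (m₁.elim (0, Classical.arbitrary _) fun x => x.2.1.1,
    (m₃.bind fun y => y.1.2).elim (0, Classical.arbitrary _) fun o => ((o.1.val : ZMod q), o.2))

end SimDefs

/-! ### Costs of the simulator -/

section GeneralCosts

variable {I : Type} {sz : I → ℕ} {α β γ : I → Type} [∀ i, BitCode (α i)] [∀ i, BitCode (β i)]
  [∀ i, BitCode (γ i)]

theorem GP.congr {f g : ∀ i, α i → β i} (hf : GP sz f) (h : ∀ i x, f i x = g i x) : GP sz g := by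
  rwa [← show f = g from funext fun i => funext (h i)]

/-- A position computed at run time is not a wire number, so all positions are scanned and the
matching entry is kept. Entry `0` serves as the initial value and is always overwritten. -/
theorem GP.select {m : I → ℕ} (hm : PolyBdd sz m) (hβ : PolyLen sz β)
    {f : ∀ i, α i → Fin (m i + 1) → β i} {d : ∀ i, α i → Fin (m i + 1)} (hf : GP sz f)
    (hd : GP sz d) : GP sz fun i x => f i x (d i x) := by
  have hm1 := hm.add (PolyBdd.const (sz := sz) 1)
  have h0 := hf.proj fun _ => 0
  let sz' : (Σ i, Fin (m i + 1)) → ℕ := fun p => sz p.1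
  have hx : GP sz' (fun p (x : α p.1 × β p.1) => x) := GP.id
  have hl : PolyLen sz' fun p => Fin (m p.1 + 1) := PolyLen.fin (hm1.pull Sigma.fst)
  have hd' : GP sz' fun p (x : α p.1 × β p.1) => d p.1 x.1 :=
    (hd.pull (Sigma.fst : (Σ i, Fin (m i + 1)) → I)).comp hx.fst'
  have hf' : GP sz' fun p (x : α p.1 × β p.1) => f p.1 x.1 p.2 := hf.unpi.comp hx.fst'
  have hF := GP.ite (hβ.pull (Sigma.fst : (Σ i, Fin (m i + 1)) → I))
    (GP.decEq hl hd' (GP.const hl fun p => p.2)) hf' hx.snd'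
  have := GP.iterate hm1 (st := fun i j x => if (d i x).val < j then f i x (d i x) else f i x 0)
    (F := fun i j x => if decide (d i x.1 = j) = true then f i x.1 j else x.2)
    (h0.congr fun i x => by simp) hF fun i j x => by
      rcases lt_trichotomy (d i x).val j.val with h | h | h
      · rw [if_pos (by omega), if_neg (by simpa [Fin.ext_iff] using h.ne), if_pos h]
      · rw [if_pos (by omega), if_pos (by simpa [Fin.ext_iff] using h), Fin.ext h]
      · rw [if_neg (by omega), if_neg (by simpa [Fin.ext_iff] using h.ne'), if_neg (by omega)]
  exact this.congr fun i x => if_pos (d i x).2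

theorem GP.encode {f : ∀ i, α i → β i} (hf : GP sz f) :
    GP sz (β := fun i => Bits (len (β i))) fun i x => code (f i x) := by
  have h : GP sz (α := β) (β := fun i => Bits (len (β i))) fun i x => code x := by
    refine GP.of_bits fun i l => ?_
    obtain ⟨⟨j, l⟩, rfl⟩ := (finSigmaFinEquiv (n := fun _ => len Bool)).surjective l
    exact ⟨j, fun x => code_pi (β := fun _ => Bool) (code x) j l⟩
  exact h.comp hf

end GeneralCosts

/-! ### Extraction from the first message and the simulated ciphertexts -/

section SimCosts

variable {q n : ℕ → ℕ} [∀ k, Fact (q k).Prime] {E : ∀ k, HomEnc (q k)}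
  {C : ∀ k, ComScheme (ZMod (q k))} {I : Type} {sz : I → ℕ} {α : I → Type} [∀ i, BitCode (α i)]

theorem gp_add (hE : HomEnc.Efficient E) {a b : ∀ i, α i → (E (sz i)).CT} (ha : GP sz a)
    (hb : GP sz b) : GP sz (β := fun i => (E (sz i)).CT) fun i x => a i x + b i x :=
  (hE.add.gp.pull sz).comp (ha.prod hb)

/-- Horner's rule needs only doublings and additions of ciphertexts; scalar multiplication is not
among the operations assumed to be efficient. -/
theorem gp_horner (hb : LenBounds n E C) (hE : HomEnc.Efficient E)
    {a : ∀ i, α i → Fin (n (sz i)) → (E (sz i)).CT} (ha : GP sz a) :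
    GP sz (β := fun i => (E (sz i)).CT)
      fun i x => ∑ j, ((2 : ZMod (q (sz i))) ^ (n (sz i) - 1 - j.val)) • a i x j := by
  let sz' : (Σ i, Fin (n (sz i))) → ℕ := fun p => sz p.1
  have hx : GP sz' (fun p (x : α p.1 × (E (sz p.1)).CT) => x) := GP.id
  have ha' : GP sz' fun p (x : α p.1 × (E (sz p.1)).CT) => a p.1 x.1 p.2 := ha.unpi.comp hx.fst'
  have hF := gp_add (sz := sz') hE (gp_add (sz := sz') hE hx.snd' hx.snd') ha'
  have := GP.iterate (hb.bdd.pull sz)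
    (st := fun i j x => ∑ l : Fin (n (sz i)) with l.val < j,
      ((2 : ZMod (q (sz i))) ^ (j - 1 - l.val)) • a i x l)
    (F := fun i j x => x.2 + x.2 + a i x.1 j)
    ((GP.const (hb.ct.pull sz) fun _ => 0).congr fun i x => by simp) hF fun i j x => by
      have h : (Finset.univ.filter fun l : Fin (n (sz i)) => l.val < j.val + 1) =
          insert j (Finset.univ.filter fun l : Fin (n (sz i)) => l.val < j.val) := by
        ext l
        simp only [Finset.mem_filter, Finset.mem_univ, true_and, Finset.mem_insert, Fin.ext_iff]
        omega
      dsimp only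
      rw [h, Finset.sum_insert (by simp), add_comm, ← Finset.sum_add_distrib]
      congr 1
      · refine Finset.sum_congr rfl fun l hl => ?_
        have hl' : l.val < j.val := by simpa using hl
        rw [← add_smul, ← two_mul, ← pow_succ']
        congr 2
        omega
      · simp
  refine this.congr fun i x => ?_
  refine Finset.sum_congr ?_ fun _ _ => rfl
  ext l
  simp

theorem gp_ofBitsBE {b : ∀ i, α i → Fin (n (sz i)) → Bool} (h : GP sz b) :
    GP sz (β := fun i => Fin (2 ^ n (sz i))) fun i x => ofBitsBE (b i x) := by
  have h' : GP sz (α := fun i => Fin (n (sz i)) → Bool) (β := fun i => Fin (2 ^ n (sz i)))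
      fun i x => ofBitsBE x := by
    refine GP.of_bits' fun i l => ?_
    by_cases hl : l.val < n (sz i)
    · refine Or.inr ⟨finSigmaFinEquiv (n := fun _ => len Bool) ⟨(⟨l.val, hl⟩ : Fin _).rev, (0 : Fin 1)⟩,
        fun x => ?_⟩
      rw [code_pi]
      show (Nat.ofBits fun i => x i.rev).testBit l.val = _
      rw [Nat.testBit_ofBits_lt _ _ hl]
      rfl
    · refine Or.inl fun x => ?_
      show (Nat.ofBits fun i => x i.rev).testBit l.val = _
      rw [Nat.testBit_ofBits_ge _ _ (not_lt.1 hl)]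
  exact h'.comp h

theorem LenBounds.msg2 (hb : LenBounds n E C) : PolyLen (fun k => k) fun k => Msg2 (n k) (E k) :=
  PolyLen.pi (PolyBdd.const 2) (PolyLen.pi (hb.bdd.add (PolyBdd.const 1)) hb.ct)

theorem LenBounds.claim (hb : LenBounds n E C) :
    PolyLen (fun k => k) fun k => Claim (n k) (E k) (C k) := (hb.pk.prod hb.com).prod hb.fin

open Classical in
theorem gp_accepts1 (hb : LenBounds n E C) (hE : HomEnc.Efficient E) (hC : ComScheme.Efficient C)
    {par : ∀ i, α i → (C (sz i)).Par} {m : ∀ i, α i → Msg1 (n (sz i)) (E (sz i)) (C (sz i))}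
    {w : ∀ i, α i → Wit1 (n (sz i)) (E (sz i)) (C (sz i))} (hpar : GP sz par) (hm : GP sz m)
    (hw : GP sz w) : GP sz (β := fun _ => Bool) fun i x => accepts1 (par i x) (m i x, w i x) := by
  have c1 := GP.decEq (hb.com.pull sz) hm.snd'.fst' (gp_com hC hpar hw.fst'.fst'.fst' hw.fst'.fst'.snd')
  have c2 := GP.decEq (hb.ct.pull sz) (gp_horner hb hE hm.snd'.snd')
    (gp_enc hE hm.fst' hw.fst'.snd'.fst' hw.fst'.snd'.snd')
  have c3 := GP.decEq (hb.zmod.pull sz) hw.fst'.fst'.fst' hw.fst'.snd'.fst'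
  let sz' : (Σ i, Fin (n (sz i))) → ℕ := fun p => sz p.1
  have hwj := hw.snd'.unpi
  have z1 := GP.const (sz := sz') (α := fun p => α p.1) (hb.zmod.pull sz') fun _ => 0
  have z2 := GP.const (sz := sz') (α := fun p => α p.1) (hb.zmod.pull sz') fun _ => 1
  have d1 := GP.decEq (hb.ct.pull sz') hm.snd'.snd'.unpi
    (gp_enc (sz := sz') hE (hm.fst'.pull Sigma.fst) hwj.fst' hwj.snd')
  have d2 := (GP.decEq (hb.zmod.pull sz') hwj.fst' z1).or (GP.decEq (hb.zmod.pull sz') hwj.fst' z2)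
  have d3 := GP.pi (hb.bdd.pull sz) (f := fun i x j => zkBit (m i x).1 ((m i x).2.2 j) ((w i x).2 j))
    ((d1.and d2).congr fun p x => by
      rw [Bool.eq_iff_iff]
      simp [zkBit]
      exact fun _ => Iff.rfl)
  refine (((c1.and c2).and c3).and (d3.all (hb.bdd.pull sz))).congr fun i x => ?_
  rw [Bool.eq_iff_iff]
  simp [accepts1, zkAnswers, zkComEq, and_assoc]

theorem gp_extract (hb : LenBounds n E C) {w : ∀ i, α i → Wit1 (n (sz i)) (E (sz i)) (C (sz i))}
    (hw : GP sz w) : GP sz (β := fun i => Fin (2 ^ n (sz i))) fun i x => extract (w i x) := by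
  let sz' : (Σ i, Fin (n (sz i))) → ℕ := fun p => sz p.1
  have z := GP.const (sz := sz') (α := fun p => α p.1) (hb.zmod.pull sz') fun _ => 1
  exact gp_ofBitsBE (GP.pi (hb.bdd.pull sz) (f := fun i x j => decide (((w i x).2 j).1 = 1))
    (GP.decEq (hb.zmod.pull sz') hw.snd'.unpi.fst' z))

theorem gp_simClaim (hb : LenBounds n E C) (hE : HomEnc.Efficient E) (hC : ComScheme.Efficient C)
    {par : ∀ i, α i → (C (sz i)).Par}
    {m : ∀ i, α i → Option (Msg1 (n (sz i)) (E (sz i)) (C (sz i)) × Wit1 (n (sz i)) (E (sz i)) (C (sz i)))}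
    (hpar : GP sz par) (hm : GP sz m) :
    GP sz (β := fun i => Option (Claim (n (sz i)) (E (sz i)) (C (sz i))))
      fun i x => simClaim (par i x) (m i x) := by
  have hx : GP sz (fun i (x : α i × (Msg1 (n (sz i)) (E (sz i)) (C (sz i)) ×
    Wit1 (n (sz i)) (E (sz i)) (C (sz i)))) => x) := GP.id
  have hacc := gp_accepts1 hb hE hC (hpar.comp hx.fst') hx.snd'.fst' hx.snd'.snd'
  have hc := (hx.snd'.fst'.fst'.prod hx.snd'.fst'.snd'.fst').prod (gp_extract hb hx.snd'.snd')
  exact hm.bind (hb.claim.pull sz) (GP.ite (hb.claim.option.pull sz) hacc hc.some GP.none)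

theorem gp_simFlag (hb : LenBounds n E C) {v : ∀ i, α i → Fin (2 ^ n (sz i))}
    {l : ∀ i, α i → Fin (2 ^ n (sz i)) × Bool} (hv : GP sz v) (hl : GP sz l) :
    GP sz (β := fun _ => Fin 2 → Bool) fun i x => simFlag (v i x) (l i x) := by
  let sz' : (Σ _ : I, Fin 2) → ℕ := fun p => sz p.1
  have hl' := hl.pull (Sigma.fst : (Σ _ : I, Fin 2) → I)
  have e := GP.decEq (hb.fin.pull sz') hl'.fst' (hv.pull (Sigma.fst : (Σ _ : I, Fin 2) → I))
  have h2 : PolyLen sz' fun _ => Fin 2 := PolyLen.fin (PolyBdd.const 2)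
  have c := GP.decEq h2 (GP.const (α := fun p : Σ _ : I, Fin 2 => α p.1) h2 fun p => p.2)
    (GP.const h2 fun _ => 0)
  exact GP.pi (PolyBdd.const 2) (GP.ite PolyLen.bool c (hl'.snd'.or e) (hl'.snd'.or e.not))

/-- The simulated plaintexts are known and encrypted directly, so again no scalar multiple of a
ciphertext has to be computed. -/
theorem gp_simVectors (hb : LenBounds n E C) (hE : HomEnc.Efficient E)
    {pk : ∀ i, α i → (E (sz i)).PK} {f : ∀ i, α i → Fin 2 → Bool}
    {tape : ∀ i, α i → Tape1 (n (sz i)) (E (sz i))} (hpk : GP sz pk)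
    (hf : GP sz (β := fun _ => Fin 2 → Bool) f) (ht : GP sz tape) :
    GP sz (β := fun i => Msg2 (n (sz i)) (E (sz i)))
      fun i x => simVectors (pk i x) (f i x) (tape i x) := by
  have hn1 := hb.bdd.add (PolyBdd.const 1)
  let J : Type := Σ _ : I, Fin 2
  let sz' : J → ℕ := fun p => sz p.1
  let K : Type := Σ p : J, Fin (n (sz' p) + 1)
  let sz'' : K → ℕ := fun p => sz' p.1
  have hl : PolyLen sz'' fun p => Fin (n (sz'' p) + 1) := PolyLen.fin (hn1.pull sz'')
  have hπ : GP sz'' (α := fun p => α p.1.1) (β := fun p => Fin (n (sz'' p) + 1))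
      fun p x => (tape p.1.1 x).1 p.2 :=
    GP.permApply (I := K) (sz := sz'') (m := fun p => n (sz'' p) + 1)
      (f := fun p x => (tape p.1.1 x).1) (ht.fst'.pull fun p : K => p.1.1) fun p => p.2
  have hlast := GP.const (α := fun p : K => α p.1.1) hl fun p => Fin.last _
  have hf' := hf.unpi.pull (Sigma.fst : K → J)
  have hs := GP.subtypeVal.comp ht.snd'.fst'.unpi.unpi
  have hρ := ht.snd'.snd'.unpi.unpi
  have hz := GP.const (α := fun p : K => α p.1.1) (hb.zmod.pull sz'') fun _ => 0
  have hm := GP.ite (hb.zmod.pull sz'') ((GP.decEq hl hπ hlast).and hf') hz hs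
  exact GP.pi (PolyBdd.const 2) (GP.pi (hn1.pull sz')
    (gp_enc (sz := sz'') hE (hpk.pull fun p : K => p.1.1) hm hρ))

end SimCosts

/-! ### The simulated messages of `P₁`, its acceptance test and the double opening -/

section SimCosts

variable {q n : ℕ → ℕ} [∀ k, Fact (q k).Prime] {E : ∀ k, HomEnc (q k)}
  {C : ∀ k, ComScheme (ZMod (q k))} {I : Type} {sz : I → ℕ} {α : I → Type} [∀ i, BitCode (α i)]

theorem gp_simReply (hb : LenBounds n E C) (hE : HomEnc.Efficient E)
    {c : ∀ i, α i → Option (Claim (n (sz i)) (E (sz i)) (C (sz i)))}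
    {l : ∀ i, α i → Option (Fin (2 ^ n (sz i)) × Bool)}
    {tape : ∀ i, α i → Tape1 (n (sz i)) (E (sz i))} (hc : GP sz c) (hl : GP sz l)
    (ht : GP sz tape) :
    GP sz (β := fun i => Option (Msg2 (n (sz i)) (E (sz i))))
      fun i x => simReply (c i x) (l i x) (tape i x) := by
  have x : GP sz (fun i (x : (α i × Claim (n (sz i)) (E (sz i)) (C (sz i))) ×
    (Fin (2 ^ n (sz i)) × Bool)) => x) := GP.id
  have y : GP sz (fun i (y : α i × Claim (n (sz i)) (E (sz i)) (C (sz i))) => y) := GP.id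
  have f := gp_simFlag hb x.fst'.snd'.snd' x.snd'
  have v := gp_simVectors hb hE x.fst'.snd'.fst'.fst' f (ht.comp x.fst'.fst')
  exact hc.bind (hb.msg2.pull sz) ((hl.comp y.fst').bind (hb.msg2.pull sz) v.some)

theorem gp_zkOneMany (hb : LenBounds n E C) (hE : HomEnc.Efficient E)
    {pk : ∀ i, α i → (E (sz i)).PK} {D : ∀ i, α i → Fin (n (sz i) + 1) → (E (sz i)).CT}
    {w : ∀ i, α i → Wit3 (n (sz i)) (E (sz i))} (hpk : GP sz pk) (hD : GP sz D) (hw : GP sz w) :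
    GP sz (β := fun _ => Bool) fun i x => zkOneMany (pk i x) (D i x) (w i x) := by
  have h1 := (hE.isKey.gp.pull sz).comp (hpk.prod hw.snd')
  have h2 := (hE.isZero.gp.pull sz).comp
    (hw.snd'.prod (GP.select (hb.bdd.pull sz) (hb.ct.pull sz) hD hw.fst'))
  exact h1.and h2

theorem gp_simAccept (hb : LenBounds n E C) (hE : HomEnc.Efficient E) (hC : ComScheme.Efficient C)
    {par : ∀ i, α i → (C (sz i)).Par}
    {c : ∀ i, α i → Option (Claim (n (sz i)) (E (sz i)) (C (sz i)))}
    {D : ∀ i, α i → Option (Msg2 (n (sz i)) (E (sz i)))}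
    {m : ∀ i, α i → Option (Msg3 (n (sz i)) (C (sz i)) × Wit3 (n (sz i)) (E (sz i)))}
    (hpar : GP sz par) (hc : GP sz c) (hD : GP sz D) (hm : GP sz m) :
    GP sz (β := fun _ => Bool) fun i x => simAccept (par i x) (c i x) (D i x) (m i x) := by
  classical
  have ff : ∀ {α : I → Type} [∀ i, BitCode (α i)],
      GP sz (α := α) (β := fun _ => Bool) fun _ _ => false := GP.const PolyLen.bool _
  have tt : ∀ {α : I → Type} [∀ i, BitCode (α i)],
      GP sz (α := α) (β := fun _ => Bool) fun _ _ => true := GP.const PolyLen.bool _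
  have x1 : GP sz (fun i (x : α i × Claim (n (sz i)) (E (sz i)) (C (sz i))) => x) := GP.id
  have x2 : GP sz (fun i (x : (α i × Claim (n (sz i)) (E (sz i)) (C (sz i))) ×
    Msg2 (n (sz i)) (E (sz i))) => x) := GP.id
  have x3 : GP sz (fun i (x : ((α i × Claim (n (sz i)) (E (sz i)) (C (sz i))) ×
    Msg2 (n (sz i)) (E (sz i))) × (Msg3 (n (sz i)) (C (sz i)) × Wit3 (n (sz i)) (E (sz i)))) => x) :=
    GP.id
  have x4 : GP sz (fun i (x : (((α i × Claim (n (sz i)) (E (sz i)) (C (sz i))) ×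
    Msg2 (n (sz i)) (E (sz i))) × (Msg3 (n (sz i)) (C (sz i)) × Wit3 (n (sz i)) (E (sz i)))) ×
      (Fin (2 ^ n (sz i)) × (C (sz i)).Rnd)) => x) := GP.id
  have pk := x3.fst'.fst'.snd'.fst'.fst'
  have h2 : PolyLen sz fun _ => Fin 2 := PolyLen.fin (PolyBdd.const 2)
  have Du := GP.select (PolyBdd.const 1) ((PolyLen.pi (hb.bdd.add (PolyBdd.const 1)) hb.ct).pull sz)
    x3.fst'.snd' x3.snd'.fst'.fst'
  have many := gp_zkOneMany hb hE pk Du x3.snd'.snd'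
  have op := GP.decEq (hb.com.pull sz) x4.fst'.fst'.fst'.snd'.fst'.snd'
    (gp_com hC (hpar.comp x4.fst'.fst'.fst'.fst') (gp_cast hb x4.snd'.fst') x4.snd'.snd')
  have acc := many.and (GP.ite PolyLen.bool
    (GP.decEq h2 x3.snd'.fst'.fst' (GP.const h2 fun _ => 0))
    (x3.snd'.fst'.snd'.elim PolyLen.bool ff op) tt)
  exact hc.elim PolyLen.bool ff ((hD.comp x1.fst').elim PolyLen.bool ff
    ((hm.comp x2.fst'.fst').elim PolyLen.bool ff acc))

theorem gp_simSend (hb : LenBounds n E C) {l : ∀ i, α i → Option (Fin (2 ^ n (sz i)) × Bool)}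
    {m : ∀ i, α i → Option (Msg3 (n (sz i)) (C (sz i)) × Wit3 (n (sz i)) (E (sz i)))}
    {acc : ∀ i, α i → Bool} (hl : GP sz l) (hm : GP sz m) (ha : GP sz (β := fun _ => Bool) acc) :
    GP sz (β := fun i => Option (Fin (2 ^ n (sz i)))) fun i x => simSend (l i x) (m i x) (acc i x) := by
  have x : GP sz (fun i (x : α i × (Msg3 (n (sz i)) (C (sz i)) × Wit3 (n (sz i)) (E (sz i)))) => x) :=
    GP.id
  have y : GP sz (fun i (x : (α i × (Msg3 (n (sz i)) (C (sz i)) × Wit3 (n (sz i)) (E (sz i)))) ×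
    (Fin (2 ^ n (sz i)) × Bool)) => x) := GP.id
  have h2 : PolyLen sz fun _ => Fin 2 := PolyLen.fin (PolyBdd.const 2)
  have c := (GP.decEq h2 x.snd'.fst'.fst' (GP.const h2 fun _ => 1)).and (ha.comp x.fst')
  exact hm.bind (hb.fin.pull sz) (GP.ite (hb.fin.option.pull sz) c
    ((hl.comp x.fst').bind (hb.fin.pull sz) y.snd'.fst'.some) GP.none)

theorem gp_twoOpenings (hb : LenBounds n E C)
    {m₁ : ∀ i, α i → Option (Msg1 (n (sz i)) (E (sz i)) (C (sz i)) ×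
      Wit1 (n (sz i)) (E (sz i)) (C (sz i)))}
    {m₃ : ∀ i, α i → Option (Msg3 (n (sz i)) (C (sz i)) × Wit3 (n (sz i)) (E (sz i)))}
    (h₁ : GP sz m₁) (h₃ : GP sz m₃) :
    GP sz (β := fun i => (ZMod (q (sz i)) × (C (sz i)).Rnd) × (ZMod (q (sz i)) × (C (sz i)).Rnd))
      fun i x => twoOpenings (m₁ i x) (m₃ i x) := by
  have x : GP sz (fun i (x : α i × (Msg1 (n (sz i)) (E (sz i)) (C (sz i)) ×
    Wit1 (n (sz i)) (E (sz i)) (C (sz i)))) => x) := GP.id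
  have y : GP sz (fun i (x : α i × (Msg3 (n (sz i)) (C (sz i)) × Wit3 (n (sz i)) (E (sz i)))) => x) :=
    GP.id
  have w : GP sz (fun i (x : α i × (Fin (2 ^ n (sz i)) × (C (sz i)).Rnd)) => x) := GP.id
  have hz := (hb.zmod.prod hb.crnd).pull sz
  have d : GP sz (α := α) (β := fun i => ZMod (q (sz i)) × (C (sz i)).Rnd)
    fun _ _ => (0, Classical.arbitrary _) := GP.const hz _
  have hop := h₃.bind (γ := fun i => Fin (2 ^ n (sz i)) × (C (sz i)).Rnd)
    ((hb.fin.prod hb.crnd).pull sz) y.snd'.fst'.snd'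
  have h1 := h₁.elim (γ := fun i => ZMod (q (sz i)) × (C (sz i)).Rnd) hz d x.snd'.snd'.fst'.fst'
  have h2 := hop.elim (γ := fun i => ZMod (q (sz i)) × (C (sz i)).Rnd) hz d
    ((gp_cast hb w.snd'.fst').prod w.snd'.snd')
  exact h1.prod h2

end SimCosts

/-! ### The simulation of `P₁` is perfect unless a commitment is opened in two ways -/

section Simulation

variable {q n : ℕ} [Fact q.Prime] {E : HomEnc q} {C : ComScheme (ZMod q)}

/-- The bit proofs leave only the plaintexts `0` and `1`, so testing for `1` in `extract` loses
nothing. -/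
theorem accepts1_spec {par : C.Par} {x : Msg1 n E C × Wit1 n E C} (h : accepts1 par x = true) :
    x.1.2.1 = C.com par x.2.1.1.1 x.2.1.1.2 ∧
      ∑ j : Fin n, ((2 : ZMod q) ^ (n - 1 - j.val)) • x.1.2.2 j = E.enc x.1.1 x.2.1.2 ∧
      x.2.1.1.1 = x.2.1.2.1 ∧
      ∀ j, x.1.2.2 j = E.enc x.1.1 (bit q (extract x.2) j, (x.2.2 j).2) := by
  obtain ⟨h0, h4⟩ := (Bool.and_eq_true _ _).mp h
  have h4 := of_decide_eq_true h4
  simp only [zkAnswers, zkComEq, zkBit, decide_eq_true_eq] at h0 h4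
  obtain ⟨h1, h2, h3⟩ := h0
  refine ⟨h1, h2, h3, fun j => ?_⟩
  obtain ⟨h5, h6⟩ := h4 j
  rw [h5, extract, bit_ofBitsBE]
  congr 1
  refine Prod.ext ?_ rfl
  rcases h6 with h6 | h6 <;> simp [h6]

theorem simClaim_of_accepts1 {par : C.Par} {x : Msg1 n E C × Wit1 n E C}
    (h : accepts1 par x = true) :
    simClaim par (some x) = some ((x.1.1, x.1.2.1), extract x.2) := if_pos h

theorem simClaim_of_not_accepts1 {par : C.Par} {x : Msg1 n E C × Wit1 n E C}
    (h : ¬ accepts1 par x = true) : simClaim par (some x) = none := if_neg h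

theorem p1Reply_of_accepts1 {par : C.Par} {x : Msg1 n E C × Wit1 n E C}
    (h : accepts1 par x = true) (v₁ : Fin (2 ^ n)) (tape : Tape1 n E) :
    p1Reply par v₁ tape (some x) = some (p1Vectors v₁ tape x.1) :=
  if_pos (by simpa [accepts1] using h)

theorem p1Reply_of_not_accepts1 {par : C.Par} {x : Msg1 n E C × Wit1 n E C}
    (h : ¬ accepts1 par x = true) (v₁ : Fin (2 ^ n)) (tape : Tape1 n E) :
    p1Reply par v₁ tape (some x) = none :=
  if_neg (by simpa [accepts1] using h)

/-- The minimum is `x` iff `x ≤ v₁`, so the leaked pair determines both weak inequalities: `v₁ ≤ x`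
holds iff the inputs are equal or the minimum is not `x`. -/
theorem simFlag_minLeak {m : ℕ} (x v₁ : Fin m) (i : Fin 2) :
    simFlag x (minLeak x v₁) i = true ↔ cmpFlag x v₁ i := by
  by_cases hi : i = 0
  · simp only [simFlag, minLeak, cmpFlag, hi, decide_true, if_true, Bool.or_eq_true,
      decide_eq_true_eq, min_eq_left_iff]
    exact ⟨fun h => h.elim le_of_eq id, Or.inr⟩
  · simp only [simFlag, minLeak, cmpFlag, hi, decide_false, Bool.false_eq_true, if_false,
      Bool.or_eq_true, decide_eq_true_eq, Bool.not_eq_true', decide_eq_false_iff_not, min_eq_left_iff,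
      not_le]
    exact ⟨fun h => h.elim (fun h => h.ge) le_of_lt, fun h => h.eq_or_lt.imp Eq.symm id⟩

/-- The bijection absorbs everything in the reply that depends on `v₁` beyond the leakage: the place
of the zero goes into the permutation, the nonzero plaintexts into the scalars, the inherited
randomness into the re-randomization. This hides `v₁` information-theoretically, even for a
malformed public key. -/
theorem exists_p1Reply_eq (hn : 2 + 4 * (2 ^ n - 1) < q) (par : C.Par) (v₁ : Fin (2 ^ n))
    (m₁ : Option (Msg1 n E C × Wit1 n E C)) :
    ∃ e : Tape1 n E → Tape1 n E, Function.Bijective e ∧ ∀ tape, p1Reply par v₁ tape m₁ =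
      simReply (simClaim par m₁) ((simClaim par m₁).map fun c => minLeak c.2 v₁) (e tape) := by
  rcases m₁ with _ | x
  · exact ⟨id, Function.bijective_id, fun _ => rfl⟩
  by_cases h : accepts1 par x = true
  swap
  · exact ⟨id, Function.bijective_id, fun tape => by
      rw [p1Reply_of_not_accepts1 h, simClaim_of_not_accepts1 h]; rfl⟩
  obtain ⟨-, -, -, hA⟩ := accepts1_spec h
  obtain ⟨d, hd⟩ := exists_cVec_eq_zero_iff (q := q) hn (extract x.2) v₁
  let c : Fin 2 → Fin (n + 1) → ZMod q := cVec q 1 (bit q (extract x.2)) (bit q v₁)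
  -- Zeros are replaced by `1`: the scalar at such a place is multiplied away in the reply, and
  -- scaling must remain invertible.
  let c' : Fin 2 → Fin (n + 1) → ZMod q := fun i j => if c i j = 0 then 1 else c i j
  have hc' : ∀ i j, c' i j ≠ 0 := fun i j => by
    by_cases h : c i j = 0 <;> simp [c', h]
  let sh : Fin 2 → Fin (n + 1) → E.Rnd := rndShift (extract x.2) v₁ fun j => (x.2.2 j).2
  -- The transposition moves the place `d` of the zero to the last place, where `simVectors` expects
  -- it.
  let e : Tape1 n E → Tape1 n E := fun tape =>
    (Equiv.swap d (Fin.last n) * tape.1,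
      (fun i j => ⟨(tape.2.1 i j).1 * c' i (tape.1 j), mul_ne_zero (tape.2.1 i j).2 (hc' _ _)⟩),
      fun i j => tape.2.2 i j + (tape.2.1 i j).1 • sh i (tape.1 j))
  have he : Function.Injective e := by
    rintro ⟨π, s, ρ⟩ ⟨π', s', ρ'⟩ h
    simp only [e, Prod.mk.injEq] at h
    obtain ⟨h1, h2, h3⟩ := h
    obtain rfl := mul_left_cancel h1
    have hs : s = s' := by
      funext i j
      refine Subtype.ext (mul_right_cancel₀ (hc' i (π j)) ?_)
      exact congrArg Subtype.val (congrFun (congrFun h2 i) j)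
    subst hs
    have hρ : ρ = ρ' := by
      funext i j
      exact add_right_cancel (congrFun (congrFun h3 i) j)
    rw [hρ]
  refine ⟨e, Finite.injective_iff_bijective.1 he, fun tape => ?_⟩
  rw [p1Reply_of_accepts1 h, simClaim_of_accepts1 h]
  refine congrArg some (funext fun i => funext fun j => ?_)
  rw [p1Vectors_eq_enc v₁ tape x.1 (extract x.2) _ hA]
  refine congrArg (E.enc x.1.1) (Prod.ext ?_ rfl)
  have hsw : Equiv.swap d (Fin.last n) (tape.1 j) = Fin.last n ↔ tape.1 j = d := by
    rw [Equiv.swap_apply_eq_iff, Equiv.swap_apply_right]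
  have hif : (decide ((e tape).1 j = Fin.last n) &&
      simFlag (extract x.2) (minLeak (extract x.2) v₁) i) = true ↔ c i (tape.1 j) = 0 := by
    rw [Bool.and_eq_true, simFlag_minLeak, decide_eq_true_eq]
    exact (and_congr_left' hsw).trans (hd i _).symm
  show (tape.2.1 i j).1 * c i (tape.1 j) = if _ then _ else (tape.2.1 i j).1 * c' i (tape.1 j)
  by_cases hz : c i (tape.1 j) = 0
  · rw [if_pos (hif.2 hz), hz, mul_zero]
  · rw [if_neg (mt hif.1 hz)]
    simp [c', hz]

/-- A maliciously chosen public key might allow one ciphertext to encrypt several plaintexts. The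
secret key in the accepted witness excludes this, so the value in the equality proof is the
extracted one. -/
theorem zkOneMany_p1Vectors (hn : 2 + 4 * (2 ^ n - 1) < q) {par : C.Par}
    {x : Msg1 n E C × Wit1 n E C} (h : accepts1 par x = true) {v₁ : Fin (2 ^ n)} {tape : Tape1 n E}
    {u : Fin 2} {w : Wit3 n E} (hw : zkOneMany x.1.1 (p1Vectors v₁ tape x.1 u) w = true) :
    cmpFlag (extract x.2) v₁ u ∧ x.2.1.1.1 = ((extract x.2).val : ZMod q) := by
  obtain ⟨-, h2, h3, hA⟩ := accepts1_spec h
  obtain ⟨hk, hz⟩ := (Bool.and_eq_true _ _).mp hw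
  obtain ⟨d, hd⟩ := exists_cVec_eq_zero_iff (q := q) hn (extract x.2) v₁
  constructor
  · rw [p1Vectors_eq_enc v₁ tape x.1 (extract x.2) _ hA, E.isZero_enc _ _ hk, mul_eq_zero,
      or_iff_right (tape.2.1 u w.1).2, hd] at hz
    exact hz.2
  · simp only [hA] at h2
    rw [sum_smul_enc] at h2
    -- Two openings of one ciphertext differ by an encryption of the difference of the plaintexts.
    -- It equals the zero ciphertext, which the secret key recognizes as an encryption of `0`.
    have h4 := sub_eq_zero.2 h2.symm
    rw [← map_sub] at h4
    have h5 : E.isZero w.2 (E.enc x.1.1 (0, 0)) = true := (E.isZero_enc _ _ hk _ _).2 rfl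
    have h6 : E.enc x.1.1 (0, 0) = 0 := map_zero (E.enc x.1.1)
    rw [h6, ← h4] at h5
    rw [h3]
    exact sub_eq_zero.1 ((E.isZero_enc _ _ hk _ _).1 h5)

/-- Unless the commitment of `P₀` is opened in two ways, the simulator computes what `P₁` sends and
determines whether `P₁` outputs the minimum. -/
theorem p1Output_eq_of_simAccept (hn : 2 + 4 * (2 ^ n - 1) < q) (par : C.Par) (v₁ : Fin (2 ^ n))
    (tape : Tape1 n E) (m₁ : Option (Msg1 n E C × Wit1 n E C))
    (m₃ : Option (Msg3 n C × Wit3 n E)) {D : Option (Msg2 n E)} (hD : D = p1Reply par v₁ tape m₁) :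
    p1Send m₃ (p1Output par v₁ m₁ D m₃) =
        simSend ((simClaim par m₁).map fun c => minLeak c.2 v₁) m₃
          (simAccept par (simClaim par m₁) D m₃) ∧
      ((∀ c ∈ simClaim par m₁, c.2 ≤ v₁ →
          (twoOpenings m₁ m₃).1.1 ≠ (twoOpenings m₁ m₃).2.1 →
          C.com par (twoOpenings m₁ m₃).1.1 (twoOpenings m₁ m₃).1.2 ≠
            C.com par (twoOpenings m₁ m₃).2.1 (twoOpenings m₁ m₃).2.2) →
        p1Output par v₁ m₁ D m₃ = if simAccept par (simClaim par m₁) D m₃ = true then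
          (simClaim par m₁).map (fun c => min c.2 v₁) else none) := by
  subst hD
  rcases m₁ with _ | x
  · rcases m₃ with _ | ⟨⟨u, o⟩, w⟩ <;> simp [p1Send, p1Output, simSend, simClaim, simAccept]
  by_cases h : accepts1 par x = true
  swap
  · rw [p1Reply_of_not_accepts1 h, simClaim_of_not_accepts1 h]
    rcases m₃ with _ | ⟨⟨u, o⟩, w⟩ <;> simp [p1Send, p1Output, simSend, simAccept]
  obtain ⟨hV, -, -, -⟩ := accepts1_spec h
  rw [p1Reply_of_accepts1 h, simClaim_of_accepts1 h]
  rcases m₃ with _ | ⟨⟨u, o⟩, w⟩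
  · simp [p1Send, p1Output, simSend, simAccept]
  by_cases hw : zkOneMany x.1.1 (p1Vectors v₁ tape x.1 u) w = true
  swap
  · simp [p1Send, p1Output, simSend, simAccept, hw]
  obtain ⟨hf, hx⟩ := zkOneMany_p1Vectors hn h hw
  by_cases hu : u = 0
  · subst hu
    have hf : extract x.2 ≤ v₁ := hf
    refine ⟨by simp [p1Send, simSend], fun hb => ?_⟩
    rcases o with _ | o
    · simp [p1Output, simAccept]
    have hb := hb _ rfl hf
    simp only [twoOpenings, Option.elim, Option.bind] at hb
    by_cases ho : x.1.2.1 = C.com par (o.1.val : ZMod q) o.2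
    -- The witness of the equality proof and the message of `P₀` open the same commitment, so by
    -- `hb` they contain the same value.
    · have hv : x.2.1.1.1 = (o.1.val : ZMod q) := by
        by_contra hne
        exact hb hne (hV.symm.trans ho)
      have hlt : 2 ^ n ≤ q := by
        have := Nat.one_le_two_pow (n := n)
        omega
      have hval : extract x.2 = o.1 := Fin.ext (by
        rw [← val_cast_of_lt hlt (extract x.2), ← val_cast_of_lt hlt o.1, ← hx, hv])
      simp [p1Output, simAccept, hw, ho, ← hval, hf]
    · simp [p1Output, simAccept, hw, ho]
  -- The zero in vector `1` gives `v₁ ≤ extract x.2`, so the minimum is `v₁` and binding plays no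
  -- role.
  · obtain rfl : u = 1 := by omega
    have hf : v₁ ≤ extract x.2 := hf
    simp [p1Send, p1Output, simSend, simAccept, hw, minLeak, hf]

end Simulation

/-! ### Security against a malicious `P₀` -/

section Malicious

variable {q n : ℕ → ℕ} [∀ k, Fact (q k).Prime] {E : ∀ k, HomEnc (q k)}
  {C : ∀ k, ComScheme (ZMod (q k))}

theorem GP.map {I : Type} {sz : I → ℕ} {α β γ : I → Type} [∀ i, BitCode (α i)]
    [∀ i, BitCode (β i)] [∀ i, BitCode (γ i)] {o : ∀ i, α i → Option (β i)} {g : ∀ i, β i → γ i}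
    (hγ : PolyLen sz γ) (ho : GP sz o) (hg : GP sz g) :
    GP sz (β := fun i => Option (γ i)) fun i x => (o i x).map (g i) :=
  (ho.bind hγ (hg.comp GP.snd).some).congr fun i x => by cases o i x <;> rfl

/-- The simulator runs the adversary, sends the extracted input, answers with `simVectors` and
delivers the minimum iff `P₁` would accept. Only a double opening can distinguish the two
executions. -/
theorem secureMalicious0 (hn : ∀ k, 2 + 4 * (2 ^ n k - 1) < q k) (hE : HomEnc.Efficient E)
    (hC : ComScheme.Efficient C) (hBinding : ComScheme.Binding C) : SecureMalicious0 n E C := by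
  have hb := lenBounds hn hE hC
  intro aux out A
  obtain ⟨t₁, s₁, g₁, hg₁, e₁⟩ := A.poly1
  obtain ⟨t₂, s₂, g₂, hg₂, e₂⟩ := A.poly2
  obtain ⟨t₃, s₃, g₃, hg₃, e₃⟩ := A.poly3
  let Ω₁ : ℕ → Type := fun k => ∀ i : Fin (t₁ k), Fin (s₁ k i + 1)
  let Ω₂ : ℕ → Type := fun k => ∀ i : Fin (t₂ k), Fin (s₂ k i + 1)
  let Ω₃ : ℕ → Type := fun k => ∀ i : Fin (t₃ k), Fin (s₃ k i + 1)
  let X : ℕ → Type := fun k => Bits (aux k) × Fin (2 ^ n k) × (C k).Par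
  let St : ℕ → Type := fun k =>
    Bits (A.st k) × (C k).Par × Option (Claim (n k) (E k) (C k))
  let Lk : ℕ → Type := fun k => Option (Fin (2 ^ n k) × Bool)
  let R : ℕ → Type := fun k => Tape1 (n k) (E k) × (Ω₂ k × Ω₃ k)
  have hΩ₁ : Drawable Ω₁ := Drawable.draws hg₁.polyLen_left.snd
  have hΩ₂ : Drawable Ω₂ := Drawable.draws hg₂.polyLen_left.snd
  have hΩ₃ : Drawable Ω₃ := Drawable.draws hg₃.polyLen_left.snd
  have hR : Drawable R := (drawable_tape hb hE).prod (hΩ₂.prod hΩ₃)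
  have hst : PolyLen (fun k => k) fun k => Bits (A.st k) := hg₁.polyLen_right.fst
  have hSt : PolyLen (fun k => k) St := hst.prod (hb.par.prod hb.claim.option)
  have hLk : PolyLen (fun k => k) Lk := (hb.fin.prod PolyLen.bool).option
  have hBits : PolyLen (fun k => k) fun k => Bits (len (St k)) := hSt.mono fun k => by
    show ∑ _i : Fin (len (St k)), 1 ≤ _
    simp
  have hX : PolyLen (fun k => k) X := hg₁.polyLen_left.fst
  let F₁ : ∀ k, X k × Ω₁ k → St k := fun k x =>
    ((g₁ k x).1, x.1.2.2, simClaim x.1.2.2 (g₁ k x).2)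
  have hF₁ : GP (fun k => k) F₁ := by
    have x : GP (fun k => k) (fun k (x : X k × Ω₁ k) => x) := GP.id
    have y := hg₁.gp
    have par := x.fst'.snd'.snd'
    exact y.fst'.prod (par.prod (gp_simClaim hb hE hC par y.snd'))
  -- A simulator hands over its state as a bit string, so the state is passed on in encoded form.
  let G₁ : ∀ k, X k × Ω₁ k → Bits (len (St k)) × Option (Fin (2 ^ n k)) := fun k x =>
    (code (F₁ k x), (F₁ k x).2.2.map Prod.snd)
  have hG₁ : PolySize G₁ :=
    (hF₁.encode.prod (hF₁.snd'.snd'.map hb.fin GP.snd)).polySize (hX.prod hΩ₁.polyLen)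
      (hBits.prod hb.fin.option)
  let D₂ : ∀ k, St k × (Lk k × R k) → Option (Msg2 (n k) (E k)) := fun k x =>
    simReply x.1.2.2 x.2.1 x.2.2.1
  have hD₂ : GP (fun k => k) (β := fun k => Option (Msg2 (n k) (E k))) D₂ := by
    have x : GP (fun k => k) (fun k (x : St k × (Lk k × R k)) => x) := GP.id
    exact gp_simReply hb hE x.fst'.snd'.snd' x.snd'.fst' x.snd'.snd'.fst'
  let T₂ : ∀ k, St k × (Lk k × R k) →
      Bits (A.st k) × Option (Msg3 (n k) (C k) × Wit3 (n k) (E k)) := fun k x =>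
    g₂ k ((x.1.1, D₂ k x), x.2.2.2.1)
  have hT₂ : GP (fun k => k) T₂ := by
    have x : GP (fun k => k) (fun k (x : St k × (Lk k × R k)) => x) := GP.id
    exact hg₂.gp.comp ((x.fst'.fst'.prod hD₂).prod x.snd'.snd'.snd'.fst')
  let acc : ∀ k, St k × (Lk k × R k) → Bool := fun k x =>
    simAccept x.1.2.1 x.1.2.2 (D₂ k x) (T₂ k x).2
  have hacc : GP (fun k => k) (β := fun _ => Bool) acc := by
    have x : GP (fun k => k) (fun k (x : St k × (Lk k × R k)) => x) := GP.id
    exact gp_simAccept hb hE hC x.fst'.snd'.fst' x.fst'.snd'.snd' hD₂ hT₂.snd'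
  let F₂ : ∀ k, St k × (Lk k × R k) → Bits (out k) × Bool := fun k x =>
    (g₃ k (((T₂ k x).1, simSend x.2.1 (T₂ k x).2 (acc k x)), x.2.2.2.2), acc k x)
  have hF₂ : GP (fun k => k) F₂ := by
    have x : GP (fun k => k) (fun k (x : St k × (Lk k × R k)) => x) := GP.id
    have send := gp_simSend hb x.snd'.fst' hT₂.snd' hacc
    exact (hg₃.gp.comp ((hT₂.fst'.prod send).prod x.snd'.snd'.snd'.snd')).prod hacc
  -- The second phase has to be defined on all bit strings, not only on codes of states.
  obtain ⟨F₂', hF₂', eF₂⟩ := hF₂.exists_extension fun k =>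
    code_surjective_prod (code_surjective_bits _) code_surjective_bool
  let G₂ : ∀ k, (Bits (len (St k)) × Lk k) × R k → Bits (out k) × Bool := fun k x =>
    F₂' k (x.1.1, (x.1.2, x.2))
  have hG₂ : PolySize G₂ := by
    have x : GP (fun k => k) (fun k (x : (Bits (len (St k)) × Lk k) × R k) => x) := GP.id
    exact (hF₂'.comp (x.fst'.fst'.prod (x.fst'.snd'.prod x.snd'))).polySize
      ((hBits.prod hLk).prod hR.polyLen) (hg₃.polyLen_right.prod PolyLen.bool)
  let S : Simulator0 n C aux out :=
    { st := fun k => len (St k)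
      run1 := fun k x => (PMF.uniformOfFintype (Ω₁ k)).map fun ω => G₁ k (x, ω)
      run2 := fun k x => (PMF.uniformOfFintype (R k)).map fun ω => G₂ k (x, ω)
      poly1 := hΩ₁.polySampler hG₁
      poly2 := hR.polySampler hG₂ }
  refine ⟨S, fun z v₀ v₁ D hD => ?_⟩
  let st : ∀ k, Ω₁ k → (C k).Par → St k := fun k ω par => F₁ k ((z k, v₀ k, par), ω)
  let m₁ : ∀ k, Ω₁ k → (C k).Par → Option (Msg1 (n k) (E k) (C k) × Wit1 (n k) (E k) (C k)) :=
    fun k ω par => (g₁ k ((z k, v₀ k, par), ω)).2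
  let lk : ∀ k, Ω₁ k → (C k).Par → Lk k := fun k ω par =>
    (st k ω par).2.2.map fun c => minLeak c.2 (v₁ k)
  let inp : ∀ k, Ω₁ k → R k → (C k).Par → St k × (Lk k × R k) := fun k ω r par =>
    (st k ω par, (lk k ω par, r))
  let idl : ∀ k, Ω₁ k → R k → (C k).Par → Bits (out k) × Option (Fin (2 ^ n k)) :=
    fun k ω r par => ((F₂ k (inp k ω r par)).1, if acc k (inp k ω r par) = true then
      (st k ω par).2.2.map (fun c => min c.2 (v₁ k)) else none)
  let rl : ∀ k, Ω₁ k → R k → (C k).Par → Bits (out k) × Option (Fin (2 ^ n k)) :=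
    fun k ω r par => ((F₂ k (inp k ω r par)).1,
      p1Output par (v₁ k) (m₁ k ω par) (D₂ k (inp k ω r par)) (T₂ k (inp k ω r par)).2)
  -- The commitment parameters are drawn last: with all other randomness fixed, an attack on binding
  -- is a deterministic function of them.
  have hswap : ∀ k (Y : Ω₁ k → R k → (C k).Par → Bits (out k) × Option (Fin (2 ^ n k))),
      ((PMF.uniformOfFintype (Ω₁ k)).bind fun ω => (PMF.uniformOfFintype (R k)).bind fun r =>
        (C k).gen.map (Y ω r)) = (C k).gen.bind fun par => (PMF.uniformOfFintype (Ω₁ k)).bind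
          fun ω => (PMF.uniformOfFintype (R k)).bind fun r => PMF.pure (Y ω r par) := by
    intro k Y
    rw [PMF.bind_comm (C k).gen]
    refine bind_congr' _ fun ω => ?_
    rw [PMF.bind_comm (C k).gen]
    rfl
  have hideal : ∀ k, ideal0 S k (z k) (v₀ k) (v₁ k) = (PMF.uniformOfFintype (Ω₁ k)).bind fun ω =>
      (PMF.uniformOfFintype (R k)).bind fun r => (C k).gen.map (idl k ω r) := by
    intro k
    show ((C k).gen.bind fun par => ((PMF.uniformOfFintype (Ω₁ k)).map fun ω =>
      G₁ k ((z k, v₀ k, par), ω)).bind fun s => ((PMF.uniformOfFintype (R k)).map fun ω =>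
        G₂ k ((s.1, s.2.map fun x₀ => minLeak x₀ (v₁ k)), ω)).bind fun o =>
          PMF.pure (o.1, if o.2 = true then s.2.map (fun x₀ => min x₀ (v₁ k)) else none)) = _
    rw [hswap]
    refine bind_congr' _ fun par => (PMF.bind_map _ _ _).trans (bind_congr' _ fun ω =>
      (PMF.bind_map _ _ _).trans (bind_congr' _ fun r => ?_))
    simp only [Function.comp, G₁, G₂, Option.map_map, eF₂]
    rfl
  have hreal : ∀ k, real0 A k (z k) (v₀ k) (v₁ k) = (PMF.uniformOfFintype (Ω₁ k)).bind fun ω =>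
      (PMF.uniformOfFintype (R k)).bind fun r => (C k).gen.map (rl k ω r) := by
    intro k
    rw [hswap]
    show ((C k).gen.bind fun par => (exec par (⟨fun p => A.run1 k (z k, v₀ k, p), A.run2 k,
      A.run3 k⟩ : Party0 (n k) (E k) (C k) (Bits (A.st k)) (Bits (A.st k)) (Bits (out k)))
        (v₁ k)).bind fun r => PMF.pure (r.1, r.2.2)) = _
    refine bind_congr' _ fun par => ?_
    simp only [exec_eq, ← e₁, ← e₂, ← e₃, PMF.bind_map, Function.comp_def, PMF.bind_bind,
      PMF.pure_bind]
    rw [PMF.bind_comm]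
    refine bind_congr' _ fun ω => ?_
    -- The tape of `P₁` is reparametrized by `e`; it stays uniform, and real and simulated reply
    -- agree outcome by outcome.
    obtain ⟨e, he, hD⟩ := exists_p1Reply_eq (hn k) par (v₁ k) (m₁ k ω par)
    refine Eq.trans ?_ (bind_uniform_prod (α := Tape1 (n k) (E k)) (β := Ω₂ k × Ω₃ k) _).symm
    conv_rhs => rw [← uniform_map_of_bijective he, PMF.bind_map]
    refine bind_congr' _ fun tape => ?_
    refine Eq.trans ?_ (bind_uniform_prod (α := Ω₂ k) (β := Ω₃ k) _).symm
    refine bind_congr' _ fun ω₂ => bind_congr' _ fun ω₃ => congrArg PMF.pure ?_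
    have hD' : D₂ k (inp k ω (e tape, (ω₂, ω₃)) par) = p1Reply par (v₁ k) tape (m₁ k ω par) :=
      (hD tape).symm
    have hs := (p1Output_eq_of_simAccept (hn k) par (v₁ k) tape (m₁ k ω par)
      (T₂ k (inp k ω (e tape, (ω₂, ω₃)) par)).2 hD').1
    have hr : rl k ω (e tape, (ω₂, ω₃)) par = (g₃ k (((T₂ k (inp k ω (e tape, (ω₂, ω₃)) par)).1,
        p1Send (T₂ k (inp k ω (e tape, (ω₂, ω₃)) par)).2 (p1Output par (v₁ k) (m₁ k ω par)
          (D₂ k (inp k ω (e tape, (ω₂, ω₃)) par)) (T₂ k (inp k ω (e tape, (ω₂, ω₃)) par)).2)), ω₃),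
        p1Output par (v₁ k) (m₁ k ω par) (D₂ k (inp k ω (e tape, (ω₂, ω₃)) par))
          (T₂ k (inp k ω (e tape, (ω₂, ω₃)) par)).2) := by
      rw [hs]
    have ht : T₂ k (inp k ω (e tape, (ω₂, ω₃)) par) =
        g₂ k (((st k ω par).1, p1Reply par (v₁ k) tape (m₁ k ω par)), ω₂) := by
      rw [← hD']
    refine Eq.trans ?_ hr.symm
    rw [ht, hD']
  -- This is the leakage in the case that the extracted input is at most `v₁`. A double opening is
  -- excluded only in that case, so the attack on binding, with `v₁` hardwired, can do without
  -- computing a minimum.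
  let lk' : ∀ k, Ω₁ k → (C k).Par → Lk k := fun k ω par =>
    (st k ω par).2.2.map fun c => (c.2, decide (c.2 = v₁ k))
  let B : ∀ k, Ω₁ k → R k → (C k).Par →
      (ZMod (q k) × (C k).Rnd) × (ZMod (q k) × (C k).Rnd) := fun k ω r par =>
    twoOpenings (m₁ k ω par) (T₂ k (st k ω par, (lk' k ω par, r))).2
  obtain ⟨p, hp⟩ : GP (I := Σ k, Ω₁ k × R k) (fun i => i.1) (α := fun i => (C i.1).Par)
      (β := fun i => (ZMod (q i.1) × (C i.1).Rnd) × (ZMod (q i.1) × (C i.1).Rnd))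
      fun i par => B i.1 i.2.1 i.2.2 par := by
    let sz : (Σ k, Ω₁ k × R k) → ℕ := fun i => i.1
    have x : GP sz (fun i (x : (C i.1).Par) => x) := GP.id
    have y : GP sz (fun i (y : (C i.1).Par × Claim (n i.1) (E i.1) (C i.1)) => y) := GP.id
    have i₁ := ((GP.const (hX.fst.pull sz) fun i => z i.1).prod
      ((GP.const (hb.fin.pull sz) fun i => v₀ i.1).prod x)).prod
        (GP.const (hΩ₁.polyLen.pull sz) fun i => i.2.1)
    have hs := (hF₁.pull sz).comp i₁
    have hm := ((hg₁.gp.pull sz).comp i₁).snd'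
    have c := GP.decEq (hb.fin.pull sz) y.snd'.snd' (GP.const (hb.fin.pull sz) fun i => v₁ i.1)
    have l := hs.snd'.snd'.bind ((hb.fin.prod PolyLen.bool).pull sz) (y.snd'.snd'.prod c).some
    have hl : GP sz (β := fun i => Lk i.1) fun i par => lk' i.1 i.2.1 par :=
      l.congr fun i par => Option.map_eq_bind.symm
    have hT := (hT₂.pull sz).comp (hs.prod (hl.prod (GP.const (hR.polyLen.pull sz) fun i => i.2.2)))
    exact gp_twoOpenings (sz := sz) hb hm hT.snd'
  obtain ⟨ε, hε, -, hε'⟩ := hBinding.exists_bound hb.par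
    ((hb.zmod.prod hb.crnd).prod (hb.zmod.prod hb.crnd)) p
  refine hε.of_abs_le fun k => ?_
  rw [abs_abs]
  dsimp only
  rw [hideal, hreal]
  refine abs_prob_bind_sub_le _ _ _ _ fun ω => abs_prob_bind_sub_le _ _ _ _ fun r => ?_
  rw [prob_map, prob_map]
  refine (abs_prob_sub_le_prob _ fun par hbad => ?_).trans (hε' k (B k ω r) (hp ⟨k, ω, r⟩))
  obtain ⟨e, he, hDe⟩ := exists_p1Reply_eq (hn k) par (v₁ k) (m₁ k ω par)
  -- The tape of the simulator comes from a real tape, so the analysis of real replies applies to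
  -- the simulated one.
  obtain ⟨tape, ht⟩ := he.2 r.1
  have hD' : D₂ k (inp k ω r par) = p1Reply par (v₁ k) tape (m₁ k ω par) := by
    rw [hDe, ht]
  have hout := (p1Output_eq_of_simAccept (hn k) par (v₁ k) tape (m₁ k ω par)
    (T₂ k (inp k ω r par)).2 hD').2 fun c hc hle hne heq => ?_
  · exact congrArg (D k) (Prod.ext rfl hout)
  have hlk : lk k ω par = lk' k ω par := by
    have hc' : (st k ω par).2.2 = some c := hc
    simp only [lk, lk', hc', Option.map_some, minLeak, min_eq_left hle]
  have hB : B k ω r par = twoOpenings (m₁ k ω par) (T₂ k (inp k ω r par)).2 := by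
    simp only [B, inp, hlk]
  rw [← hB] at hne heq
  exact decide_eq_false_iff_not.1 hbad ⟨hne, heq⟩

end Malicious

end BankToClient

end

theorem mainTheorem5 (q n : ℕ → ℕ) [∀ k, Fact (q k).Prime]
    (hn : ∀ k, 2 + 4 * (2 ^ n k - 1) < q k)
    (E : ∀ k, BankToClient.HomEnc (q k)) (C : ∀ k, BankToClient.ComScheme (ZMod (q k)))
    (hE : BankToClient.HomEnc.Efficient E) (hC : BankToClient.ComScheme.Efficient C)
    (hEnc : BankToClient.HomEnc.Secure E)
    (hHiding : BankToClient.ComScheme.Hiding C) (hBinding : BankToClient.ComScheme.Binding C) :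
    BankToClient.Correct n E C ∧ BankToClient.SecureMalicious0 n E C ∧
      BankToClient.SecureSemiHonest1 n E C := by
  exact ⟨BankToClient.correct hn E C, BankToClient.secureMalicious0 hn hE hC hBinding,
    BankToClient.secureSemiHonest1 hn hE hC hEnc hHiding⟩
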